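/- Fix $d\ge 2$. Basis states of $n$ qudits are $|c_1\cdots c_n\rangle$, $c_i\in\{0,\dots,d-1\}$ ($c_1$ most significant), ordered lexicographically. A control word $C=[C_1\cdots C_n]$ has letters in $\{0,\dots,d-1\}\sqcup\{*\}\sqcup\{T\}$, with exactly one letter $T$; for $V\in U(d)$ the operator $\wedge(C,V)$ applies $V$ to the qudit at the position of $T$ on the basis states that agree with every numeric letter of $C$, and fixes the other basis states. It is *$k$-controlled* if $C$ has $k$ numeric letters. Let $\mathtt{INC}|j\rangle=|j+1 \bmod d\rangle$, and let $\mathtt{CINC}$ be the two-qudit gate that applies $\mathtt{INC}$ to the target if and only if the control is in the state $|d-1\rangle$. *State reduction.* The $\clubsuit$-sequence of length-$n$ words is defined recursively (empty for $n=0$): prefix each $q=0,\dots,d-1$ in turn to the sequence for $n-1$, then append $\clubsuit^n$. To reduce a vector $\psi$ to a multiple of $|0\cdots0\rangle$, go through its terms $t=t_1\cdots t_{\ell-1}\clubsuit\cdots\clubsuit$, updating $\psi$; each contributes $\wedge(C,V)$ with $T$ at position $\ell$, a control on the rightmost numeric letter $>0$ of $t$ (if any), and $V$ the Householder reflection taking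 $\sum_k\psi_{t_1\cdots t_{\ell-1}k0\cdots0}|k\rangle$ to a multiple of $|0\rangle$. Reduction to a multiple of $|m\rangle$ is obtained by conjugating with $\bigotimes_i\mathtt{INC}^{m_i}$. *Triangle.* For $n=1$, apply one one-qudit unitary, given by a Householder QR reduction. For $n\ge2$, split the matrix into $d\times d$ blocks of size $d^{n-1}$. Reduce the top-left block recursively on the bottom $n-1$ lines. Then for $m=0,\dots,d-2$: for every column $mc$ ($c$ a word of length $n-1$, in increasing order), (i) for $l=m+1,\dots,d-1$ reduce the part of the column in block-row $l$ to a multiple of $|c\rangle$ by the state reduction on the bottom $n-1$ lines with an extra control on the value $l$ of the top qudit, and (ii) clear the entries in the rows $xc$, $x>m$, by one $\wedge(Tc,V)$ with $V$ a Householder reflection acting on the levels $\ge m$; after these columns, reduce the $(m+1)$-st diagonal block recursively with an extra control on the value $m+1$ of the top qudit. *Controlled operations without ancillas.* $\wedge_k$ denotes $k$ controls, all on $|d-1\rangle$; other control values are reached by conjugating the control lines with powers of $\mathtt{INC}$. $\wedge_1(V)$ is built from a spectral decomposition of $V$, each eigenvalue $\xi^d$ being realized by $\wedge_1(\xi I)\,\mathtt{CINC}\,(I\otimes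 D)\,\mathtt{CINC}^{-1}(I\otimes D^{-1})$, $D=\sum_j\xi^j|j\rangle\langle j|$, conjugated by a one-qudit unitary. For $k\ge2$, $\wedge_k(V)=\wedge_{k-1}(X)[\wedge_{k-1}(\mathtt{INC})\wedge_1(X^\dagger)]^{d-1}\wedge_{k-1}(\mathtt{INC})\wedge_1(X^{d-1})$ with $X=V^{1/d}$, where $\wedge_{k-1}(\mathtt{INC})$ targets one of the controls. Here $\wedge_1(\mathtt{INC})=\mathtt{CINC}$, $\wedge_2(\mathtt{INC})$ is given by the previous formula, and for $k\ge3$, $\wedge_k(\mathtt{INC})=[\wedge_{\lfloor (k+1)/2\rfloor}(\mathtt{INC})\wedge_{\lceil (k+1)/2\rceil}(\mathtt{INC})]^d$, where the first-performed factor targets a borrowed line that is one of the controls of the other factor. *Synthesis.* If Triangle outputs $O_1,\dots,O_p$ on $U$ and $W=O_p\cdots O_1U$, the circuit for $U$ realizes $W$ by $d^n$ phase operations with $n-1$ controls each, followed by $O_p^\dagger,\dots,O_1^\dagger$, every controlled operation being expanded as above. **Theorem.** 1. For every $n\ge1$ and every unitary $U$ of size $d^n\times d^n$, all gates $V$ of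 the operations $\wedge(C,V)$ output by Triangle are unitary, and $O_p\cdots O_1U$ is diagonal. 2. The number $f(n,k)$ of $k$-controlled operations output by Triangle does not depend on $U$, and there is $n_0$ such that $f(n,k)\le d^{2n-k+4}$ for all $n\ge n_0$ and all $k\ge0$. 3. For every $n\ge1$ and every such $U$, the synthesis circuit uses only one-qudit unitaries, $\mathtt{CINC}$ and $\mathtt{CINC}^{-1}$ on the $n$ qudits (no ancillas), equals $U$ exactly, and the total number of its $\mathtt{CINC}$ and $\mathtt{CINC}^{-1}$ gates is at most $$2(n+1)^{2+\log_2 d}\,d^{n+4}+26\,d^{2n+8},$$ which is $O(d^{2n})$ as $n\to\infty$. 4. This is asymptotically optimal: there is $a>0$ (depending only on $d$) such that for all large $n$ there is a unitary $U$ on $n$ qudits for which every ancilla-free circuit of arbitrary one-qudit and two-qudit unitary gates equal to $U$ contains at least $a\,d^{2n}$ two-qudit gates. -/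

import Mathlib

open scoped Matrix

namespace QuditTriangle

noncomputable section

/-! ### Operators and controlled one-qudit operators

A dit string of length `n` is a function `Fin n → Fin d`; position `0` is the most significant
qudit (the top line of a circuit diagram).  The state space of `n` qudits has the dit strings as
its computational basis. -/

/-- One-qudit operators. -/
abbrev Op1 (d : ℕ) := Matrix (Fin d) (Fin d) ℂ

/-- Two-qudit operators. -/
abbrev Op2 (d : ℕ) := Matrix (Fin d × Fin d) (Fin d × Fin d) ℂ

/-- `n`-qudit operators. -/
abbrev OpN (d n : ℕ) := Matrix (Fin n → Fin d) (Fin n → Fin d) ℂ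

/-- Prefix the letter `q` (most significant dit) to a dit string. -/
def pre {d n : ℕ} (q : Fin d) (x : Fin n → Fin d) : Fin (n + 1) → Fin d :=
  Fin.cons (α := fun _ => Fin d) q x

/-- All dit strings of length `n` in increasing (lexicographic) order. -/
def words (d : ℕ) : (n : ℕ) → List (Fin n → Fin d)
  | 0 => [Fin.elim0]
  | n + 1 => (List.finRange d).flatMap fun q => (words d n).map (pre q)

/-- The controlled one-qudit operator `∧(C, V)`.  The control word `C` has the letter `T` at
position `target`, the numeric letter `q` at the positions `i` with `ctrl i = some q`, and the
letter `*` at the other positions. -/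
structure CtrlOp (d n : ℕ) where
  target : Fin n
  ctrl : Fin n → Option (Fin d)
  ctrl_target : ctrl target = none
  gate : Op1 d

namespace CtrlOp

/-- The control word matches a dit string if each numeric letter does. -/
def Matches {d n : ℕ} (o : CtrlOp d n) (x : Fin n → Fin d) : Prop :=
  ∀ i q, o.ctrl i = some q → x i = q

open Classical in
/-- The `n`-qudit operator: apply the gate to the target qudit of those basis states that match
the control word, and fix the other basis states. -/
def toMatrix {d n : ℕ} (o : CtrlOp d n) : OpN d n := fun x y =>
  if o.Matches y then
    (if ∀ i, i ≠ o.target → x i = y i then o.gate (x o.target) (y o.target) else 0)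
  else (if x = y then 1 else 0)

/-- The number of controls, i.e. of numeric letters of the control word. -/
def numControls {d n : ℕ} (o : CtrlOp d n) : ℕ :=
  (Finset.univ.filter fun i => (o.ctrl i).isSome = true).card

/-- View an operation on `n` qudits as one on the bottom `n` of `n + 1` lines, with the letter
`a` (a control on a value, or `*` for `none`) on the new most significant line. -/
def addLine {d n : ℕ} (a : Option (Fin d)) (o : CtrlOp d n) : CtrlOp d (n + 1) where
  target := o.target.succ
  ctrl := Fin.cons (α := fun _ => Option (Fin d)) a o.ctrl
  ctrl_target := by simpa using o.ctrl_target
  gate := o.gate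

/-- Conjugation by `⊗ₖ INC ^ (m k)`: the numeric letters of the control word are shifted by `m`,
and the gate `V` becomes `INC ^ s V INC ^ (-s)` with `s = m target`. -/
def shift {d n : ℕ} (m : Fin n → Fin d) (o : CtrlOp d n) : CtrlOp d n where
  target := o.target
  ctrl := fun i => (o.ctrl i).map (· + m i)
  ctrl_target := by simp [o.ctrl_target]
  gate := o.gate.submatrix (· - m o.target) (· - m o.target)

/-- The inverse operation `∧(C, V†)`. -/
def adjoint {d n : ℕ} (o : CtrlOp d n) : CtrlOp d n where
  target := o.target
  ctrl := o.ctrl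
  ctrl_target := o.ctrl_target
  gate := o.gateᴴ

end CtrlOp

/-- The operator obtained by performing the operations of a list in order, the head first. -/
def run {d n : ℕ} : List (CtrlOp d n) → OpN d n
  | [] => 1
  | o :: os => run os * o.toMatrix

/-! ### Householder reflections and state synthesis -/

/-- The phase `z / |z|` of a complex number, with the convention that `0` has phase `1`. -/
def phase (z : ℂ) : ℂ := if z = 0 then 1 else z / (‖z‖ : ℂ)

/-- The one-qudit Householder reflection that takes `ψ` to a multiple of `|m⟩`:
`I - (2 / ⟨η|η⟩) |η⟩⟨η|` with `η = ψ - √⟨ψ|ψ⟩ (ψ_m / |ψ_m|) |m⟩`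
(it is the identity if `η = 0`). -/
def householder {d : ℕ} (m : Fin d) (ψ : Fin d → ℂ) : Op1 d :=
  let η : Fin d → ℂ :=
    ψ - ((Real.sqrt (∑ k, ‖ψ k‖ ^ 2) : ℂ) * phase (ψ m)) • Pi.single m (1 : ℂ)
  1 - (2 / ((∑ k, ‖η k‖ ^ 2 : ℝ) : ℂ)) • Matrix.vecMulVec η (star η)

/-- The vector `v` with its entries before position `m` replaced by `0`. -/
def below {d : ℕ} (m : Fin d) (v : Fin d → ℂ) : Fin d → ℂ := fun x => if x < m then 0 else v x

/-- The unitary factor of the QR reduction of a `d × d` matrix `A`: the product of the Householder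
reflections that clear the entries below the diagonal, column by column. -/
def qrGate {d : ℕ} (A : Op1 d) : Op1 d :=
  (List.finRange d).foldl (fun Q j => householder j (below j fun x => (Q * A) x j) * Q) 1

/-- A word of length `n` made of numeric letters followed by at least one `♣`: either all the
letters are `♣`, or the word is a numeric letter followed by such a word. -/
inductive ClubTerm (d : ℕ) : ℕ → Type
  | clubs {n : ℕ} : ClubTerm d (n + 1)
  | cons {n : ℕ} (q : Fin d) (t : ClubTerm d n) : ClubTerm d (n + 1)

/-- The `♣`-sequence: the sequence of length `n - 1` words prefixed by each of `0, …, d - 1` in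
turn, followed by `♣ⁿ`. -/
def clubSeq (d : ℕ) : (n : ℕ) → List (ClubTerm d n)
  | 0 => []
  | n + 1 => ((List.finRange d).flatMap fun q => (clubSeq d n).map (ClubTerm.cons q))
      ++ [ClubTerm.clubs]

namespace ClubTerm

/-- The position of the leftmost `♣`. -/
def target {d : ℕ} : {n : ℕ} → ClubTerm d n → Fin n
  | _, clubs => 0
  | _, cons _ t => t.target.succ

/-- Does the word contain a numeric letter greater than `0`? -/
def hasPos {d : ℕ} [NeZero d] : {n : ℕ} → ClubTerm d n → Bool
  | _, clubs => false
  | _, cons q t => decide (q ≠ 0) || t.hasPos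

/-- The controls: only the rightmost numeric letter greater than `0`, if there is one. -/
def ctrl {d : ℕ} [NeZero d] : {n : ℕ} → ClubTerm d n → Fin n → Option (Fin d)
  | _, clubs => fun _ => none
  | _, cons q t => Fin.cons (α := fun _ => Option (Fin d))
      (if q ≠ 0 ∧ t.hasPos = false then some q else none) t.ctrl

/-- The dit string `t₁ ⋯ t_{ℓ-1} k 0 ⋯ 0`, where `ℓ` is the position of the leftmost `♣`. -/
def fill {d : ℕ} [NeZero d] : {n : ℕ} → ClubTerm d n → Fin d → (Fin n → Fin d)
  | _, clubs, k => pre k 0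
  | _, cons q t, k => pre q (t.fill k)

theorem ctrl_target {d : ℕ} [NeZero d] : ∀ {n : ℕ} (t : ClubTerm d n), t.ctrl t.target = none
  | _, clubs => rfl
  | _, cons q t => by simpa [ctrl, target] using ctrl_target t

/-- Single-`♣`-Householder: the operation that a term of the `♣`-sequence contributes when the
current state is `ψ`. -/
def op {d n : ℕ} [NeZero d] (t : ClubTerm d n) (ψ : (Fin n → Fin d) → ℂ) : CtrlOp d n where
  target := t.target
  ctrl := t.ctrl
  ctrl_target := t.ctrl_target
  gate := householder 0 fun k => ψ (t.fill k)

end ClubTerm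

/-- Iterate Single-`♣`-Householder over a list of terms, updating the state. -/
def clubSweep {d n : ℕ} [NeZero d] :
    List (ClubTerm d n) → ((Fin n → Fin d) → ℂ) → List (CtrlOp d n)
  | [], _ => []
  | t :: ts, ψ => t.op ψ :: clubSweep ts ((t.op ψ).toMatrix *ᵥ ψ)

/-- `♣`-Householder: the operations that reduce the `n`-qudit state `ψ` to a multiple of `|m⟩`. -/
def clubHouseholder {d n : ℕ} [NeZero d] (ψ : (Fin n → Fin d) → ℂ) (m : Fin n → Fin d) :
    List (CtrlOp d n) :=
  (clubSweep (clubSeq d n) fun x => ψ (x + m)).map (CtrlOp.shift m)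

/-! ### The Triangle algorithm -/

/-- A procedure reads the current matrix and outputs a list of operations to be applied to it from
the left. -/
abbrev Procedure (d n : ℕ) := OpN d n → List (CtrlOp d n)

/-- Perform procedures one after the other, each on the matrix that its predecessors left. -/
def inTurn {d n : ℕ} : List (Procedure d n) → Procedure d n
  | [], _ => []
  | a :: as, A => a A ++ inTurn as (run (a A) * A)

/-- Collapse the part of the column `m c` in the block-row `l` onto its entry in the row `l c`, by
`♣`-Householder with an additional control on the value `l` of the most significant qudit. -/
def clearBlock {d n : ℕ} [NeZero d] (m : Fin d) (c : Fin n → Fin d) (l : Fin d) :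
    Procedure d (n + 1) := fun A =>
  (clubHouseholder (fun x => A (pre l x) (pre m c)) c).map (CtrlOp.addLine (some l))

/-- Clear the entries in the rows `x c`, `x > m`, of the column `m c` by one operation
`∧(T c, V)`; `V` is a Householder reflection acting only on the levels `x ≥ m`. -/
def clearRest {d n : ℕ} (m : Fin d) (c : Fin n → Fin d) : Procedure d (n + 1) := fun A =>
  [{ target := 0
     ctrl := Fin.cons (α := fun _ => Option (Fin d)) none fun i => some (c i)
     ctrl_target := rfl
     gate := householder m (below m fun x => A (pre x c) (pre m c)) }]

/-- Apply a procedure for `n` qudits to the `m`-th diagonal block, with the letter `a` on the most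
significant line. -/
def onBlock {d n : ℕ} (P : Procedure d n) (a : Option (Fin d)) (m : Fin d) :
    Procedure d (n + 1) := fun A =>
  (P (A.submatrix (pre m) (pre m))).map (CtrlOp.addLine a)

/-- One level of the recursion.  The top-left block is reduced without additional control.  Then,
for each block-column `m` but the last one (below which there is nothing to clear), its columns are
cleared below the diagonal block, and the next diagonal block is reduced with a control on the
value `m + 1` of the most significant qudit. -/
def triangleStep {d n : ℕ} [NeZero d] (P : Procedure d n) : Procedure d (n + 1) :=
  inTurn (onBlock P none 0 ::
    (List.finRange d).flatMap fun m =>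
      if h : m.val + 1 < d then
        ((words d n).flatMap fun c =>
          (((List.finRange d).filter fun l => decide (m < l)).map fun l => clearBlock m c l)
            ++ [clearRest m c])
          ++ [onBlock P (some ⟨m.val + 1, h⟩) ⟨m.val + 1, h⟩]
      else [])

/-- The Triangle algorithm for `n` qudits. -/
def triangle {d : ℕ} [NeZero d] : (n : ℕ) → Procedure d n
  | 0 => fun _ => []
  | 1 => fun A =>
      [{ target := 0
         ctrl := fun _ => none
         ctrl_target := rfl
         gate := qrGate (A.submatrix (fun a _ => a) (fun a _ => a)) }]
  | n + 2 => triangleStep (triangle (n + 1))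

/-! ### Circuits of one- and two-qudit gates -/

/-- A gate on `n` lines: a one-qudit gate on line `i`, or a two-qudit gate on the lines `i, j`. -/
inductive Gate (d n : ℕ)
  | one (i : Fin n) (V : Op1 d)
  | two (i j : Fin n) (W : Op2 d)

/-- The modular increment `INC |j⟩ = |j + 1 mod d⟩`. -/
def inc (d : ℕ) [NeZero d] : Op1 d := fun a b => if a = b + 1 then 1 else 0

/-- `∧₁(V)` on two qudits: `V` is applied to the second one iff the first one is in the state
`|d - 1⟩` (which is `-1` in `Fin d`). -/
def wedge1 {d : ℕ} [NeZero d] (V : Op1 d) : Op2 d := fun x y =>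
  if x.1 = y.1 then (if y.1 = -1 then V x.2 y.2 else (1 : Op1 d) x.2 y.2) else 0

/-- `CINC = ∧₁(INC)`. -/
def cinc (d : ℕ) [NeZero d] : Op2 d := wedge1 (inc d)

/-- `CINC⁻¹ = ∧₁(INC⁻¹)`. -/
def cincInv (d : ℕ) [NeZero d] : Op2 d := wedge1 (inc d)ᴴ

namespace Gate

open Classical in
/-- The `n`-qudit operator of a gate. -/
def toMatrix {d n : ℕ} : Gate d n → OpN d n
  | one i V => fun x y => if ∀ k, k ≠ i → x k = y k then V (x i) (y i) else 0
  | two i j W => fun x y =>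
      if ∀ k, k ≠ i → k ≠ j → x k = y k then W (x i, x j) (y i, y j) else 0

/-- Arbitrary unitary one- and two-qudit gates. -/
def IsUnitary {d n : ℕ} : Gate d n → Prop
  | one _ V => V ∈ Matrix.unitaryGroup (Fin d) ℂ
  | two i j W => i ≠ j ∧ W ∈ Matrix.unitaryGroup (Fin d × Fin d) ℂ

/-- The gate library of all one-qudit unitaries together with `CINC` and `CINC⁻¹`. -/
def InLibrary {d n : ℕ} [NeZero d] : Gate d n → Prop
  | one _ V => V ∈ Matrix.unitaryGroup (Fin d) ℂ
  | two i j W => i ≠ j ∧ (W = cinc d ∨ W = cincInv d)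

/-- Is it a two-qudit gate? -/
def isTwo {d n : ℕ} : Gate d n → Bool
  | one _ _ => false
  | two _ _ _ => true

end Gate

/-- A circuit on `n` lines (without ancillas); the head of the list is performed first. -/
abbrev Circuit (d n : ℕ) := List (Gate d n)

/-- The operator of a circuit. -/
def Circuit.eval {d n : ℕ} : Circuit d n → OpN d n
  | [] => 1
  | g :: gs => Circuit.eval gs * g.toMatrix

/-- The number of two-qudit gates of a circuit.  For a circuit over the library this is the number
of `CINC` and `CINC⁻¹` gates. -/
def Circuit.twoCount {d n : ℕ} (C : Circuit d n) : ℕ := C.countP Gate.isTwo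

/-! ### Controlled operations without ancillas -/

/-- A spectral decomposition `V = P diag(exp(iθ_k)) P†` of a unitary `V`: the pair `(P, θ)`. -/
def eigen {d : ℕ} (V : Op1 d) : Op1 d × (Fin d → ℝ) :=
  Classical.epsilon fun p : Op1 d × (Fin d → ℝ) =>
    p.1 ∈ Matrix.unitaryGroup (Fin d) ℂ ∧
      V = p.1 * Matrix.diagonal (fun k => Complex.exp (Complex.I * p.2 k)) * p.1ᴴ

/-- The number `exp(i θ_k / d)`, where `exp(i θ_k)` is the `k`-th eigenvalue of `V`. -/
def eigenRoot {d : ℕ} (V : Op1 d) (k : Fin d) : ℂ :=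
  Complex.exp (Complex.I * (((eigen V).2 k / d : ℝ) : ℂ))

/-- A `d`-th root `V^(1/d)` of a unitary `V`. -/
def root {d : ℕ} (V : Op1 d) : Op1 d :=
  (eigen V).1 * Matrix.diagonal (eigenRoot V) * (eigen V).1ᴴ

/-- A unitary `W_k` that takes `|0⟩` to the `k`-th eigenvector of `V`. -/
def eigenFrame {d : ℕ} (V : Op1 d) (k : Fin d) : Op1 d :=
  (eigen V).1.submatrix id (· + k)

/-- The controlled phase `∧₁(I + (ξ^d - 1)|0⟩⟨0|)`, `|ξ| = 1`, with control `c` and target `t`, as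
`∧₁(ξ I) · CINC · (I ⊗ D) · CINC⁻¹ · (I ⊗ D⁻¹)` with `D = ∑ ξ^j |j⟩⟨j|`; here `∧₁(ξ I)` is a
one-qudit gate on the control line. -/
def ctrlPhase {d n : ℕ} [NeZero d] (c t : Fin n) (ξ : ℂ) : Circuit d n :=
  let D : Op1 d := Matrix.diagonal fun j => ξ ^ j.val
  [.one t Dᴴ, .two c t (cincInv d), .one t D, .two c t (cinc d),
    .one c (Matrix.diagonal fun j => if j = -1 then ξ else 1)]

/-- `∧₁(V)` with control `c` and target `t`, by the spectral decomposition of `V`. -/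
def ctrlOne {d n : ℕ} [NeZero d] (c t : Fin n) (V : Op1 d) : Circuit d n :=
  (List.finRange d).flatMap fun k =>
    [.one t (eigenFrame V k)ᴴ] ++ ctrlPhase c t (eigenRoot V k) ++ [.one t (eigenFrame V k)]

/-- The circuit
`∧ₖ₋₁(X) [∧ₖ₋₁(INC) ∧₁(X†)]^(d-1) ∧ₖ₋₁(INC) ∧₁(X^(d-1))` for `∧ₖ(X^d)` with target `t`.
`A` is a circuit for `∧ₖ₋₁(INC)` on the remaining controls with target `q`, and `B` one for
`∧ₖ₋₁(X)` on the remaining controls with target `t`; `q` controls the operations `∧₁`. -/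
def peel {d n : ℕ} [NeZero d] (q t : Fin n) (X : Op1 d) (A B : Circuit d n) : Circuit d n :=
  ctrlOne q t (X ^ (d - 1)) ++ A
    ++ (List.replicate (d - 1) (ctrlOne q t Xᴴ ++ A)).flatten ++ B

/-- `∧ₖ(INC)` with all controls on `|d - 1⟩`: the list of control lines, the target line `t`, and
one further line `s`, which is borrowed (in an arbitrary state, to be restored) if `k ≥ 3`.  In that
case the circuit is `[∧_⌊(k+1)/2⌋(INC) ∧_⌈(k+1)/2⌉(INC)]^d`, where the first-performed factor has
target `s`, and the second one has `s` among its controls. -/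
def ctrlInc {d n : ℕ} [NeZero d] : List (Fin n) → Fin n → Fin n → Circuit d n
  | [], t, _ => [.one t (inc d)]
  | [c], t, _ => [.two c t (cinc d)]
  | [c, q], t, _ =>
      peel q t (root (inc d)) [.two c q (cinc d)] (ctrlOne c t (root (inc d)))
  | c :: c' :: c'' :: cs, t, s =>
      (List.replicate d
        (ctrlInc ((c :: c' :: c'' :: cs).take ((cs.length + 5) / 2)) s t
          ++ ctrlInc (s :: (c :: c' :: c'' :: cs).drop ((cs.length + 5) / 2)) t c)).flatten
  termination_by L => L.length
  decreasing_by
    all_goals simp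
    all_goals omega

/-- `∧ₖ(V)` with all controls on `|d - 1⟩`: the list of control lines and the target line. -/
def ctrlMany {d n : ℕ} [NeZero d] : List (Fin n) → Fin n → Op1 d → Circuit d n
  | [], t, V => [.one t V]
  | [c], t, V => ctrlOne c t V
  | q :: c :: cs, t, V =>
      peel q t (root V) (ctrlInc (c :: cs) q t) (ctrlMany (c :: cs) t (root V))

/-- The circuit for a controlled operation `∧(C, V)`: powers of `INC` on the control lines turn
all control values into `d - 1` and back. -/
def CtrlOp.circuit {d n : ℕ} [NeZero d] (o : CtrlOp d n) : Circuit d n :=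
  let moves (G : Fin d → Op1 d) : Circuit d n :=
    (List.finRange n).flatMap fun i => ((o.ctrl i).map fun q => Gate.one i (G q)).toList
  moves (fun q => inc d ^ (-1 - q).val)
    ++ ctrlMany ((List.finRange n).filter fun i => (o.ctrl i).isSome) o.target o.gate
    ++ moves (fun q => (inc d ^ (-1 - q).val)ᴴ)

/-! ### Unitary synthesis -/

/-- The diagonal operator with entries `w j`, as a product of `d ^ n` phases, each of which has
`n - 1` controls. -/
def diagonalOps {d : ℕ} : (n : ℕ) → ((Fin n → Fin d) → ℂ) → List (CtrlOp d n)
  | 0, _ => []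
  | n + 1, w => (words d (n + 1)).map fun j =>
      { target := Fin.last n
        ctrl := fun i => if i = Fin.last n then none else some (j i)
        ctrl_target := by simp
        gate := Matrix.diagonal fun a => if a = j (Fin.last n) then w j else 1 }

/-- The circuit for `U` given by the Triangle algorithm: if `Triangle` reduces `U` to the diagonal
`W = O_p ⋯ O_1 U`, it realizes `W` and then `O_p†, …, O_1†`. -/
def synthesize {d : ℕ} [NeZero d] (n : ℕ) (U : OpN d n) : Circuit d n :=
  ((diagonalOps n fun j => (run (triangle n U) * U) j j)
    ++ (triangle n U).reverse.map CtrlOp.adjoint).flatMap CtrlOp.circuit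

end

end QuditTriangle

namespace QuditTriangle

noncomputable section

/-! ### Controlled operators as block-diagonal matrices -/

/-! Correctness of the reduction rests on an elimination order in which nothing already cleared is
ever spoiled. A control on a letter `r ≠ 0` makes an operation act trivially on multiples of
`|0⋯0⟩`. The `♣`-sweep therefore treats the slices of a vector in increasing order of the top
letter, and collapsed slices stay collapsed (`step_cons_of_collapsed`, `collapsed_foldl_clubSeq`).
For matrices, the invariant `Cleared` records which columns vanish below the diagonal blocks and
which diagonal blocks are already triangular. Each row operation meets only zeros in those columns,
so the result is upper triangular (`upperTri_after_triangle`). A unitary upper triangular matrix is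
diagonal, because its inverse is both upper triangular and its conjugate transpose.

The control patterns never depend on the matrix entries (`oblivious_triangle`). Counting is done
with the weight `∑ d ^ k`, `k` running over the numbers of controls: an additional control
multiplies it by `d`, so the recursion for it is linear, and `weightLE_triangle` gives `d ^ (2 * n +
4)`. Comparing this with the contribution of a single `k` bounds the number of `k`-controlled
operations, in fact for all `n`.

For the ancilla-free circuits, every operator on two chosen lines that is controlled by other lines
is block diagonal after splitting the index type (`mux`). An identity of circuits then becomes an
identity of `d² × d²` matrices `shiftMux`, in which one line is incremented and the other receives a
gate depending on the value of the first. Two cyclic arguments suffice, `peel_identity` and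
`borrow_identity`: while a line runs through the residues modulo `d`, a gate controlled by it fires
once. Roots of gates come from a spectral theorem for unitary matrices, proved by the Cayley
transform.

The cost uses two estimates of the same recursion. The bound `ctrlCost_le_pow`, a multiple of `d ^
k`, combines with the weight to give order `d ^ (2 * n)` for the Triangle operations. The `d ^ n`
diagonal phases have `n - 1` controls each, and for them the polynomial bound `ctrlCost_le_rpow` is
needed, whose exponent solves the halving recursion for `∧ₖ(INC)`.

The lower bound is a parameter count. One-qudit gates can be pushed through two-qudit gates into a
single layer, so a circuit with a fixed sequence of two-qudit positions lies in a polynomial family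
with `d ^ 4` parameters per two-qudit gate and `n * d ^ 2` for the layer. With fewer parameters than
the `d ^ (2 * n)` matrix entries, the family satisfies a nonzero polynomial equation
(`PolyCovered.exists_ne_zero`). The product of these equations over the finitely many shapes is
nonzero, and so cannot vanish on all unitaries, which are Zariski dense
(`eq_zero_of_entryEval_unitary`). -/

/-- The matrix that acts by `G r` on the first component of those indices whose second component,
with respect to the splitting `e` of the index type, is `r`. -/
def mux {X m o : Type*} [DecidableEq o] (e : X ≃ m × o) (G : o → Matrix m m ℂ) : Matrix X X ℂ :=
  (Matrix.blockDiagonal G).submatrix e e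

section mux

variable {X m o : Type*} [DecidableEq o] (e : X ≃ m × o)

theorem mux_apply (G : o → Matrix m m ℂ) (x y : X) :
    mux e G x y = if (e x).2 = (e y).2 then G (e x).2 (e x).1 (e y).1 else 0 := rfl

theorem mux_mul [Fintype X] [Fintype m] [Fintype o] (G H : o → Matrix m m ℂ) :
    mux e G * mux e H = mux e (fun r => G r * H r) := by
  simp only [mux, Matrix.submatrix_mul_equiv, Matrix.blockDiagonal_mul]

theorem mux_one [DecidableEq X] [DecidableEq m] : mux e (fun _ => (1 : Matrix m m ℂ)) = 1 := by
  have := Matrix.blockDiagonal_one (m := m) (o := o) (α := ℂ)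
  rw [mux]
  erw [this]
  simp

theorem mux_pow [Fintype X] [DecidableEq X] [Fintype m] [DecidableEq m] [Fintype o]
    (G : o → Matrix m m ℂ) (k : ℕ) : mux e G ^ k = mux e (fun r => G r ^ k) := by
  induction k with
  | zero => simp [mux_one]
  | succ k ih => simp only [pow_succ, ih, mux_mul]

theorem mux_conjTranspose (G : o → Matrix m m ℂ) : (mux e G)ᴴ = mux e (fun r => (G r)ᴴ) := by
  simp only [mux, Matrix.conjTranspose_submatrix, Matrix.blockDiagonal_conjTranspose]

end mux

/-- The predicate `S` on dit strings does not depend on the letter at position `t`. -/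
def IndepOf {d n : ℕ} (S : (Fin n → Fin d) → Prop) (t : Fin n) : Prop :=
  ∀ x a, S (Function.update x t a) ↔ S x

theorem IndepOf.congr {d n : ℕ} {S : (Fin n → Fin d) → Prop} {t : Fin n} (h : IndepOf S t)
    {x y : Fin n → Fin d} (hxy : ∀ i, i ≠ t → x i = y i) : S x ↔ S y := by
  have : y = Function.update x t (y t) := by
    ext i
    by_cases hi : i = t
    · subst hi; simp
    · simp [hi, hxy i hi]
  rw [this, h]

open Classical in
/-- Apply `V` to the qudit `t` of those basis states that satisfy `S`. -/
def ctl {d n : ℕ} (S : (Fin n → Fin d) → Prop) (t : Fin n) (V : Op1 d) : OpN d n := fun x y =>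
  if S y then (if ∀ i, i ≠ t → x i = y i then V (x t) (y t) else 0)
  else (if x = y then 1 else 0)

theorem CtrlOp.toMatrix_eq_ctl {d n : ℕ} (o : CtrlOp d n) :
    o.toMatrix = ctl o.Matches o.target o.gate := rfl

theorem CtrlOp.indepOf_matches {d n : ℕ} (o : CtrlOp d n) : IndepOf o.Matches o.target := by
  intro x a
  refine forall₂_congr fun i q => imp_congr_right fun h => ?_
  have : i ≠ o.target := by
    rintro rfl
    simp [o.ctrl_target] at h
  simp [this]

/-- The splitting of the dit strings into the letter at position `t` and the other letters. -/
def splitOne {d n : ℕ} (t : Fin n) : (Fin n → Fin d) ≃ Fin d × ({k // k ≠ t} → Fin d) :=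
  Equiv.funSplitAt t (Fin d)

theorem splitOne_snd_eq {d n : ℕ} {t : Fin n} {x y : Fin n → Fin d} :
    (splitOne t x).2 = (splitOne t y).2 ↔ ∀ i, i ≠ t → x i = y i := by
  simp [splitOne, funext_iff]

theorem splitOne_fst {d n : ℕ} {t : Fin n} {x : Fin n → Fin d} : (splitOne t x).1 = x t := rfl

theorem splitOne_symm {d n : ℕ} {t : Fin n} {x : Fin n → Fin d} (a : Fin d) :
    ∀ i, i ≠ t → (splitOne t).symm (a, (splitOne t x).2) i = x i := by
  intro i hi
  simp [splitOne, hi]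

-- The letter `0` inserted at position `t` is a dummy, harmless because `S` ignores that position.
-- This form reduces the algebra of controlled gates to that of their blocks.
open Classical in
theorem ctl_eq_mux {d n : ℕ} [NeZero d] {S : (Fin n → Fin d) → Prop} {t : Fin n}
    (hS : IndepOf S t) (V : Op1 d) :
    ctl S t V = mux (splitOne t) (fun r => if S ((splitOne t).symm (0, r)) then V else 1) := by
  ext x y
  rw [mux_apply, splitOne_fst, splitOne_fst, ctl]
  simp only [splitOne_snd_eq, hS.congr (splitOne_symm (x := x) 0)]
  by_cases h : ∀ i, i ≠ t → x i = y i
  · rw [if_pos h, if_pos h, ← hS.congr h]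
    split_ifs with h1 h2
    · rfl
    · subst h2; simp
    · rw [Matrix.one_apply_ne]
      intro h3
      apply h2
      ext i
      by_cases hi : i = t
      · subst hi; rw [h3]
      · rw [h i hi]
  · rw [if_neg h, if_neg h]
    split_ifs with h1 h2
    · rfl
    · subst h2; simp at h
    · rfl

theorem ctl_mul {d n : ℕ} [NeZero d] {S : (Fin n → Fin d) → Prop} {t : Fin n}
    (hS : IndepOf S t) (V W : Op1 d) : ctl S t V * ctl S t W = ctl S t (V * W) := by
  rw [ctl_eq_mux hS, ctl_eq_mux hS, ctl_eq_mux hS, mux_mul]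
  congr 1
  ext1 r
  split_ifs <;> simp

theorem ctl_one {d n : ℕ} {S : (Fin n → Fin d) → Prop} {t : Fin n} :
    ctl S t (1 : Op1 d) = 1 := by
  ext x y
  by_cases hxy : x = y
  · subst hxy; simp [ctl]
  · rw [Matrix.one_apply_ne hxy, ctl]
    split_ifs with h1 h2
    · rw [Matrix.one_apply_ne]
      intro h3
      apply hxy
      ext i
      by_cases hi : i = t
      · subst hi; rw [h3]
      · rw [h2 i hi]
    · rfl
    · rfl

theorem ctl_conjTranspose {d n : ℕ} [NeZero d] {S : (Fin n → Fin d) → Prop} {t : Fin n}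
    (hS : IndepOf S t) (V : Op1 d) : (ctl S t V)ᴴ = ctl S t Vᴴ := by
  rw [ctl_eq_mux hS, ctl_eq_mux hS, mux_conjTranspose]
  congr 1
  ext1 r
  split_ifs <;> simp

theorem ctl_mem_unitary {d n : ℕ} [NeZero d] {S : (Fin n → Fin d) → Prop} {t : Fin n}
    (hS : IndepOf S t) {V : Op1 d} (hV : V ∈ Matrix.unitaryGroup (Fin d) ℂ) :
    ctl S t V ∈ Matrix.unitaryGroup (Fin n → Fin d) ℂ := by
  rw [Matrix.mem_unitaryGroup_iff, Matrix.star_eq_conjTranspose] at *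
  rw [ctl_conjTranspose hS, ctl_mul hS, hV, ctl_one]

open Classical in
theorem ctl_mulVec {d n : ℕ} {S : (Fin n → Fin d) → Prop} {t : Fin n}
    (hS : IndepOf S t) (V : Op1 d) (ψ : (Fin n → Fin d) → ℂ) (x : Fin n → Fin d) :
    (ctl S t V *ᵥ ψ) x =
      if S x then ∑ a, V (x t) a * ψ (Function.update x t a) else ψ x := by
  rw [Matrix.mulVec, dotProduct]
  by_cases hx : S x
  · rw [if_pos hx]
    symm
    refine Finset.sum_of_injOn (fun a => Function.update x t a) ?_ ?_ ?_ ?_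
    · exact (Function.update_injective x t).injOn
    · simp
    · intro y _ hy
      have h : ¬ ∀ i, i ≠ t → x i = y i := by
        intro h
        apply hy
        refine ⟨y t, by simp, ?_⟩
        ext i
        by_cases hi : i = t
        · subst hi; simp
        · simp [hi, h i hi]
      rw [ctl, if_neg h]
      split_ifs with h1 h2
      · simp
      · subst h2; simp at h
      · simp
    · intro a _
      have : ∀ i, i ≠ t → x i = Function.update x t a i := by
        intro i hi; simp [hi]
      rw [ctl, if_pos ((hS x a).2 hx), if_pos this]
      simp
  · rw [if_neg hx, Finset.sum_eq_single x]
    · simp [ctl, hx]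
    · intro y _ hy
      rw [ctl]
      split_ifs with h1 h2 h3
      · exact absurd ((hS.congr h2).2 h1) hx
      · simp
      · exact absurd h3.symm hy
      · simp
    · simp

namespace CtrlOp

open Classical in
theorem toMatrix_mulVec {d n : ℕ} (o : CtrlOp d n) (ψ : (Fin n → Fin d) → ℂ)
    (x : Fin n → Fin d) :
    (o.toMatrix *ᵥ ψ) x =
      if o.Matches x then
        ∑ a, o.gate (x o.target) a * ψ (Function.update x o.target a) else ψ x :=
  ctl_mulVec o.indepOf_matches _ _ _

theorem toMatrix_mem_unitary {d n : ℕ} [NeZero d] {o : CtrlOp d n}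
    (ho : o.gate ∈ Matrix.unitaryGroup (Fin d) ℂ) :
    o.toMatrix ∈ Matrix.unitaryGroup (Fin n → Fin d) ℂ :=
  ctl_mem_unitary o.indepOf_matches ho

theorem toMatrix_adjoint {d n : ℕ} [NeZero d] (o : CtrlOp d n) :
    o.adjoint.toMatrix = o.toMatrixᴴ :=
  (ctl_conjTranspose o.indepOf_matches _).symm

open Classical in
theorem addLine_mulVec {d n : ℕ} (a : Option (Fin d)) (o : CtrlOp d n)
    (ψ : (Fin (n + 1) → Fin d) → ℂ) (q : Fin d) (x : Fin n → Fin d) :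
    ((o.addLine a).toMatrix *ᵥ ψ) (pre q x) =
      if a = none ∨ a = some q then (o.toMatrix *ᵥ fun x => ψ (pre q x)) x else ψ (pre q x) := by
  have hm : (o.addLine a).Matches (pre q x) ↔ (a = none ∨ a = some q) ∧ o.Matches x := by
    rw [Matches, Fin.forall_fin_succ]
    refine and_congr ?_ (by rfl)
    rcases a with _ | a
    · simp [addLine]
    · simp [addLine, pre, eq_comm]
  rw [toMatrix_mulVec, toMatrix_mulVec, hm]
  have hu : ∀ a, Function.update (pre q x) o.target.succ a = pre q (Function.update x o.target a) :=
    fun a => (Fin.cons_update (α := fun _ => Fin d) q x o.target a).symm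
  have ht : (o.addLine a).target = o.target.succ := rfl
  by_cases ha : a = none ∨ a = some q
  · simp only [ha, true_and, if_true, ht, hu]
    rfl
  · simp [ha]

theorem shift_toMatrix {d n : ℕ} [NeZero d] (m : Fin n → Fin d) (o : CtrlOp d n)
    (x y : Fin n → Fin d) : (o.shift m).toMatrix x y = o.toMatrix (x - m) (y - m) := by
  have h1 : (o.shift m).Matches y ↔ o.Matches (y - m) := by
    refine forall_congr' fun i => ?_
    rcases h : o.ctrl i with _ | q
    · simp [shift, h]
    · simp [shift, h, sub_eq_iff_eq_add]
  have h2 : (∀ i, i ≠ o.target → x i = y i) ↔ ∀ i, i ≠ o.target → (x - m) i = (y - m) i := by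
    simp
  have h3 : x = y ↔ x - m = y - m := by simp
  have h4 : (o.shift m).target = o.target := rfl
  simp only [toMatrix, h3, h4, h2]
  by_cases h : o.Matches (y - m)
  · rw [if_pos h, if_pos (h1.2 h)]
    rfl
  · rw [if_neg h, if_neg (fun h' => h (h1.1 h'))]

end CtrlOp

theorem run_append {d n : ℕ} (L M : List (CtrlOp d n)) : run (L ++ M) = run M * run L := by
  induction L with
  | nil => simp [run]
  | cons o L ih => simp [run, ih, Matrix.mul_assoc]

theorem run_mem_unitary {d n : ℕ} [NeZero d] {L : List (CtrlOp d n)}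
    (hL : ∀ o ∈ L, o.gate ∈ Matrix.unitaryGroup (Fin d) ℂ) :
    run L ∈ Matrix.unitaryGroup (Fin n → Fin d) ℂ := by
  induction L with
  | nil => exact one_mem _
  | cons o L ih =>
    exact mul_mem (ih fun p hp => hL p (List.mem_cons_of_mem _ hp))
      (CtrlOp.toMatrix_mem_unitary (hL o List.mem_cons_self))

/-- The top letter is never changed by these operations, so each slice with a fixed top letter
evolves separately. Applied to columns, it says that they act on whole block-rows. -/
theorem run_addLine_mulVec {d n : ℕ} (a : Option (Fin d)) (L : List (CtrlOp d n))
    (ψ : (Fin (n + 1) → Fin d) → ℂ) (q : Fin d) (x : Fin n → Fin d) :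
    (run (L.map (CtrlOp.addLine a)) *ᵥ ψ) (pre q x) =
      if a = none ∨ a = some q then (run L *ᵥ fun x => ψ (pre q x)) x else ψ (pre q x) := by
  induction L generalizing ψ with
  | nil => simp [run]
  | cons o L ih =>
    simp only [List.map_cons, run, ← Matrix.mulVec_mulVec]
    rw [ih]
    simp only [CtrlOp.addLine_mulVec]
    split_ifs <;> rfl

theorem run_shift_apply {d n : ℕ} [NeZero d] (m : Fin n → Fin d) (L : List (CtrlOp d n))
    (x y : Fin n → Fin d) : run (L.map (CtrlOp.shift m)) x y = run L (x - m) (y - m) := by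
  induction L generalizing x y with
  | nil => simp [run, Matrix.one_apply]
  | cons o L ih =>
    simp only [List.map_cons, run, Matrix.mul_apply, ih, CtrlOp.shift_toMatrix]
    exact Fintype.sum_equiv (Equiv.subRight m) _ _ fun _ => rfl

theorem run_shift_mulVec {d n : ℕ} [NeZero d] (m : Fin n → Fin d) (L : List (CtrlOp d n))
    (ψ : (Fin n → Fin d) → ℂ) (x : Fin n → Fin d) :
    (run (L.map (CtrlOp.shift m)) *ᵥ ψ) x = (run L *ᵥ fun x => ψ (x + m)) (x - m) := by
  simp only [Matrix.mulVec, dotProduct, run_shift_apply]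
  exact Fintype.sum_equiv (Equiv.subRight m) _ _ fun _ => by simp

/-! ### Householder reflections -/

theorem norm_phase (z : ℂ) : ‖phase z‖ = 1 := by
  unfold phase
  split_ifs with h
  · simp
  · simp [h]

/-- The vector `η` that defines the Householder reflection taking `ψ` to a multiple of `|m⟩`. -/
def householderVec {d : ℕ} (m : Fin d) (ψ : Fin d → ℂ) : Fin d → ℂ :=
  ψ - ((Real.sqrt (∑ k, ‖ψ k‖ ^ 2) : ℂ) * phase (ψ m)) • Pi.single m (1 : ℂ)

theorem householder_eq {d : ℕ} (m : Fin d) (ψ : Fin d → ℂ) :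
    householder m ψ = 1 - (2 / ((∑ k, ‖householderVec m ψ k‖ ^ 2 : ℝ) : ℂ)) •
      Matrix.vecMulVec (householderVec m ψ) (star (householderVec m ψ)) := rfl

theorem star_dotProduct_self {d : ℕ} (η : Fin d → ℂ) :
    star η ⬝ᵥ η = ((∑ k, ‖η k‖ ^ 2 : ℝ) : ℂ) := by
  simp only [dotProduct, Pi.star_apply, RCLike.star_def]
  push_cast
  exact Finset.sum_congr rfl fun k _ => Complex.conj_mul' _

theorem householder_mem_unitary {d : ℕ} (m : Fin d) (ψ : Fin d → ℂ) :
    householder m ψ ∈ Matrix.unitaryGroup (Fin d) ℂ := by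
  rw [householder_eq]
  set η := householderVec m ψ
  set s : ℝ := ∑ k, ‖η k‖ ^ 2 with hs
  have hsq : Matrix.vecMulVec η (star η) * Matrix.vecMulVec η (star η) =
      (s : ℂ) • Matrix.vecMulVec η (star η) := by
    rw [Matrix.vecMulVec_mul_vecMulVec, star_dotProduct_self, ← hs, Matrix.vecMulVec_smul]
  have hst : star (1 - (2 / (s : ℂ)) • Matrix.vecMulVec η (star η)) =
      1 - (2 / (s : ℂ)) • Matrix.vecMulVec η (star η) := by
    rw [Matrix.star_eq_conjTranspose, Matrix.conjTranspose_sub, Matrix.conjTranspose_one,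
      Matrix.conjTranspose_smul, Matrix.conjTranspose_vecMulVec]
    simp
  rw [Matrix.mem_unitaryGroup_iff, hst, sub_mul, mul_sub, mul_sub, one_mul, mul_one, one_mul,
    smul_mul_smul_comm, hsq, smul_smul]
  -- For `η = 0` the convention `2 / 0 = 0` leaves the identity matrix.
  by_cases h : (s : ℂ) = 0
  · simp [h]
  · have : 2 / (s : ℂ) * (2 / s) * s = 2 / s + 2 / s := by field_simp; norm_num
    rw [this, add_smul]
    abel

theorem householder_mulVec {d : ℕ} (m : Fin d) (ψ φ : Fin d → ℂ) :
    householder m ψ *ᵥ φ = φ - (2 / ((∑ k, ‖householderVec m ψ k‖ ^ 2 : ℝ) : ℂ) *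
      (star (householderVec m ψ) ⬝ᵥ φ)) • householderVec m ψ := by
  rw [householder_eq, Matrix.sub_mulVec, Matrix.one_mulVec, Matrix.smul_mulVec,
    Matrix.vecMulVec_mulVec]
  ext i
  simp
  ring

/-- The phase of `ψ m` in the definition makes `⟨η|ψ⟩` real, whence `⟨η|η⟩ = 2⟨η|ψ⟩` and the
reflection subtracts exactly `η` from `ψ`. -/
theorem householder_mulVec_self {d : ℕ} (m : Fin d) (ψ : Fin d → ℂ) :
    householder m ψ *ᵥ ψ =
      ((Real.sqrt (∑ k, ‖ψ k‖ ^ 2) : ℂ) * phase (ψ m)) • Pi.single m (1 : ℂ) := by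
  set N : ℝ := ∑ k, ‖ψ k‖ ^ 2 with hN
  have hN0 : 0 ≤ N := Finset.sum_nonneg fun _ _ => by positivity
  set c : ℂ := (Real.sqrt N : ℂ) * phase (ψ m) with hc
  have hη : householderVec m ψ = ψ - c • Pi.single m (1 : ℂ) := rfl
  set η := householderVec m ψ
  have hcn : star c * c = N := by
    rw [RCLike.star_def, Complex.conj_mul', hc, norm_mul, norm_phase, Complex.norm_real,
      Real.norm_of_nonneg (Real.sqrt_nonneg _), mul_one, ← Complex.ofReal_pow, Real.sq_sqrt hN0]
  have hph : star (phase (ψ m)) * ψ m = ‖ψ m‖ := by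
    unfold phase
    split_ifs with h
    · simp [h]
    · rw [star_div₀]
      have : star ((‖ψ m‖ : ℂ)) = ‖ψ m‖ := by simp
      rw [this, div_mul_eq_mul_div, RCLike.star_def, Complex.conj_mul', sq, mul_div_assoc, div_self,
        mul_one]
      simpa using h
  have hcψ : star c * ψ m = Real.sqrt N * ‖ψ m‖ := by
    rw [hc, star_mul', mul_assoc, hph]
    simp
  have hψc : star (ψ m) * c = Real.sqrt N * ‖ψ m‖ := by
    have := congrArg star hcψ
    rw [star_mul', star_star, mul_comm] at this
    rw [this]
    simp
  have hm : ∀ φ : Fin d → ℂ, φ ⬝ᵥ Pi.single m (1 : ℂ) = φ m := fun φ => by simp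
  have hm' : ∀ φ : Fin d → ℂ, Pi.single m (1 : ℂ) ⬝ᵥ φ = φ m := fun φ => by simp
  have h1 : star η ⬝ᵥ ψ = N - Real.sqrt N * ‖ψ m‖ := by
    rw [hη, star_sub, sub_dotProduct, star_dotProduct_self, star_smul, smul_dotProduct,
      ← Pi.single_star, star_one, hm', smul_eq_mul, hcψ]
  have h2 : star η ⬝ᵥ η = 2 * (N - Real.sqrt N * ‖ψ m‖) := by
    have : star η ⬝ᵥ η = star η ⬝ᵥ ψ - c * star (η m) := by
      conv_lhs => rw [hη]
      rw [dotProduct_sub, dotProduct_smul, hm, smul_eq_mul, ← hη]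
      rfl
    rw [this, h1, hη]
    simp only [Pi.sub_apply, Pi.smul_apply, Pi.single_eq_same, smul_eq_mul, mul_one, star_sub]
    rw [mul_sub, mul_comm c (star c), hcn, mul_comm c, hψc]
    ring
  rw [householder_mulVec, ← star_dotProduct_self]
  change ψ - (2 / (star η ⬝ᵥ η) * (star η ⬝ᵥ ψ)) • η = _
  -- This number is half of `⟨η|η⟩`; if it vanishes, `ψ` is already a multiple of `|m⟩`.
  by_cases h : (N : ℂ) - Real.sqrt N * ‖ψ m‖ = 0
  · have h0 : η = 0 := by
      rw [h, mul_zero] at h2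
      rw [star_dotProduct_self, Complex.ofReal_eq_zero,
        Finset.sum_eq_zero_iff_of_nonneg fun _ _ => by positivity] at h2
      ext k
      simpa using h2 k (Finset.mem_univ k)
    rw [h0, smul_zero, sub_zero]
    rwa [hη, sub_eq_zero] at h0
  · rw [h1, h2, div_mul_eq_mul_div, div_self (mul_ne_zero two_ne_zero h), one_smul, hη]
    abel

theorem householder_mulVec_self_apply {d : ℕ} {m k : Fin d} (hk : k ≠ m) (ψ : Fin d → ℂ) :
    (householder m ψ *ᵥ ψ) k = 0 := by
  rw [householder_mulVec_self]
  simp [hk]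

/-- A Householder reflection fixes the vectors orthogonal to `ψ` and `|m⟩`. -/
theorem householder_mulVec_of_disjoint {d : ℕ} {m : Fin d} {ψ φ : Fin d → ℂ}
    (h : ∀ k, k = m ∨ ψ k ≠ 0 → φ k = 0) : householder m ψ *ᵥ φ = φ := by
  have : star (householderVec m ψ) ⬝ᵥ φ = 0 := by
    refine Finset.sum_eq_zero fun k _ => ?_
    by_cases hk : k = m ∨ ψ k ≠ 0
    · rw [h k hk, mul_zero]
    · push Not at hk
      simp [householderVec, hk.1, hk.2]
  rw [householder_mulVec, this]
  simp

theorem pre_self_tail {d n : ℕ} (x : Fin (n + 1) → Fin d) : pre (x 0) (Fin.tail x) = x :=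
  Fin.cons_self_tail (α := fun _ => Fin d) x

theorem pre_zero {d n : ℕ} [NeZero d] : pre (0 : Fin d) (0 : Fin n → Fin d) = 0 := by
  ext i
  refine Fin.cases ?_ (fun i => ?_) i <;> rfl

theorem update_pre_zero {d n : ℕ} (q a : Fin d) (x : Fin n → Fin d) :
    Function.update (pre q x) 0 a = pre a x :=
  Fin.update_cons_zero (α := fun _ => Fin d) q x a

/-! ### State synthesis -/

/-- A state all of whose entries except that of `|0⋯0⟩` vanish. -/
def Collapsed {d n : ℕ} [NeZero d] (φ : (Fin n → Fin d) → ℂ) : Prop := ∀ x, x ≠ 0 → φ x = 0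

namespace ClubTerm

variable {d : ℕ} [NeZero d]

/-- The state after the operation that a term contributes. -/
def step {n : ℕ} (ψ : (Fin n → Fin d) → ℂ) (t : ClubTerm d n) : (Fin n → Fin d) → ℂ :=
  (t.op ψ).toMatrix *ᵥ ψ

theorem exists_ctrl_of_hasPos : ∀ {n : ℕ} (t : ClubTerm d n), t.hasPos = true →
    ∃ i r, t.ctrl i = some r ∧ r ≠ 0
  | _, clubs, h => by simp [hasPos] at h
  | _, cons q t, h => by
    by_cases ht : t.hasPos = true
    · obtain ⟨i, r, hi, hr⟩ := exists_ctrl_of_hasPos t ht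
      exact ⟨i.succ, r, by simpa [ctrl] using hi, hr⟩
    · have hq : q ≠ 0 := by simpa [hasPos, ht] using h
      exact ⟨0, q, by simp [ctrl, hq, ht], hq⟩

theorem op_cons {n : ℕ} (q : Fin d) (t : ClubTerm d n) (ψ : (Fin (n + 1) → Fin d) → ℂ) :
    (cons q t).op ψ = (t.op fun x => ψ (pre q x)).addLine
      (if q ≠ 0 ∧ t.hasPos = false then some q else none) := rfl

theorem step_cons_self {n : ℕ} (q : Fin d) (t : ClubTerm d n) (ψ : (Fin (n + 1) → Fin d) → ℂ)
    (x : Fin n → Fin d) : step ψ (cons q t) (pre q x) = step (fun x => ψ (pre q x)) t x := by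
  rw [step, op_cons, CtrlOp.addLine_mulVec, if_pos]
  · rfl
  · split_ifs <;> simp

/-- The control on a letter `r ≠ 0` is not met by `|0⋯0⟩`, the only basis state present in `φ`. -/
theorem step_of_collapsed {n : ℕ} {t : ClubTerm d n} (ht : t.hasPos = true)
    (ψ : (Fin n → Fin d) → ℂ) {φ : (Fin n → Fin d) → ℂ} (hφ : Collapsed φ) :
    (t.op ψ).toMatrix *ᵥ φ = φ := by
  obtain ⟨i, r, hi, hr⟩ := exists_ctrl_of_hasPos t ht
  ext x
  rw [CtrlOp.toMatrix_mulVec]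
  split_ifs with hx
  · have h : ∀ y, (t.op ψ).Matches y → φ y = 0 := by
      intro y hy
      apply hφ
      rintro rfl
      exact hr (hy i r hi).symm
    rw [h x hx]
    refine Finset.sum_eq_zero fun a _ => ?_
    rw [h _ (((t.op ψ).indepOf_matches x a).2 hx), mul_zero]
  · rfl

/-- If the tail has a positive letter, the control sits there and misses the collapsed slice.
Otherwise the control is on the prefix `q`, which differs from `p`. This is why one control per term
is enough. -/
theorem step_cons_of_collapsed {n : ℕ} {p q : Fin d} (hpq : p ≠ q) (hq : q ≠ 0)
    (t : ClubTerm d n) {ψ : (Fin (n + 1) → Fin d) → ℂ} (hψ : Collapsed fun x => ψ (pre p x))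
    (x : Fin n → Fin d) : step ψ (cons q t) (pre p x) = ψ (pre p x) := by
  rw [step, op_cons, CtrlOp.addLine_mulVec]
  by_cases ht : t.hasPos = true
  · simp only [ht, step_of_collapsed ht _ hψ, ite_self]
  · simp [hq, ht, hpq.symm]

theorem foldl_step_cons_self {n : ℕ} (q : Fin d) (L : List (ClubTerm d n))
    (ψ : (Fin (n + 1) → Fin d) → ℂ) :
    (fun x => (L.map (cons q)).foldl step ψ (pre q x)) =
      L.foldl step (fun x => ψ (pre q x)) := by
  induction L generalizing ψ with
  | nil => rfl
  | cons t L ih =>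
    simp only [List.map_cons, List.foldl_cons]
    rw [ih]
    congr 1
    ext x
    exact step_cons_self q t ψ x

theorem foldl_step_cons_of_collapsed {n : ℕ} {p q : Fin d} (hpq : p ≠ q) (hq : q ≠ 0)
    (L : List (ClubTerm d n)) {ψ : (Fin (n + 1) → Fin d) → ℂ}
    (hψ : Collapsed fun x => ψ (pre p x)) :
    (fun x => (L.map (cons q)).foldl step ψ (pre p x)) = fun x => ψ (pre p x) := by
  induction L generalizing ψ with
  | nil => rfl
  | cons t L ih =>
    have h := funext fun x => step_cons_of_collapsed hpq hq t hψ x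
    simp only [List.map_cons, List.foldl_cons]
    rw [ih (by rw [h]; exact hψ), h]

/-- Terms with prefix `q` collapse the slice `q` and keep the collapsed slices `p < q`. They may
scramble the slices that are still to come, which does no harm. The disjunction in `hp` separates
the pending slices from the finished ones. -/
theorem collapsed_foldl_flatMap {n : ℕ} {L : List (ClubTerm d n)}
    (hL : ∀ ψ, Collapsed (L.foldl step ψ)) (Q : List (Fin d)) (hQ : Q.Pairwise (· < ·))
    (ψ : (Fin (n + 1) → Fin d) → ℂ) (p : Fin d)
    (hp : p ∈ Q ∨ (Collapsed fun x => ψ (pre p x)) ∧ ∀ q ∈ Q, p < q) :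
    Collapsed fun x => (Q.flatMap fun q => L.map (cons q)).foldl step ψ (pre p x) := by
  induction Q generalizing ψ with
  | nil => exact (hp.resolve_left (by simp)).1
  | cons q Q ih =>
    simp only [List.flatMap_cons, List.foldl_append]
    rw [List.pairwise_cons] at hQ
    apply ih hQ.2
    rcases hp with hp | ⟨hp, hlt⟩
    · rcases List.mem_cons.1 hp with rfl | hp
      · right
        refine ⟨?_, hQ.1⟩
        rw [foldl_step_cons_self]
        exact hL _
      · exact Or.inl hp
    · right
      have hpq : p < q := hlt q List.mem_cons_self
      refine ⟨?_, fun r hr => hlt r (List.mem_cons_of_mem _ hr)⟩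
      -- Here `p < q` forces `q ≠ 0`; a prefix `0` would not be usable as a control.
      rw [foldl_step_cons_of_collapsed hpq.ne (fun h => by simp [h] at hpq) L hp]
      exact hp

/-- Only the entries `k 0⋯0` can be nonzero, and the uncontrolled reflection on the top line merges
them; at every other tail it acts on zeros. -/
theorem collapsed_step_clubs {n : ℕ} {ψ : (Fin (n + 1) → Fin d) → ℂ}
    (hψ : ∀ p, Collapsed fun x => ψ (pre p x)) : Collapsed (step ψ clubs) := by
  intro x hx
  rw [← pre_self_tail x] at hx ⊢
  have hm : ((clubs : ClubTerm d (n + 1)).op ψ).Matches (pre (x 0) (Fin.tail x)) := by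
    intro i q h
    simp [op, ctrl] at h
  rw [step, CtrlOp.toMatrix_mulVec, if_pos hm]
  have ht : ((clubs : ClubTerm d (n + 1)).op ψ).target = 0 := rfl
  simp only [ht, update_pre_zero]
  by_cases h : Fin.tail x = 0
  · rw [h] at hx ⊢
    have h0 : x 0 ≠ 0 := by
      intro h0
      rw [h0, pre_zero] at hx
      exact hx rfl
    exact householder_mulVec_self_apply h0 fun k => ψ (pre k 0)
  · refine Finset.sum_eq_zero fun a _ => ?_
    have h0 : ψ (pre a (Fin.tail x)) = 0 := hψ a _ h
    rw [h0, mul_zero]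

theorem collapsed_foldl_clubSeq : ∀ {n : ℕ} (ψ : (Fin n → Fin d) → ℂ),
    Collapsed ((clubSeq d n).foldl step ψ)
  | 0, ψ => fun x hx => absurd (Subsingleton.elim _ _) hx
  | n + 1, ψ => by
    rw [clubSeq, List.foldl_append]
    exact collapsed_step_clubs fun p =>
      collapsed_foldl_flatMap collapsed_foldl_clubSeq _ (List.pairwise_lt_finRange d) ψ p
        (Or.inl (List.mem_finRange p))

end ClubTerm

theorem run_clubSweep {d n : ℕ} [NeZero d] (L : List (ClubTerm d n)) (ψ : (Fin n → Fin d) → ℂ) :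
    run (clubSweep L ψ) *ᵥ ψ = L.foldl ClubTerm.step ψ := by
  induction L generalizing ψ with
  | nil => simp [clubSweep, run]
  | cons t L ih =>
    rw [clubSweep, run, ← Matrix.mulVec_mulVec, ih]
    rfl

theorem run_clubHouseholder_mulVec {d n : ℕ} [NeZero d] (ψ : (Fin n → Fin d) → ℂ)
    {m x : Fin n → Fin d} (hx : x ≠ m) : (run (clubHouseholder ψ m) *ᵥ ψ) x = 0 := by
  rw [clubHouseholder, run_shift_mulVec, run_clubSweep]
  exact ClubTerm.collapsed_foldl_clubSeq _ _ (sub_ne_zero.2 hx)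

theorem clubSweep_gate_mem {d n : ℕ} [NeZero d] (L : List (ClubTerm d n))
    (ψ : (Fin n → Fin d) → ℂ) :
    ∀ o ∈ clubSweep L ψ, o.gate ∈ Matrix.unitaryGroup (Fin d) ℂ := by
  induction L generalizing ψ with
  | nil => simp [clubSweep]
  | cons t L ih =>
    rw [clubSweep, List.forall_mem_cons]
    exact ⟨householder_mem_unitary _ _, ih _⟩

theorem CtrlOp.shift_gate_mem {d n : ℕ} [NeZero d] (m : Fin n → Fin d) {o : CtrlOp d n}
    (ho : o.gate ∈ Matrix.unitaryGroup (Fin d) ℂ) :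
    (o.shift m).gate ∈ Matrix.unitaryGroup (Fin d) ℂ := by
  rw [Matrix.mem_unitaryGroup_iff, Matrix.star_eq_conjTranspose] at *
  have h : (o.shift m).gate = o.gate.submatrix (Equiv.subRight (m o.target))
    (Equiv.subRight (m o.target)) := rfl
  rw [h, Matrix.conjTranspose_submatrix, Matrix.submatrix_mul_equiv, ho,
    Matrix.submatrix_one_equiv]

theorem clubHouseholder_gate_mem {d n : ℕ} [NeZero d] (ψ : (Fin n → Fin d) → ℂ)
    (m : Fin n → Fin d) :
    ∀ o ∈ clubHouseholder ψ m, o.gate ∈ Matrix.unitaryGroup (Fin d) ℂ := by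
  rw [clubHouseholder, List.forall_mem_map]
  exact fun o ho => CtrlOp.shift_gate_mem m (clubSweep_gate_mem _ _ o ho)

/-! ### Upper triangular matrices -/

/-- Upper triangular with respect to the lexicographic order of the dit strings. -/
def UpperTri {d n : ℕ} (A : OpN d n) : Prop :=
  Matrix.BlockTriangular A (toLex : (Fin n → Fin d) → Lex (Fin n → Fin d))

theorem toLex_pre_lt {d n : ℕ} {p q : Fin d} {x y : Fin n → Fin d} :
    toLex (pre p x) < toLex (pre q y) ↔ p < q ∨ p = q ∧ toLex x < toLex y :=
  Fin.pi_lex_lt_cons_cons (α := fun _ => Fin d) (fun {_} => (· < ·))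

theorem upperTri_succ {d n : ℕ} {A : OpN d (n + 1)}
    (h1 : ∀ p q x y, p < q → A (pre q x) (pre p y) = 0)
    (h2 : ∀ p, UpperTri (A.submatrix (pre p) (pre p))) : UpperTri A := by
  intro x y hxy
  rw [← pre_self_tail x, ← pre_self_tail y] at hxy ⊢
  rcases toLex_pre_lt.1 hxy with h | ⟨h, h'⟩
  · exact h1 _ _ _ _ h
  · rw [h]
    exact h2 _ h'

theorem mem_words {d : ℕ} : ∀ {n : ℕ} (x : Fin n → Fin d), x ∈ words d n
  | 0, x => by simp [words, Subsingleton.elim x Fin.elim0]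
  | n + 1, x => by
    rw [words, List.mem_flatMap]
    exact ⟨x 0, List.mem_finRange _, List.mem_map.2 ⟨Fin.tail x, mem_words _, pre_self_tail x⟩⟩

theorem words_pairwise (d : ℕ) : ∀ n : ℕ, (words d n).Pairwise fun x y => toLex x < toLex y
  | 0 => List.pairwise_singleton _ _
  | n + 1 => by
    rw [words, List.pairwise_flatMap]
    constructor
    · intro q _
      rw [List.pairwise_map]
      exact (words_pairwise d n).imp fun h => toLex_pre_lt.2 (Or.inr ⟨rfl, h⟩)
    · refine (List.pairwise_lt_finRange d).imp fun h x hx y hy => ?_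
      obtain ⟨x, _, rfl⟩ := List.mem_map.1 hx
      obtain ⟨y, _, rfl⟩ := List.mem_map.1 hy
      exact toLex_pre_lt.2 (Or.inl h)

/-- The inverse of an upper triangular matrix is upper triangular, and here it is `Aᴴ`, which is
lower triangular. -/
theorem UpperTri.isDiag_of_mem_unitary {d n : ℕ} {A : OpN d n} (hA : UpperTri A)
    (hU : A ∈ Matrix.unitaryGroup (Fin n → Fin d) ℂ) : A.IsDiag := by
  have h1 : A * Aᴴ = 1 := Matrix.mem_unitaryGroup_iff.1 hU
  have h2 : Aᴴ * A = 1 := Matrix.mem_unitaryGroup_iff'.1 hU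
  let _ : Invertible A := ⟨Aᴴ, h2, h1⟩
  have h3 : Matrix.BlockTriangular A⁻¹ (toLex : (Fin n → Fin d) → Lex (Fin n → Fin d)) :=
    Matrix.blockTriangular_inv_of_blockTriangular hA
  rw [Matrix.inv_eq_right_inv h1] at h3
  intro x y hxy
  rcases lt_trichotomy (toLex x) (toLex y) with h | h | h
  · have := h3 h
    simpa using this
  · exact absurd (toLex.injective h) hxy
  · exact hA h

/-! ### The Triangle algorithm -/

theorem householder_below_mulVec_of_eq_zero {d : ℕ} {m : Fin d} {ψ φ : Fin d → ℂ}
    (h : ∀ k, m ≤ k → φ k = 0) : householder m (below m ψ) *ᵥ φ = φ := by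
  refine householder_mulVec_of_disjoint fun k hk => h k ?_
  rcases hk with rfl | hk
  · exact le_rfl
  · by_contra hlt
    exact hk (if_pos (not_le.1 hlt))

/-- Split `φ` at level `m`: the reflection is built from the part at levels `≥ m` and fixes the
rest. -/
theorem householder_below_mulVec_self {d : ℕ} {m q : Fin d} (h : m < q) (φ : Fin d → ℂ) :
    (householder m (below m φ) *ᵥ φ) q = 0 := by
  have h1 : householder m (below m φ) *ᵥ φ = householder m (below m φ) *ᵥ below m φ +
      householder m (below m φ) *ᵥ (φ - below m φ) := by
    rw [← Matrix.mulVec_add, add_sub_cancel]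
  rw [h1, Pi.add_apply, householder_mulVec_self_apply h.ne', zero_add,
    householder_below_mulVec_of_eq_zero]
  · simp [below, h.not_gt]
  · intro k hk
    simp [below, hk.not_gt]

/-- The matrix that a procedure leaves. -/
def after {d n : ℕ} (A : OpN d n) (P : Procedure d n) : OpN d n := run (P A) * A

theorem after_apply {d n : ℕ} (A : OpN d n) (P : Procedure d n) (x y : Fin n → Fin d) :
    after A P x y = (run (P A) *ᵥ fun x => A x y) x := rfl

theorem after_inTurn {d n : ℕ} (L : List (Procedure d n)) (A : OpN d n) :
    after A (inTurn L) = L.foldl after A := by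
  induction L generalizing A with
  | nil => simp [after, inTurn, run]
  | cons P L ih =>
    rw [List.foldl_cons, ← ih, after, inTurn, run_append, Matrix.mul_assoc]
    rfl

theorem after_clearBlock {d n : ℕ} [NeZero d] (m : Fin d) (c : Fin n → Fin d) (l : Fin d)
    (A : OpN d (n + 1)) (q : Fin d) (x : Fin n → Fin d) (y : Fin (n + 1) → Fin d) :
    after A (clearBlock m c l) (pre q x) y =
      if q = l then (run (clubHouseholder (fun x => A (pre l x) (pre m c)) c) *ᵥ
        fun x => A (pre q x) y) x
      else A (pre q x) y := by
  rw [after_apply, clearBlock, run_addLine_mulVec]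
  simp [eq_comm]

theorem after_clearRest {d n : ℕ} [NeZero d] (m : Fin d) (c : Fin n → Fin d)
    (A : OpN d (n + 1)) (q : Fin d) (x : Fin n → Fin d) (y : Fin (n + 1) → Fin d) :
    after A (clearRest m c) (pre q x) y =
      if x = c then (householder m (below m fun a => A (pre a c) (pre m c)) *ᵥ
        fun a => A (pre a c) y) q
      else A (pre q x) y := by
  rw [after_apply, clearRest, run, run, one_mul, CtrlOp.toMatrix_mulVec]
  have hm : ∀ o : CtrlOp d (n + 1),
      o.ctrl = Fin.cons (α := fun _ => Option (Fin d)) none (fun i => some (c i)) →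
      (o.Matches (pre q x) ↔ x = c) := by
    intro o ho
    simp [CtrlOp.Matches, Fin.forall_fin_succ, pre, funext_iff, ho, eq_comm]
  by_cases hx : x = c
  · rw [if_pos hx, if_pos ((hm _ rfl).2 hx)]
    simp only [update_pre_zero, hx]
    rfl
  · rw [if_neg hx, if_neg (fun h => hx ((hm _ rfl).1 h))]

theorem after_onBlock {d n : ℕ} (P : Procedure d n) (a : Option (Fin d)) (m : Fin d)
    (A : OpN d (n + 1)) (q : Fin d) (x : Fin n → Fin d) (y : Fin (n + 1) → Fin d) :
    after A (onBlock P a m) (pre q x) y =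
      if a = none ∨ a = some q then
        (run (P (A.submatrix (pre m) (pre m))) *ᵥ fun x => A (pre q x) y) x
      else A (pre q x) y := by
  rw [after_apply, onBlock, run_addLine_mulVec]

/-- Below the diagonal blocks the block-columns before `m` and the columns `m c` with `D c` are
cleared, and the diagonal blocks up to the `m`-th one are upper triangular. -/
structure Cleared {d n : ℕ} (m : ℕ) (D : (Fin n → Fin d) → Prop) (A : OpN d (n + 1)) : Prop where
  col : ∀ p q : Fin d, ∀ x y, p < q → (p.val < m ∨ p.val = m ∧ D y) → A (pre q x) (pre p y) = 0
  diag : ∀ p : Fin d, p.val ≤ m → UpperTri (A.submatrix (pre p) (pre p))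

theorem mulVec_eq_zero_of {d n : ℕ} (M : OpN d n) {φ : (Fin n → Fin d) → ℂ} (h : ∀ x, φ x = 0)
    (x : Fin n → Fin d) : (M *ᵥ φ) x = 0 := by
  have : φ = 0 := funext h
  simp [this]

/-- The operations mix rows inside the block-row `l` only: there the finished columns are zero, and
`l > m` keeps the finished diagonal blocks out of reach. -/
theorem Cleared.clearBlock {d n : ℕ} [NeZero d] {m : Fin d} {D : (Fin n → Fin d) → Prop}
    {A : OpN d (n + 1)} (hA : Cleared m D A) (c : Fin n → Fin d) {l : Fin d} (hl : m < l) :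
    Cleared m D (after A (clearBlock m c l)) where
  col p q x y hpq hp := by
    rw [after_clearBlock]
    split_ifs
    · exact mulVec_eq_zero_of _ (fun x => hA.col p q x y hpq hp) x
    · exact hA.col p q x y hpq hp
  diag p hp := by
    convert hA.diag p hp using 1
    ext x y
    have : p ≠ l := by rintro rfl; exact absurd hl (not_lt.2 hp)
    rw [Matrix.submatrix_apply, after_clearBlock, if_neg this, Matrix.submatrix_apply]

/-- The alternative "still to be treated or already zero" is the induction hypothesis that survives
one step, since different block-rows do not interact. -/
theorem Cleared.clearBlocks {d n : ℕ} [NeZero d] {m : Fin d} {D : (Fin n → Fin d) → Prop}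
    (c : Fin n → Fin d) (L : List (Fin d)) (hL : ∀ l ∈ L, m < l) {A : OpN d (n + 1)}
    (hA : Cleared m D A) :
    Cleared m D ((L.map (QuditTriangle.clearBlock m c)).foldl after A) ∧
      ∀ l x, x ≠ c → (l ∈ L ∨ A (pre l x) (pre m c) = 0) →
        (L.map (QuditTriangle.clearBlock m c)).foldl after A (pre l x) (pre m c) = 0 := by
  induction L generalizing A with
  | nil => exact ⟨hA, fun l x _ h => h.resolve_left (by simp)⟩
  | cons l' L ih =>
    rw [List.forall_mem_cons] at hL
    rw [List.map_cons, List.foldl_cons]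
    have h := ih hL.2 (hA.clearBlock c hL.1)
    refine ⟨h.1, fun l x hx hl => h.2 l x hx ?_⟩
    by_cases hmem : l ∈ L
    · exact Or.inl hmem
    · right
      rw [after_clearBlock]
      split_ifs with heq
      · subst heq
        exact run_clubHouseholder_mulVec _ hx
      · exact hl.resolve_left (by simp [heq, hmem])

/-- The reflection combines the rows `k c` with `k ≥ m`. In the earlier columns these entries
vanish, so nothing is lost. Outside the rows `x c`, the new column was emptied beforehand, which is
`hc`. -/
theorem Cleared.clearRest {d n : ℕ} [NeZero d] {m : Fin d} {D : (Fin n → Fin d) → Prop}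
    {c : Fin n → Fin d} {A : OpN d (n + 1)} (hA : Cleared m D A)
    (hD : ∀ y, D y ↔ toLex y < toLex c)
    (hc : ∀ l x, m < l → x ≠ c → A (pre l x) (pre m c) = 0) :
    Cleared m (fun y => D y ∨ y = c) (after A (clearRest m c)) := by
  have key : ∀ (q p : Fin d) y, (p.val < m.val ∨ p = m ∧ D y) →
      (householder m (below m fun a => A (pre a c) (pre m c)) *ᵥ
        fun a => A (pre a c) (pre p y)) q = A (pre q c) (pre p y) := by
    intro q p y hp
    rw [householder_below_mulVec_of_eq_zero]
    intro k hk
    rcases hp with hp | ⟨rfl, hy⟩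
    · exact hA.col p k c y (lt_of_lt_of_le hp hk) (Or.inl hp)
    · rcases hk.eq_or_lt with rfl | hk
      -- In the row `m c` the entry lies below the diagonal of the `m`-th diagonal block. This is
      -- why that block has to be reduced before its columns are treated.
      · exact hA.diag p le_rfl ((hD y).1 hy)
      · exact hA.col p k c y hk (Or.inr ⟨rfl, hy⟩)
  constructor
  · intro p q x y hpq hp
    rw [after_clearRest]
    by_cases h : p.val < m ∨ p = m ∧ D y
    · have h' : p.val < m ∨ p.val = m ∧ D y := h.imp_right (And.imp_left (congrArg _))
      split_ifs with hx
      · rw [key q p y h]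
        exact hA.col p q c y hpq h'
      · exact hA.col p q x y hpq h'
    · obtain ⟨rfl, rfl⟩ : p = m ∧ y = c := by
        push Not at h
        rcases hp with hp | ⟨hp, hy⟩
        · exact absurd hp h.1.not_gt
        · have := Fin.ext hp
          exact ⟨this, hy.resolve_left (h.2 this)⟩
      split_ifs with hx
      · exact householder_below_mulVec_self hpq _
      · exact hc q x hpq hx
  · intro p hp x y hxy
    rw [Matrix.submatrix_apply, after_clearRest]
    have h0 := hA.diag p hp hxy
    rw [Matrix.submatrix_apply] at h0
    split_ifs with hx
    · subst hx
      rcases hp.eq_or_lt with hpm | hlt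
      · rw [key p p y (Or.inr ⟨Fin.ext hpm, (hD y).2 hxy⟩), h0]
      · rw [key p p y (Or.inl hlt), h0]
    · exact h0

theorem Cleared.congr {d n : ℕ} {m : ℕ} {D E : (Fin n → Fin d) → Prop} {A : OpN d (n + 1)}
    (hA : Cleared m D A) (h : ∀ y, E y → D y) : Cleared m E A :=
  ⟨fun p q x y hpq hp => hA.col p q x y hpq (hp.imp_right (And.imp_right (h y))), hA.diag⟩

/-- `W` lists the words already treated. Because `words d n` is increasing, membership in `W` means
being smaller than the current word `c`, as `Cleared.clearRest` requires. -/
theorem Cleared.columns {d n : ℕ} [NeZero d] {m : Fin d} (W L : List (Fin n → Fin d))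
    (h : W ++ L = words d n) {A : OpN d (n + 1)} (hA : Cleared m (· ∈ W) A) :
    Cleared m (fun _ => True) ((L.flatMap fun c =>
      (((List.finRange d).filter fun l => decide (m < l)).map fun l =>
        QuditTriangle.clearBlock m c l) ++ [QuditTriangle.clearRest m c]).foldl after A) := by
  induction L generalizing W A with
  | nil =>
    refine hA.congr fun y _ => ?_
    rw [List.append_nil] at h
    exact h ▸ mem_words y
  | cons c L ih =>
    rw [List.flatMap_cons, List.foldl_append, List.foldl_append]
    refine ih (W ++ [c]) (by simpa using h) ?_
    have hb := hA.clearBlocks c ((List.finRange d).filter fun l => decide (m < l)) (by simp)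
    have hp := words_pairwise d n
    rw [← h, List.pairwise_append, List.pairwise_cons] at hp
    refine (hb.1.clearRest (c := c) (fun y => ⟨fun hy => hp.2.2 y hy c List.mem_cons_self,
      fun hy => ?_⟩) fun l x hl hx => hb.2 l x hx (Or.inl (by simpa using hl))).congr (by simp)
    have hw := mem_words y
    rw [← h, List.mem_append, List.mem_cons] at hw
    rcases hw with hw | rfl | hw
    · exact hw
    · exact absurd hy (lt_irrefl _)
    · exact absurd hy (hp.2.1.1 y hw).not_gt

/-- The extra control confines the operations to the block-row `m + 1`, where all block-columns up
to `m` are zero by now. -/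
theorem Cleared.onBlock {d n : ℕ} {m : ℕ} {A : OpN d (n + 1)}
    (hA : Cleared m (fun _ => True) A) {P : Procedure d n} (hP : ∀ B, UpperTri (after B P))
    (h : m + 1 < d) :
    Cleared (m + 1) (fun _ => False) (after A (onBlock P (some ⟨m + 1, h⟩) ⟨m + 1, h⟩)) where
  col p q x y hpq hp := by
    have hp' : p.val < m ∨ p.val = m ∧ True := by
      simp only [and_false, or_false] at hp
      simp only [and_true]
      omega
    rw [after_onBlock]
    by_cases hq : some (⟨m + 1, h⟩ : Fin d) = none ∨ some ⟨m + 1, h⟩ = some q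
    · rw [if_pos hq]
      exact mulVec_eq_zero_of _ (fun x => hA.col p q x y hpq hp') x
    · rw [if_neg hq]
      exact hA.col p q x y hpq hp'
  diag p hp := by
    by_cases hpm : p = ⟨m + 1, h⟩
    · convert hP (A.submatrix (pre p) (pre p)) using 1
      ext x y
      subst hpm
      rw [Matrix.submatrix_apply, after_onBlock, if_pos (by simp), after_apply]
      rfl
    · have hlt : p.val ≤ m := by
        have : p.val ≠ m + 1 := fun h' => hpm (Fin.ext h')
        omega
      convert hA.diag p hlt using 1
      ext x y
      rw [Matrix.submatrix_apply, after_onBlock, if_neg (by simpa using Ne.symm hpm),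
        Matrix.submatrix_apply]

theorem upperTri_after_triangleStep {d n : ℕ} [NeZero d] {P : Procedure d n}
    (hP : ∀ A, UpperTri (after A P)) (A : OpN d (n + 1)) : UpperTri (after A (triangleStep P)) := by
  rw [triangleStep, after_inTurn, List.foldl_cons]
  set A₀ := after A (onBlock P none 0) with hA₀
  have h0 : Cleared 0 (fun _ => False) A₀ := by
    constructor
    · simp
    · intro p hp
      obtain rfl : p = 0 := Fin.ext (by simpa using hp)
      convert hP (A.submatrix (pre 0) (pre 0)) using 1
      ext x y
      rw [Matrix.submatrix_apply, hA₀, after_onBlock, if_pos (by simp), after_apply]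
      rfl
  set body : Fin d → List (Procedure d (n + 1)) := fun m =>
    if h : m.val + 1 < d then
      ((words d n).flatMap fun c =>
        (((List.finRange d).filter fun l => decide (m < l)).map fun l => clearBlock m c l)
          ++ [clearRest m c])
        ++ [onBlock P (some ⟨m.val + 1, h⟩) ⟨m.val + 1, h⟩]
    else [] with hbody
  have hk : ∀ k, k + 1 ≤ d →
      Cleared k (fun _ => False) ((((List.finRange d).take k).flatMap body).foldl after A₀) := by
    intro k
    induction k with
    | zero => intro _; simpa using h0
    | succ k ih =>
      intro hkd
      have hk' : k < d := by omega
      have h1 : (List.finRange d).take (k + 1) = (List.finRange d).take k ++ [⟨k, hk'⟩] := by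
        rw [List.take_add_one]
        simp [hk']
      rw [h1, List.flatMap_append, List.foldl_append, List.flatMap_cons, List.flatMap_nil,
        List.append_nil]
      have h3 : body ⟨k, hk'⟩ = _ := dif_pos hkd
      rw [h3, List.foldl_append, List.foldl_cons, List.foldl_nil]
      have h2 := (ih (by omega)).congr (E := (· ∈ ([] : List (Fin n → Fin d)))) (by simp)
      exact (Cleared.columns (m := ⟨k, hk'⟩) [] _ rfl h2).onBlock hP hkd
  have hd : 0 < d := Nat.pos_of_ne_zero (NeZero.ne d)
  -- The last block-column contributes no procedure, so the invariant at `k = d - 1` describes the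
  -- final matrix.
  have hlast : (List.finRange d).flatMap body =
      ((List.finRange d).take (d - 1)).flatMap body := by
    conv_lhs => rw [← List.take_append_drop (d - 1) (List.finRange d)]
    rw [List.flatMap_append]
    refine (List.self_eq_append_right.2 ?_).symm
    rw [List.flatMap_eq_nil_iff]
    intro m hm
    have : ¬ m.val + 1 < d := by
      obtain ⟨i, hi, rfl⟩ := List.getElem_of_mem hm
      simp at hi ⊢
      omega
    rw [hbody]
    exact dif_neg this
  rw [hlast]
  have hfin := hk (d - 1) (by omega)
  refine upperTri_succ (fun p q x y hpq => hfin.col p q x y hpq (Or.inl ?_))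
    fun p => hfin.diag p (by omega)
  have := q.isLt
  omega

/-! ### One qudit: the QR reduction -/

/-- One step of the QR reduction of `A`. -/
def qrStep {d : ℕ} (A Q : Op1 d) (j : Fin d) : Op1 d :=
  householder j (below j fun x => (Q * A) x j) * Q

theorem qrGate_eq {d : ℕ} (A : Op1 d) : qrGate A = (List.finRange d).foldl (qrStep A) 1 := rfl

theorem qrStep_mul_apply {d : ℕ} (A Q : Op1 d) (j i k : Fin d) :
    (qrStep A Q j * A) i k =
      (householder j (below j fun x => (Q * A) x j) *ᵥ fun x => (Q * A) x k) i := by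
  rw [qrStep, Matrix.mul_assoc]
  rfl

theorem qrGate_mem_unitary {d : ℕ} (A : Op1 d) :
    qrGate A ∈ Matrix.unitaryGroup (Fin d) ℂ := by
  rw [qrGate_eq]
  refine List.foldlRecOn _ _ (one_mem _) fun Q hQ j _ => ?_
  exact mul_mem (householder_mem_unitary _ _) hQ

/-- Earlier columns vanish at all levels from the current one on, hence are fixed by the later
reflections. -/
theorem qrGate_mul_apply {d : ℕ} (A : Op1 d) {i j : Fin d} (h : j < i) :
    (qrGate A * A) i j = 0 := by
  have key : ∀ k ≤ d, ∀ i j : Fin d, j < i → j.val < k →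
      (((List.finRange d).take k).foldl (qrStep A) 1 * A) i j = 0 := by
    intro k
    induction k with
    | zero => simp
    | succ k ih =>
      intro hk i j hji hj
      have h1 : (List.finRange d).take (k + 1) = (List.finRange d).take k ++ [⟨k, hk⟩] := by
        rw [List.take_add_one]
        simp [Nat.lt_of_succ_le hk]
      rw [h1, List.foldl_append, List.foldl_cons, List.foldl_nil, qrStep_mul_apply]
      rcases Nat.lt_succ_iff_lt_or_eq.1 hj with hj | hj
      · rw [householder_below_mulVec_of_eq_zero]
        · exact ih (by omega) i j hji hj
        · intro l hl
          exact ih (by omega) l j (lt_of_lt_of_le hj hl) hj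
      · obtain rfl : j = ⟨k, hk⟩ := Fin.ext hj
        exact householder_below_mulVec_self hji _
  have := key d le_rfl i j h j.isLt
  rwa [List.take_of_length_le (by simp)] at this

theorem upperTri_after_triangle {d : ℕ} [NeZero d] : ∀ (n : ℕ) (A : OpN d n),
    UpperTri (after A (triangle n))
  | 0, A => fun x y h => absurd (congrArg toLex (Subsingleton.elim y x)) h.ne
  | 1, A => by
    intro x y h
    have h' : y 0 < x 0 := by
      rw [← pre_self_tail x, ← pre_self_tail y] at h
      rcases toLex_pre_lt.1 h with h | ⟨_, h⟩
      · exact h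
      · exact absurd (congrArg toLex (Subsingleton.elim _ _)) h.ne
    rw [after_apply, triangle, run, run, one_mul, CtrlOp.toMatrix_mulVec]
    have hm : ∀ o : CtrlOp d 1, o.ctrl = (fun _ => none) → o.Matches x :=
      fun o ho i q h => by simp [ho] at h
    rw [if_pos (hm _ rfl)]
    rw [← qrGate_mul_apply (A.submatrix (fun a _ => a) (fun a _ => a)) h']
    refine Finset.sum_congr rfl fun a _ => ?_
    congr 1
    change A (Function.update x 0 a) y = A (fun _ => a) (fun _ => y 0)
    congr 1
    · ext i
      simp [Subsingleton.elim i 0]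
    · ext i
      simp [Subsingleton.elim i 0]
  | n + 2, A => upperTri_after_triangleStep (upperTri_after_triangle (n + 1)) A

theorem forall_mem_inTurn {d n : ℕ} {p : CtrlOp d n → Prop} {L : List (Procedure d n)}
    (h : ∀ P ∈ L, ∀ A, ∀ o ∈ P A, p o) (A : OpN d n) : ∀ o ∈ inTurn L A, p o := by
  induction L generalizing A with
  | nil => simp [inTurn]
  | cons P L ih =>
    rw [List.forall_mem_cons] at h
    rw [inTurn, List.forall_mem_append]
    exact ⟨h.1 A, ih h.2 _⟩

theorem triangle_gate_mem {d : ℕ} [NeZero d] : ∀ (n : ℕ) (A : OpN d n),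
    ∀ o ∈ triangle n A, o.gate ∈ Matrix.unitaryGroup (Fin d) ℂ
  | 0, A => by simp [triangle]
  | 1, A => by
    rw [triangle, List.forall_mem_singleton]
    exact qrGate_mem_unitary _
  | n + 2, A => by
    have hblock : ∀ a m, ∀ A, ∀ o ∈ onBlock (triangle (n + 1)) a m A,
        o.gate ∈ Matrix.unitaryGroup (Fin d) ℂ := by
      intro a m A
      rw [onBlock, List.forall_mem_map]
      exact triangle_gate_mem (n + 1) _
    rw [triangle, triangleStep]
    apply forall_mem_inTurn
    simp only [List.forall_mem_cons, List.forall_mem_flatMap]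
    refine ⟨hblock _ _, fun m _ => ?_⟩
    split_ifs with h
    · simp only [List.forall_mem_append, List.forall_mem_flatMap, List.forall_mem_map,
        List.forall_mem_singleton]
      refine ⟨fun c _ => ⟨fun l _ A => ?_, fun A => ?_⟩, hblock _ _⟩
      · rw [clearBlock, List.forall_mem_map]
        exact clubHouseholder_gate_mem _ _
      · rw [clearRest, List.forall_mem_singleton]
        exact householder_mem_unitary _ _
    · simp

theorem run_triangle_mul_mem_unitary {d n : ℕ} [NeZero d] {U : OpN d n}
    (hU : U ∈ Matrix.unitaryGroup (Fin n → Fin d) ℂ) :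
    run (triangle n U) * U ∈ Matrix.unitaryGroup (Fin n → Fin d) ℂ :=
  mul_mem (run_mem_unitary (triangle_gate_mem n U)) hU

theorem run_triangle_mul_isDiag {d n : ℕ} [NeZero d] {U : OpN d n}
    (hU : U ∈ Matrix.unitaryGroup (Fin n → Fin d) ℂ) : (run (triangle n U) * U).IsDiag :=
  (upperTri_after_triangle n U).isDiag_of_mem_unitary (run_triangle_mul_mem_unitary hU)

/-! ### Counting the operations of the Triangle algorithm -/

theorem CtrlOp.numControls_addLine {d n : ℕ} (a : Option (Fin d)) (o : CtrlOp d n) :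
    (o.addLine a).numControls = o.numControls + if a.isSome then 1 else 0 := by
  rw [numControls, Fin.card_filter_univ_succ]
  cases a <;> rfl

theorem CtrlOp.numControls_shift {d n : ℕ} [NeZero d] (m : Fin n → Fin d) (o : CtrlOp d n) :
    (o.shift m).numControls = o.numControls := by
  simp [numControls, shift]

/-- The number of controls of the operation that a term contributes. -/
def ClubTerm.numControls {d n : ℕ} [NeZero d] (t : ClubTerm d n) : ℕ :=
  (Finset.univ.filter fun i => (t.ctrl i).isSome = true).card

/-- A prefix becomes a control only when no positive letter stands to its right, so controls never
accumulate. -/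
theorem ClubTerm.numControls_le {d : ℕ} [NeZero d] : ∀ {n : ℕ} (t : ClubTerm d n),
    t.numControls ≤ if t.hasPos then 1 else 0
  | _, clubs => by simp [numControls, ctrl]
  | _, cons q t => by
    have ih := numControls_le t
    have h : (cons q t).numControls =
        t.numControls + if q ≠ 0 ∧ t.hasPos = false then 1 else 0 := by
      rw [numControls, Fin.card_filter_univ_succ]
      by_cases hq : q ≠ 0 ∧ t.hasPos = false
      · simp [ctrl, hq, numControls]
      · simp only [ctrl, if_neg hq, numControls]
        simp
    rw [h, hasPos]
    by_cases hq : q = 0 <;> by_cases ht : t.hasPos = true <;> simp_all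

/-- The numbers of controls of a list of operations. -/
def profile {d n : ℕ} (L : List (CtrlOp d n)) : List ℕ := L.map CtrlOp.numControls

theorem profile_singleton_congr {d n : ℕ} {o p : CtrlOp d n} (h : o.ctrl = p.ctrl) :
    profile [o] = profile [p] := by
  simp [profile, CtrlOp.numControls, h]

theorem profile_clubSweep {d n : ℕ} [NeZero d] (L : List (ClubTerm d n))
    (ψ : (Fin n → Fin d) → ℂ) : profile (clubSweep L ψ) = L.map ClubTerm.numControls := by
  induction L generalizing ψ with
  | nil => rfl
  | cons t L ih =>
    rw [clubSweep, profile, List.map_cons, List.map_cons, ← ih]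
    rfl

theorem profile_map_addLine {d n : ℕ} (a : Option (Fin d)) (L : List (CtrlOp d n)) :
    profile (L.map (CtrlOp.addLine a)) =
      (profile L).map fun k => k + if a.isSome then 1 else 0 := by
  simp [profile, Function.comp_def, CtrlOp.numControls_addLine]

theorem profile_clubHouseholder {d n : ℕ} [NeZero d] (ψ : (Fin n → Fin d) → ℂ)
    (m : Fin n → Fin d) :
    profile (clubHouseholder ψ m) = (clubSeq d n).map ClubTerm.numControls := by
  rw [← profile_clubSweep, clubHouseholder, profile, List.map_map]
  exact List.map_congr_left fun o _ => CtrlOp.numControls_shift m o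

/-- The numbers of controls of the operations that a procedure outputs do not depend on the
matrix. -/
def Oblivious {d n : ℕ} (P : Procedure d n) : Prop := ∀ A B, profile (P A) = profile (P B)

theorem oblivious_inTurn {d n : ℕ} {L : List (Procedure d n)} (h : ∀ P ∈ L, Oblivious P) :
    Oblivious (inTurn L) := by
  induction L with
  | nil => exact fun _ _ => rfl
  | cons P L ih =>
    intro A B
    rw [List.forall_mem_cons] at h
    have h1 := h.1 A B
    have h2 := ih h.2 (run (P A) * A) (run (P B) * B)
    simp only [profile] at h1 h2
    rw [inTurn, inTurn, profile, profile, List.map_append, List.map_append, h1, h2]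

theorem oblivious_onBlock {d n : ℕ} {P : Procedure d n} (hP : Oblivious P) (a : Option (Fin d))
    (m : Fin d) : Oblivious (onBlock P a m) := by
  intro A B
  rw [onBlock, onBlock, profile_map_addLine, profile_map_addLine, hP]

theorem oblivious_triangle {d : ℕ} [NeZero d] : ∀ n : ℕ,
    Oblivious (triangle n : Procedure d n)
  | 0 => by
    intro A B
    simp only [triangle]
  | 1 => by
    intro A B
    simp only [triangle]
    exact profile_singleton_congr rfl
  | n + 2 => by
    have ih := oblivious_triangle (d := d) (n + 1)
    rw [triangle, triangleStep]
    apply oblivious_inTurn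
    simp only [List.forall_mem_cons, List.forall_mem_flatMap]
    refine ⟨oblivious_onBlock ih _ _, fun m _ => ?_⟩
    split_ifs with h
    · simp only [List.forall_mem_append, List.forall_mem_flatMap, List.forall_mem_map,
        List.forall_mem_singleton]
      refine ⟨fun c _ => ⟨fun l _ A B => ?_, fun A B => profile_singleton_congr rfl⟩, oblivious_onBlock ih _ _⟩
      rw [clearBlock, clearBlock, profile_map_addLine, profile_map_addLine,
        profile_clubHouseholder, profile_clubHouseholder]
    · simp

/-! ### Weighted counting: an operation with `k` controls counts `d ^ k` -/

/-- The sum of `d ^ k` over the operations of a list, `k` their numbers of controls. -/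
def weight {d n : ℕ} (L : List (CtrlOp d n)) : ℕ := ((profile L).map (d ^ ·)).sum

theorem weight_append {d n : ℕ} (L M : List (CtrlOp d n)) :
    weight (L ++ M) = weight L + weight M := by
  simp [weight, profile]

theorem weight_map_addLine {d n : ℕ} (a : Option (Fin d)) (L : List (CtrlOp d n)) :
    weight (L.map (CtrlOp.addLine a)) = (if a.isSome then d else 1) * weight L := by
  rw [weight, profile_map_addLine, weight, ← List.sum_map_mul_left, List.map_map]
  congr 1
  refine List.map_congr_left fun k _ => ?_
  cases a <;> simp [pow_succ, mul_comm]

/-- The weight of the output of a procedure is at most `w`, for all matrices. -/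
def WeightLE {d n : ℕ} (P : Procedure d n) (w : ℕ) : Prop := ∀ A, weight (P A) ≤ w

theorem WeightLE.inTurn_append {d n : ℕ} {L M : List (Procedure d n)} {a b : ℕ}
    (hL : WeightLE (inTurn L) a) (hM : WeightLE (inTurn M) b) :
    WeightLE (inTurn (L ++ M)) (a + b) := by
  intro A
  have h : ∀ A, inTurn (L ++ M) A = inTurn L A ++ inTurn M (run (inTurn L A) * A) := by
    clear hL hM
    induction L with
    | nil => intro A; simp [inTurn, run]
    | cons P L ih =>
      intro A
      rw [List.cons_append, inTurn, ih, inTurn, run_append, List.append_assoc, Matrix.mul_assoc]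
  rw [h, weight_append]
  exact Nat.add_le_add (hL _) (hM _)

theorem WeightLE.inTurn_singleton {d n : ℕ} {P : Procedure d n} {a : ℕ} (hP : WeightLE P a) :
    WeightLE (inTurn [P]) a := by
  intro A
  simpa [inTurn] using hP A

theorem WeightLE.inTurn_nil {d n : ℕ} : WeightLE (inTurn ([] : List (Procedure d n))) 0 := by
  intro A
  simp [inTurn, weight, profile]

theorem WeightLE.inTurn_flatMap {d n : ℕ} {α : Type*} (X : List α)
    {f : α → List (Procedure d n)} {w : α → ℕ} (h : ∀ x ∈ X, WeightLE (inTurn (f x)) (w x)) :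
    WeightLE (inTurn (X.flatMap f)) (X.map w).sum := by
  induction X with
  | nil => exact WeightLE.inTurn_nil
  | cons x X ih =>
    rw [List.forall_mem_cons] at h
    rw [List.flatMap_cons, List.map_cons, List.sum_cons]
    exact h.1.inTurn_append (ih h.2)

theorem WeightLE.mono {d n : ℕ} {P : Procedure d n} {a b : ℕ} (h : WeightLE P a) (hab : a ≤ b) :
    WeightLE P b := fun A => (h A).trans hab

/-- The length is the geometric sum `1 + d + ⋯ + d ^ (n - 1)`, written without division or truncated
subtraction of powers. -/
theorem length_clubSeq (d n : ℕ) (hd : 1 ≤ d) : (d - 1) * (clubSeq d n).length + 1 = d ^ n := by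
  induction n with
  | zero => simp [clubSeq]
  | succ n ih =>
    obtain ⟨e, rfl⟩ : ∃ e, d = e + 1 := ⟨d - 1, by omega⟩
    have h : (clubSeq (e + 1) (n + 1)).length = (e + 1) * (clubSeq (e + 1) n).length + 1 := by
      simp [clubSeq, List.length_flatMap]
    rw [pow_succ, ← ih, h]
    simp
    ring

theorem length_words (d n : ℕ) : (words d n).length = d ^ n := by
  induction n with
  | zero => simp [words]
  | succ n ih => simp [words, List.length_flatMap, ih, pow_succ, mul_comm]

theorem weight_clubHouseholder_le {d n : ℕ} [NeZero d] (ψ : (Fin n → Fin d) → ℂ)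
    (m : Fin n → Fin d) : weight (clubHouseholder ψ m) ≤ (clubSeq d n).length * d := by
  rw [weight, profile_clubHouseholder, List.map_map]
  refine (List.sum_le_card_nsmul _ d ?_).trans (by simp)
  simp only [List.mem_map]
  rintro _ ⟨t, _, rfl⟩
  have h1 : t.numControls ≤ 1 := (ClubTerm.numControls_le t).trans (by split_ifs <;> simp)
  exact (Nat.pow_le_pow_right (Nat.pos_of_ne_zero (NeZero.ne d)) h1).trans (pow_one d).le

theorem weightLE_clearBlock {d n : ℕ} [NeZero d] (m : Fin d) (c : Fin n → Fin d) (l : Fin d) :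
    WeightLE (clearBlock m c l) (d * ((clubSeq d n).length * d)) := by
  intro A
  rw [clearBlock, weight_map_addLine]
  exact Nat.mul_le_mul_left _ (weight_clubHouseholder_le _ _)

theorem weightLE_clearRest {d n : ℕ} (m : Fin d) (c : Fin n → Fin d) :
    WeightLE (clearRest m c) (d ^ n) := by
  intro A
  have h : ∀ o : CtrlOp d (n + 1), o.ctrl =
      Fin.cons (α := fun _ => Option (Fin d)) none (fun i => some (c i)) →
      weight [o] = d ^ n := by
    intro o ho
    have h : o.numControls = n := by
      simp [CtrlOp.numControls, Fin.card_filter_univ_succ, ho]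
    simp [weight, profile, h]
  exact (h _ rfl).le

theorem weightLE_onBlock {d n : ℕ} {P : Procedure d n} {w : ℕ} (hP : WeightLE P w)
    (a : Option (Fin d)) (m : Fin d) :
    WeightLE (onBlock P a m) ((if a.isSome then d else 1) * w) := by
  intro A
  rw [onBlock, weight_map_addLine]
  exact Nat.mul_le_mul_left _ (hP _)

/-- The factor `d ^ n` counts the columns of a block-column. For one column, at most `d - 1`
block-rows cost `d * (length * d)` each, the two factors `d` coming from the extra control and from
the single control of a `♣`-term; by `length_clubSeq` their sum is at most `d ^ n * d ^ 2`. The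
remaining `d ^ n` is the fully controlled `clearRest`, and `d * w` the next diagonal block. -/
theorem weightLE_triangleStep {d n : ℕ} [NeZero d] {P : Procedure d n} {w : ℕ}
    (hP : WeightLE P w) :
    WeightLE (triangleStep P)
      (w + (d - 1) * (d ^ n * (d ^ n * d ^ 2 + d ^ n) + d * w)) := by
  have hd : 1 ≤ d := Nat.one_le_iff_ne_zero.2 (NeZero.ne d)
  have h0 : WeightLE (onBlock P none 0) w := (weightLE_onBlock hP _ _).mono (by simp)
  rw [triangleStep, ← List.singleton_append]
  refine h0.inTurn_singleton.inTurn_append ?_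
  refine (WeightLE.inTurn_flatMap (List.finRange d) (w := fun m =>
    if m.val + 1 < d then d ^ n * (d ^ n * d ^ 2 + d ^ n) + d * w else 0) fun m _ => ?_).mono ?_
  · by_cases h : m.val + 1 < d
    · rw [dif_pos h, if_pos h]
      refine WeightLE.inTurn_append ?_ ((weightLE_onBlock hP _ _).inTurn_singleton)
      refine (WeightLE.inTurn_flatMap (words d n) (w := fun _ => d ^ n * d ^ 2 + d ^ n)
        fun c _ => ?_).mono (by simp [length_words])
      refine WeightLE.inTurn_append ?_ (weightLE_clearRest m c).inTurn_singleton
      have hmap : ((List.finRange d).filter fun l => decide (m < l)).map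
          (fun l => clearBlock m c l) =
          ((List.finRange d).filter fun l => decide (m < l)).flatMap
            (fun l => [clearBlock m c l]) := by
        rw [List.map_eq_flatMap]
      rw [hmap]
      refine (WeightLE.inTurn_flatMap _ (w := fun _ => d * ((clubSeq d n).length * d))
        fun l _ => (weightLE_clearBlock m c l).inTurn_singleton).mono ?_
      have hlen : ((List.finRange d).filter fun l => decide (m < l)).length ≤ d - 1 := by
        have : ((List.finRange d).filter fun l => decide (m < l)).length
            < (List.finRange d).length :=
          List.length_filter_lt_length_iff_exists.2 ⟨m, List.mem_finRange m, by simp⟩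
        simp only [List.length_finRange] at this
        omega
      rw [List.map_const', List.sum_replicate, smul_eq_mul]
      calc _ ≤ (d - 1) * (d * ((clubSeq d n).length * d)) := Nat.mul_le_mul_right _ hlen
        _ = ((d - 1) * (clubSeq d n).length) * d ^ 2 := by ring
        _ ≤ _ := Nat.mul_le_mul_right _ (by rw [← length_clubSeq d n hd]; omega)
    · rw [dif_neg h]
      exact WeightLE.inTurn_nil.mono (Nat.zero_le _)
  · rw [← Fin.sum_univ_def]
    obtain ⟨e, rfl⟩ : ∃ e, d = e + 1 := ⟨d - 1, by omega⟩
    -- The summand of the last block-column is zero and the other `d - 1` are equal.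
    rw [Fin.sum_univ_castSucc]
    simp

theorem weightLE_triangle {d : ℕ} [NeZero d] (hd : 2 ≤ d) : ∀ n : ℕ,
    WeightLE (triangle n : Procedure d n) (d ^ (2 * n + 4))
  | 0 => fun A => Nat.zero_le _
  | 1 => fun A => by
    have h : ∀ o : CtrlOp d 1, o.ctrl = (fun _ => none) → weight [o] = 1 := by
      intro o ho
      simp [weight, profile, CtrlOp.numControls, ho]
    exact (h _ rfl).le.trans (Nat.one_le_pow _ _ (by omega))
  | n + 2 => by
    refine (weightLE_triangleStep (weightLE_triangle hd (n + 1))).mono ?_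
    obtain ⟨e, rfl⟩ : ∃ e, d = e + 1 := ⟨d - 1, by omega⟩
    rw [Nat.add_sub_cancel]
    have h1 : (e + 1) ^ (2 * (n + 1) + 4) = ((e + 1) ^ (n + 1)) ^ 2 * (e + 1) ^ 4 := by
      rw [← pow_mul, ← pow_add]; congr 1; ring
    have h2 : (e + 1) ^ (2 * (n + 2) + 4) = ((e + 1) ^ (n + 1)) ^ 2 * (e + 1) ^ 6 := by
      rw [← pow_mul, ← pow_add]; congr 1; ring
    rw [h1, h2]
    -- After division by `X ^ 2` only `d ^ 2 + 1 ≤ d ^ 4` is used: with `d ^ 4` in its place, `d ^ 4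
    -- + (d - 1) * (d ^ 4 + d ^ 5) = d ^ 6` holds exactly.
    set X := (e + 1) ^ (n + 1)
    calc _ = X ^ 2 * ((e + 1) ^ 4 + e * ((e + 1) ^ 2 + 1 + (e + 1) ^ 5)) := by ring
      _ ≤ X ^ 2 * (e + 1) ^ 6 := by
        refine Nat.mul_le_mul_left _ ?_
        have : (e + 1) ^ 2 + 1 ≤ (e + 1) ^ 4 := by 
          have h4 : 4 ≤ (e + 1) ^ 2 := (Nat.pow_le_pow_left hd 2)
          calc _ ≤ (e + 1) ^ 2 * 4 := by omega
            _ ≤ (e + 1) ^ 2 * (e + 1) ^ 2 := Nat.mul_le_mul_left _ h4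
            _ = _ := by ring
        calc _ ≤ (e + 1) ^ 4 + e * ((e + 1) ^ 4 + (e + 1) ^ 5) := by gcongr
          _ = (e + 1) ^ 6 := by ring

/-- Markov's inequality: keep only the terms with exactly `k` controls in the weight. -/
theorem countP_mul_pow_le_weight {d n : ℕ} (L : List (CtrlOp d n)) (k : ℕ) :
    L.countP (fun o => o.numControls = k) * d ^ k ≤ weight L := by
  induction L with
  | nil => simp
  | cons o L ih =>
    rw [← List.singleton_append, weight_append, List.singleton_append, List.countP_cons, add_mul]
    have h : weight [o] = d ^ o.numControls := by simp [weight, profile]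
    rw [add_comm, h]
    refine Nat.add_le_add ?_ ih
    by_cases ho : o.numControls = k <;> simp [ho]

theorem Oblivious.countP_eq {d n : ℕ} {P : Procedure d n} (hP : Oblivious P) (A B : OpN d n)
    (k : ℕ) : (P A).countP (fun o => o.numControls = k) =
      (P B).countP (fun o => o.numControls = k) := by
  have h : ∀ L : List (CtrlOp d n), L.countP (fun o => o.numControls = k) =
      (profile L).countP (fun j => j = k) := by
    intro L
    rw [profile, List.countP_map]
    rfl
  rw [h, h, hP A B]

theorem countP_triangle_le {d n : ℕ} [NeZero d] (hd : 2 ≤ d) (A : OpN d n) (k : ℕ) :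
    ((triangle n A).countP (fun o => o.numControls = k) : ℝ) ≤
      (d : ℝ) ^ (2 * (n : ℤ) - (k : ℤ) + 4) := by
  have h := (countP_mul_pow_le_weight (triangle n A) k).trans (weightLE_triangle hd n A)
  have hd0 : (0 : ℝ) < d := by positivity
  have h1 : (d : ℝ) ^ (2 * (n : ℤ) - (k : ℤ) + 4) = (d : ℝ) ^ (2 * n + 4) / (d : ℝ) ^ k := by
    rw [← zpow_natCast, ← zpow_natCast, ← zpow_sub₀ hd0.ne']
    congr 1
    push_cast
    ring
  rw [h1, le_div_iff₀ (by positivity)]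
  exact_mod_cast h

/-! ### Spectral decomposition of unitary matrices -/

theorem infinite_unit_sphere : (Metric.sphere (0 : ℂ) 1).Infinite := by
  have hne : ∀ n : ℕ, (1 : ℂ) - n * Complex.I ≠ 0 := by
    intro n h
    simpa using congrArg Complex.re h
  refine Set.infinite_of_injective_forall_mem
    (f := fun n : ℕ => ((1 : ℂ) + n * Complex.I) / (1 - n * Complex.I)) ?_ ?_
  · intro a b hab
    simp only at hab
    rw [div_eq_div_iff (hne a) (hne b)] at hab
    have : (2 * Complex.I) * (a : ℂ) = 2 * Complex.I * b := by linear_combination hab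
    exact_mod_cast mul_left_cancel₀ (by simp) this
  · intro n
    have h : (1 : ℂ) + n * Complex.I = star ((1 : ℂ) - n * Complex.I) := by
      simp
    rw [mem_sphere_zero_iff_norm, norm_div, h, norm_star, div_self (norm_ne_zero_iff.2 (hne n))]

/-- Every unitary matrix has a multiple by a phase that does not have the eigenvalue `1`. -/
theorem exists_phase_isUnit_one_sub {d : ℕ} (V : Op1 d) :
    ∃ c : ℂ, ‖c‖ = 1 ∧ IsUnit (1 - c • V) := by
  -- The unit circle is infinite and the spectrum finite, so some `z` on the circle is not an
  -- eigenvalue; `z⁻¹` is the phase.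
  have hfin : (spectrum ℂ V).Finite := Matrix.finite_spectrum V
  obtain ⟨z, hz, hzs⟩ := infinite_unit_sphere.exists_notMem_finset hfin.toFinset
  have hz1 : ‖z‖ = 1 := by simpa using hz
  have hz0 : z ≠ 0 := by
    rintro rfl
    simp at hz1
  refine ⟨z⁻¹, by simp [hz1], ?_⟩
  have h1 : IsUnit (algebraMap ℂ (Op1 d) z - V) := by
    simpa [spectrum.mem_iff] using hzs
  have h2 : (1 - z⁻¹ • V) = z⁻¹ • (algebraMap ℂ (Op1 d) z - V) := by
    rw [smul_sub, Algebra.algebraMap_eq_smul_one, smul_smul, inv_mul_cancel₀ hz0, one_smul]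
  rw [h2]
  have := h1.smul (Units.mk0 z⁻¹ (inv_ne_zero hz0))
  exact this

/-- Cayley transform: for a multiple `W = c • V` without eigenvalue `1`, the matrix `H = i(1 + W)(1
- W)⁻¹` is Hermitian. Its orthonormal eigenbasis diagonalizes `W = (H + i)⁻¹(H - i)`, hence `V`,
with eigenvalues of modulus `1`. -/
theorem exists_eigen {d : ℕ} {V : Op1 d} (hV : V ∈ Matrix.unitaryGroup (Fin d) ℂ) :
    ∃ p : Op1 d × (Fin d → ℝ), p.1 ∈ Matrix.unitaryGroup (Fin d) ℂ ∧
      V = p.1 * Matrix.diagonal (fun k => Complex.exp (Complex.I * p.2 k)) * p.1ᴴ := by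
  obtain ⟨c, hc, hu⟩ := exists_phase_isUnit_one_sub V
  have hc0 : c ≠ 0 := by
    rintro rfl
    simp at hc
  have hcc : star c * c = 1 := by
    rw [RCLike.star_def, Complex.conj_mul', hc]
    simp
  set W : Op1 d := c • V with hW
  have hWs : Wᴴ * W = 1 := by
    rw [hW, Matrix.conjTranspose_smul, smul_mul_smul_comm, hcc, one_smul]
    exact Matrix.mem_unitaryGroup_iff'.1 hV
  obtain ⟨N, hN1, hN2⟩ : ∃ N, (1 - W) * N = 1 ∧ N * (1 - W) = 1 :=
    ⟨↑hu.unit⁻¹, hu.mul_val_inv, hu.val_inv_mul⟩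
  set H : Op1 d := Complex.I • ((1 + W) * N) with hH
  have hHW : H * (1 - W) = Complex.I • (1 + W) := by
    rw [hH, smul_mul_assoc, mul_assoc, hN2, mul_one]
  have hherm : H.IsHermitian := by
    have h1 : Nᴴ * (1 - Wᴴ) = 1 := by
      have := congrArg Matrix.conjTranspose hN1
      simpa using this
    -- Both sides are `W - Wᴴ` because `Wᴴ * W = 1`; this relation gives the self-adjointness of
    -- `H`.
    have h2 : (1 - Wᴴ) * (1 + W) = -((1 + Wᴴ) * (1 - W)) := by
      simp only [sub_mul, mul_add, add_mul, mul_sub, one_mul, mul_one, hWs]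
      abel
    have h3 : Hᴴ = -Complex.I • (Nᴴ * (1 + Wᴴ)) := by
      rw [hH, Matrix.conjTranspose_smul, Matrix.conjTranspose_mul]
      simp
    rw [Matrix.IsHermitian, h3, hH]
    calc -Complex.I • (Nᴴ * (1 + Wᴴ))
        = -Complex.I • (Nᴴ * (1 + Wᴴ) * ((1 - W) * N)) := by rw [hN1, mul_one]
      _ = Complex.I • (Nᴴ * (-((1 + Wᴴ) * (1 - W))) * N) := by
        simp only [mul_neg, neg_mul, smul_neg, neg_smul, mul_assoc]
      _ = Complex.I • (Nᴴ * (1 - Wᴴ) * (1 + W) * N) := by rw [← h2]; simp only [mul_assoc]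
      _ = _ := by rw [h1, one_mul]
  set P : Op1 d := (hherm.eigenvectorUnitary : Op1 d) with hP
  set e : Fin d → ℂ := fun k => (hherm.eigenvalues k : ℂ) with he
  have hPm : P ∈ Matrix.unitaryGroup (Fin d) ℂ := hherm.eigenvectorUnitary.2
  have hP1 : P * Pᴴ = 1 := Matrix.mem_unitaryGroup_iff.1 hPm
  have hP2 : Pᴴ * P = 1 := Matrix.mem_unitaryGroup_iff'.1 hPm
  have hsp : H = P * Matrix.diagonal e * Pᴴ := by
    conv_lhs => rw [hherm.spectral_theorem]
    rw [Unitary.conjStarAlgAut_apply]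
    rfl
  have hne : ∀ k, e k + Complex.I ≠ 0 := by
    intro k h
    have := congrArg Complex.im h
    simp [he] at this
  have hEq : (H + Complex.I • 1) * W = H - Complex.I • 1 := by
    have h4 : H - H * W = Complex.I • 1 + Complex.I • W := by
      rw [← smul_add, ← hHW, mul_sub, mul_one]
    rw [add_mul, smul_one_mul]
    have h5 : H * W = H - (Complex.I • 1 + Complex.I • W) := by
      rw [← h4]; abel
    rw [h5]; abel
  have hdiag : ∀ z : ℂ, H + z • 1 = P * Matrix.diagonal (fun k => e k + z) * Pᴴ := by
    intro z
    have : (Matrix.diagonal fun k => e k + z) = Matrix.diagonal e + z • (1 : Op1 d) := by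
      rw [← Matrix.diagonal_one, ← Matrix.diagonal_smul, Matrix.diagonal_add]
      simp
    rw [this, mul_add, add_mul, ← hsp, mul_smul_comm, smul_mul_assoc, mul_one, hP1]
  have hWP : W = P * Matrix.diagonal (fun k => (e k - Complex.I) / (e k + Complex.I)) * Pᴴ := by
    set M := P * Matrix.diagonal (fun k => (e k + Complex.I)⁻¹) * Pᴴ with hM
    have h6 : M * (H + Complex.I • 1) = 1 := by
      rw [hdiag, hM]
      calc _ = P * (Matrix.diagonal (fun k => (e k + Complex.I)⁻¹) * (Pᴴ * P) *
            Matrix.diagonal (fun k => e k + Complex.I)) * Pᴴ := by simp only [mul_assoc]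
        _ = 1 := by
          rw [hP2, mul_one, Matrix.diagonal_mul_diagonal]
          simp only [inv_mul_cancel₀ (hne _), Matrix.diagonal_one, mul_one, hP1]
    calc W = M * ((H + Complex.I • 1) * W) := by rw [← mul_assoc, h6, one_mul]
      _ = M * (H + (-Complex.I) • 1) := by rw [hEq, neg_smul, sub_eq_add_neg]
      _ = P * (Matrix.diagonal (fun k => (e k + Complex.I)⁻¹) * (Pᴴ * P) *
            Matrix.diagonal (fun k => e k + -Complex.I)) * Pᴴ := by
          rw [hdiag, hM]; simp only [mul_assoc]
      _ = _ := by
          rw [hP2, mul_one, Matrix.diagonal_mul_diagonal]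
          congr 3
          ext k
          rw [div_eq_inv_mul, sub_eq_add_neg]
  have hnorm : ∀ k, ‖c⁻¹ * ((e k - Complex.I) / (e k + Complex.I))‖ = 1 := by
    intro k
    have h7 : e k - Complex.I = star (e k + Complex.I) := by
      simp [he, sub_eq_add_neg]
    rw [norm_mul, norm_inv, hc, norm_div, h7, norm_star, div_self (norm_ne_zero_iff.2 (hne k))]
    simp
  refine ⟨(P, fun k => Complex.arg (c⁻¹ * ((e k - Complex.I) / (e k + Complex.I)))), hPm, ?_⟩
  have h8 : V = c⁻¹ • W := by rw [hW, smul_smul, inv_mul_cancel₀ hc0, one_smul]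
  rw [h8, hWP, ← smul_mul_assoc, ← mul_smul_comm, ← Matrix.diagonal_smul]
  congr 3
  ext k
  have h9 := Complex.norm_mul_exp_arg_mul_I (c⁻¹ * ((e k - Complex.I) / (e k + Complex.I)))
  rw [hnorm, Complex.ofReal_one, one_mul, mul_comm] at h9
  exact h9.symm

section eigen

variable {d : ℕ} {V : Op1 d}

theorem eigen_fst_mem (hV : V ∈ Matrix.unitaryGroup (Fin d) ℂ) :
    (eigen V).1 ∈ Matrix.unitaryGroup (Fin d) ℂ :=
  (Classical.epsilon_spec (exists_eigen hV)).1

theorem eigen_eq (hV : V ∈ Matrix.unitaryGroup (Fin d) ℂ) :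
    V = (eigen V).1 * Matrix.diagonal (fun k => Complex.exp (Complex.I * (eigen V).2 k)) *
      (eigen V).1ᴴ :=
  (Classical.epsilon_spec (exists_eigen hV)).2

theorem eigenRoot_pow [NeZero d] (k : Fin d) :
    eigenRoot V k ^ d = Complex.exp (Complex.I * (eigen V).2 k) := by
  rw [eigenRoot, ← Complex.exp_nat_mul]
  congr 1
  have : (d : ℂ) ≠ 0 := Nat.cast_ne_zero.2 (NeZero.ne d)
  push_cast
  field_simp

theorem norm_eigenRoot (k : Fin d) : ‖eigenRoot V k‖ = 1 := by
  rw [eigenRoot, Complex.norm_exp]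
  simp

theorem diagonal_mem_unitary {ι : Type*} [Fintype ι] [DecidableEq ι] {w : ι → ℂ}
    (hw : ∀ k, ‖w k‖ = 1) : Matrix.diagonal w ∈ Matrix.unitaryGroup ι ℂ := by
  rw [Matrix.mem_unitaryGroup_iff, Matrix.star_eq_conjTranspose, Matrix.diagonal_conjTranspose,
    Matrix.diagonal_mul_diagonal, ← Matrix.diagonal_one]
  congr 1
  ext k
  rw [Pi.star_apply, RCLike.star_def, Complex.mul_conj', hw]
  simp

theorem conjTranspose_mem_unitary {ι : Type*} [Fintype ι] [DecidableEq ι] {M : Matrix ι ι ℂ}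
    (hM : M ∈ Matrix.unitaryGroup ι ℂ) : Mᴴ ∈ Matrix.unitaryGroup ι ℂ :=
  Unitary.star_mem hM

theorem root_mem_unitary (hV : V ∈ Matrix.unitaryGroup (Fin d) ℂ) :
    root V ∈ Matrix.unitaryGroup (Fin d) ℂ :=
  mul_mem (mul_mem (eigen_fst_mem hV) (diagonal_mem_unitary norm_eigenRoot))
    (conjTranspose_mem_unitary (eigen_fst_mem hV))

theorem root_pow [NeZero d] (hV : V ∈ Matrix.unitaryGroup (Fin d) ℂ) : root V ^ d = V := by
  have hP : (eigen V).1ᴴ * (eigen V).1 = 1 := Matrix.mem_unitaryGroup_iff'.1 (eigen_fst_mem hV)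
  have hP' : (eigen V).1 * (eigen V).1ᴴ = 1 := Matrix.mem_unitaryGroup_iff.1 (eigen_fst_mem hV)
  have h : ∀ k, root V ^ k =
      (eigen V).1 * Matrix.diagonal (fun j => eigenRoot V j ^ k) * (eigen V).1ᴴ := by
    intro k
    induction k with
    | zero => simp [hP']
    | succ k ih =>
      rw [pow_succ, ih, root]
      calc _ = (eigen V).1 * (Matrix.diagonal (fun j => eigenRoot V j ^ k) *
            ((eigen V).1ᴴ * (eigen V).1) * Matrix.diagonal (eigenRoot V)) * (eigen V).1ᴴ := by
            simp only [mul_assoc]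
        _ = _ := by
            rw [hP, mul_one, Matrix.diagonal_mul_diagonal]
            simp only [pow_succ]
  rw [h]
  conv_rhs => rw [eigen_eq hV]
  simp only [eigenRoot_pow]

theorem eigenFrame_eq [NeZero d] (k : Fin d) :
    eigenFrame V k = (eigen V).1.submatrix (Equiv.refl _) (Equiv.addRight k) := rfl

theorem eigenFrame_mem_unitary [NeZero d] (hV : V ∈ Matrix.unitaryGroup (Fin d) ℂ) (k : Fin d) :
    eigenFrame V k ∈ Matrix.unitaryGroup (Fin d) ℂ := by
  rw [Matrix.mem_unitaryGroup_iff, Matrix.star_eq_conjTranspose, eigenFrame_eq,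
    Matrix.conjTranspose_submatrix, Matrix.submatrix_mul_equiv]
  have := Matrix.mem_unitaryGroup_iff.1 (eigen_fst_mem hV)
  rw [Matrix.star_eq_conjTranspose] at this
  rw [this, Matrix.submatrix_one_equiv]

/-- Translating the columns puts the `k`-th eigenvector at position `0`, the level on which
`ctrlPhase` acts, without altering the conjugated operator. -/
theorem eigenFrame_conj [NeZero d] (k : Fin d) (z : ℂ) :
    eigenFrame V k * Matrix.diagonal (fun j => if j = 0 then z else 1) * (eigenFrame V k)ᴴ =
      (eigen V).1 * Matrix.diagonal (fun j => if j = k then z else 1) * (eigen V).1ᴴ := by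
  have h : Matrix.diagonal (fun j => if j = 0 then z else 1) =
      (Matrix.diagonal (fun j : Fin d => if j = k then z else 1)).submatrix
        (Equiv.addRight k) (Equiv.addRight k) := by
    rw [Matrix.submatrix_diagonal_equiv]
    congr 1
    ext j
    simp
  rw [h, eigenFrame_eq, Matrix.submatrix_mul_equiv, Matrix.conjTranspose_submatrix,
    Matrix.submatrix_mul_equiv]
  rfl

end eigen

/-! ### Two-qudit operators -/

/-- The two-qudit operator that applies `G j` to the second qudit if the first one is in the state
`|j⟩`, and then increases the first one by `k`. -/
def shiftMux {d : ℕ} [NeZero d] (k : Fin d) (G : Fin d → Op1 d) : Op2 d := fun x y =>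
  if x.1 = y.1 + k then G y.1 x.2 y.2 else 0

section shiftMux

variable {d : ℕ} [NeZero d]

theorem shiftMux_mul (k l : Fin d) (G H : Fin d → Op1 d) :
    shiftMux k G * shiftMux l H = shiftMux (k + l) fun j => G (j + l) * H j := by
  ext x y
  simp only [Matrix.mul_apply, shiftMux, Fintype.sum_prod_type]
  rw [Finset.sum_eq_single (y.1 + l)]
  · by_cases h : x.1 = y.1 + (k + l)
    · simp [h, add_comm k l, add_assoc]
    · have h' : ¬ x.1 = y.1 + l + k := by rwa [add_assoc, add_comm l k]
      simp [h, h']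
  · intro z _ hz
    simp [hz]
  · simp

theorem shiftMux_zero_one : shiftMux (0 : Fin d) (fun _ => 1) = 1 := by
  ext x y
  by_cases h : x.1 = y.1 <;> simp [shiftMux, Matrix.one_apply, Prod.ext_iff, h]

theorem wedge1_eq (V : Op1 d) : wedge1 V = shiftMux 0 fun j => if j = -1 then V else 1 := by
  ext x y
  simp only [wedge1, shiftMux, add_zero]
  split_ifs <;> rfl

theorem wedge1_mul (V W : Op1 d) : wedge1 V * wedge1 W = wedge1 (V * W) := by
  rw [wedge1_eq, wedge1_eq, wedge1_eq, shiftMux_mul, add_zero]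
  congr 1
  ext1 j
  by_cases h : j = -1 <;> simp [h]

theorem wedge1_one : wedge1 (1 : Op1 d) = 1 := by
  rw [wedge1_eq, ← shiftMux_zero_one]
  simp

theorem wedge1_pow (V : Op1 d) (k : ℕ) : wedge1 V ^ k = wedge1 (V ^ k) := by
  induction k with
  | zero => simp [wedge1_one]
  | succ k ih => rw [pow_succ, pow_succ, ih, wedge1_mul]

theorem val_nsmul_one (k : ℕ) : (k • (1 : Fin d)).val = k % d := by
  induction k with
  | zero => simp
  | succ k ih =>
    rw [succ_nsmul, Fin.val_add, ih, Fin.coe_ofNat_eq_mod, ← Nat.add_mod]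

theorem card_nsmul_one : d • (1 : Fin d) = 0 := by
  ext
  simp [val_nsmul_one]

theorem pred_nsmul_one : (d - 1) • (1 : Fin d) = -1 := by
  have hd : d - 1 + 1 = d := Nat.sub_add_cancel (Nat.one_le_iff_ne_zero.2 (NeZero.ne d))
  rw [eq_neg_iff_add_eq_zero, ← succ_nsmul, hd, card_nsmul_one]

theorem nsmul_one_inj {i k : ℕ} (hi : i < d) (hk : k < d) :
    i • (1 : Fin d) = k • 1 ↔ i = k := by
  rw [Fin.ext_iff, val_nsmul_one, val_nsmul_one, Nat.mod_eq_of_lt hi, Nat.mod_eq_of_lt hk]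

theorem exists_nsmul_one (a : Fin d) : ∃ i < d, i • (1 : Fin d) = a :=
  ⟨a.val, a.isLt, by ext; rw [val_nsmul_one, Nat.mod_eq_of_lt a.isLt]⟩

-- The first line visits `j, j + 1, …, j + k - 1`. For `k ≤ d` these values are distinct, so `V`
-- fires at most once.
open Classical in
theorem shiftMux_one_pow (a : Fin d) (V : Op1 d) {k : ℕ} (hk : k ≤ d) :
    shiftMux 1 (fun j => if j = a then V else 1) ^ k =
      shiftMux (k • 1) fun j => if ∃ i < k, j + i • 1 = a then V else 1 := by
  induction k with
  | zero => simp [shiftMux_zero_one]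
  | succ k ih =>
    rw [pow_succ', ih (by omega), shiftMux_mul, succ_nsmul, add_comm]
    congr 1
    ext1 j
    by_cases h : j + k • 1 = a
    · have h1 : ¬ ∃ i < k, j + i • (1 : Fin d) = a := by
        rintro ⟨i, hi, h'⟩
        have := (nsmul_one_inj (by omega) (by omega)).1 (add_left_cancel (h'.trans h.symm))
        omega
      have h2 : ∃ i < k + 1, j + i • (1 : Fin d) = a := ⟨k, by omega, h⟩
      rw [if_pos h, if_neg h1, if_pos h2, mul_one]
    · have h1 : (∃ i < k + 1, j + i • (1 : Fin d) = a) ↔ ∃ i < k, j + i • (1 : Fin d) = a := by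
        constructor
        · rintro ⟨i, hi, h'⟩
          rcases Nat.lt_succ_iff_lt_or_eq.1 hi with hi | rfl
          · exact ⟨i, hi, h'⟩
          · exact absurd h' h
        · rintro ⟨i, hi, h'⟩
          exact ⟨i, by omega, h'⟩
      rw [if_neg h, one_mul, if_congr h1 rfl rfl]

theorem shiftMux_one_one_pow : shiftMux (1 : Fin d) (fun _ => (1 : Op1 d)) ^ d = 1 := by
  have := shiftMux_one_pow (0 : Fin d) 1 le_rfl
  simpa only [ite_self, card_nsmul_one, shiftMux_zero_one] using this

/-- The two-qudit identity behind the construction of `∧ₖ(X ^ d)` from operations with fewer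
controls. -/
theorem peel_identity {X : Op1 d} (hX : X * Xᴴ = 1) :
    shiftMux 0 (fun _ => X) * ((shiftMux 1 (fun _ => 1) * wedge1 Xᴴ) ^ (d - 1) *
      (shiftMux 1 (fun _ => 1) * wedge1 (X ^ (d - 1)))) = wedge1 (X ^ d) := by
  have hd : d - 1 + 1 = d := Nat.sub_add_cancel (Nat.one_le_iff_ne_zero.2 (NeZero.ne d))
  simp only [wedge1_eq, shiftMux_mul, add_zero, one_mul]
  rw [shiftMux_one_pow _ _ (Nat.sub_le _ _), shiftMux_mul, shiftMux_mul, zero_add, ← succ_nsmul,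
    hd, card_nsmul_one]
  congr 1
  ext1 j
  -- The gates `X†` see the control values `j + 1, …, j + d - 1`, that is, all except `j`. For `j =
  -- -1` none fires and `X * X ^ (d - 1)` remains; otherwise exactly one fires and cancels `X`.
  by_cases hj : j = -1
  · have h : ¬ ∃ i < d - 1, j + 1 + i • (1 : Fin d) = -1 := by
      rintro ⟨i, hi, h⟩
      rw [hj, neg_add_cancel, zero_add, ← pred_nsmul_one, nsmul_one_inj] at h <;> omega
    rw [if_neg h, if_pos hj, if_pos hj, one_mul, ← pow_succ', hd]
  · have h : ∃ i < d - 1, j + 1 + i • (1 : Fin d) = -1 := by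
      obtain ⟨i, hi, h⟩ := exists_nsmul_one (-1 - (j + 1))
      refine ⟨i, ?_, by rw [h, add_sub_cancel]⟩
      have : i ≠ d - 1 := by
        rintro rfl
        rw [pred_nsmul_one] at h
        apply hj
        rw [eq_sub_iff_add_eq, add_eq_left] at h
        exact eq_neg_of_add_eq_zero_left h
      omega
    rw [if_pos h, if_neg hj, if_neg hj, mul_one, hX]

/-- The two-qudit identity behind the construction of `∧ₖ(INC)` with a borrowed line. -/
theorem borrow_identity (V : Op1 d) :
    (wedge1 V * shiftMux 1 fun _ => 1) ^ d = shiftMux 0 fun _ => V := by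
  have h : wedge1 V * shiftMux 1 (fun _ => 1) =
      shiftMux 1 fun j => if j = -1 - 1 then V else 1 := by
    rw [wedge1_eq, shiftMux_mul, zero_add]
    congr 1
    ext1 j
    rw [mul_one, if_congr (eq_sub_iff_add_eq).symm rfl rfl]
  rw [h, shiftMux_one_pow _ _ le_rfl, card_nsmul_one]
  congr 1
  ext1 j
  -- In `d` rounds the borrowed line takes every value, so the condition holds for each initial `j`.
  rw [if_pos]
  obtain ⟨i, hi, h⟩ := exists_nsmul_one (-1 - 1 - j)
  exact ⟨i, hi, by rw [h, add_sub_cancel]⟩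

end shiftMux

theorem inc_eq_submatrix (d : ℕ) [NeZero d] (k : ℕ) (a b : Fin d) :
    (inc d ^ k) a b = if a = b + k • 1 then 1 else 0 := by
  induction k generalizing a b with
  | zero => simp [Matrix.one_apply]
  | succ k ih =>
    rw [pow_succ, Matrix.mul_apply, Finset.sum_eq_single (b + 1)]
    · simp [ih, inc, succ_nsmul, add_assoc, add_comm (1 : Fin d)]
    · intro c _ hc
      simp [inc, hc]
    · simp

theorem inc_pow_card (d : ℕ) [NeZero d] : inc d ^ d = 1 := by
  ext a b
  rw [inc_eq_submatrix, card_nsmul_one, Matrix.one_apply, add_zero]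

theorem inc_mul_conjTranspose (d : ℕ) [NeZero d] : inc d * (inc d)ᴴ = 1 := by
  ext a b
  rw [Matrix.mul_apply, Finset.sum_eq_single (a - 1)]
  · simp [inc, Matrix.one_apply, eq_comm]
  · intro c _ hc
    have : ¬ a = c + 1 := by
      rintro rfl
      simp at hc
    simp [inc, this]
  · simp

theorem inc_mem_unitary (d : ℕ) [NeZero d] : inc d ∈ Matrix.unitaryGroup (Fin d) ℂ :=
  Matrix.mem_unitaryGroup_iff.2 (inc_mul_conjTranspose d)

/-! ### Operators on two of the lines -/

/-- The splitting of the dit strings into the letters at the positions `q, t` and the others. -/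
def splitTwo {d n : ℕ} {q t : Fin n} (h : q ≠ t) :
    (Fin n → Fin d) ≃ (Fin d × Fin d) × ({k // k ≠ q ∧ k ≠ t} → Fin d) where
  toFun x := ((x q, x t), fun k => x k)
  invFun p k := if hq : k = q then p.1.1 else if ht : k = t then p.1.2 else p.2 ⟨k, hq, ht⟩
  left_inv x := by
    ext k
    by_cases hq : k = q
    · simp [hq]
    · by_cases ht : k = t
      · simp [ht, h.symm]
      · simp [hq, ht]
  right_inv p := by
    refine Prod.ext (Prod.ext ?_ ?_) ?_
    · simp
    · simp [h.symm]
    · ext k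
      simp [k.2.1, k.2.2]

/-- The dit strings agree at the positions other than `q, t`. -/
def AgreeOff {d n : ℕ} (q t : Fin n) (x y : Fin n → Fin d) : Prop :=
  ∀ k, k ≠ q → k ≠ t → x k = y k

theorem eq_iff_of_pair {d n : ℕ} {q t : Fin n} {x y : Fin n → Fin d} :
    x = y ↔ AgreeOff q t x y ∧ x q = y q ∧ x t = y t := by
  constructor
  · rintro rfl
    simp [AgreeOff]
  · rintro ⟨h1, h2, h3⟩
    ext k
    by_cases hq : k = q
    · subst hq; rw [h2]
    · by_cases ht : k = t
      · subst ht; rw [h3]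
      · rw [h1 k hq ht]

theorem agree_off_iff {d n : ℕ} {q t : Fin n} (h : q ≠ t) {x y : Fin n → Fin d} :
    (∀ k, k ≠ t → x k = y k) ↔ AgreeOff q t x y ∧ x q = y q := by
  constructor
  · exact fun h' => ⟨fun k _ hk => h' k hk, h' q h⟩
  · rintro ⟨h1, h2⟩ k hk
    by_cases hq : k = q
    · subst hq; exact h2
    · exact h1 k hq hk

section splitTwo

variable {d n : ℕ} {q t : Fin n} (h : q ≠ t)

open Classical in
theorem mux_splitTwo_apply (G : ({k // k ≠ q ∧ k ≠ t} → Fin d) → Op2 d) (x y : Fin n → Fin d) :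
    mux (splitTwo h) G x y = if AgreeOff q t x y then
      G (splitTwo h y).2 (x q, x t) (y q, y t) else 0 := by
  have h1 : (splitTwo h x).2 = (splitTwo h y).2 ↔ AgreeOff q t x y := by
    simp [splitTwo, funext_iff, AgreeOff]
  rw [mux_apply]
  by_cases h2 : (splitTwo h x).2 = (splitTwo h y).2
  · rw [if_pos h2, if_pos (h1.1 h2), h2]
    rfl
  · rw [if_neg h2, if_neg (fun h3 => h2 (h1.2 h3))]

variable [NeZero d]

/-- The condition `S` in terms of the lines other than `q, t`. -/
def offPair (S : (Fin n → Fin d) → Prop) (r : {k // k ≠ q ∧ k ≠ t} → Fin d) : Prop :=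
  S ((splitTwo h).symm (0, r))

theorem offPair_iff {S : (Fin n → Fin d) → Prop} (hq : IndepOf S q) (ht : IndepOf S t)
    (x : Fin n → Fin d) : offPair h S (splitTwo h x).2 ↔ S x := by
  have : (splitTwo h).symm (0, (splitTwo h x).2) =
      Function.update (Function.update x q 0) t 0 := by
    ext k
    by_cases hkq : k = q
    · subst hkq; simp [splitTwo, h]
    · by_cases hkt : k = t
      · subst hkt; simp [splitTwo, hkq]
      · simp [splitTwo, hkq, hkt]
  rw [offPair, this, ht, hq]

-- This and the next two lemmas translate the possible roles of the lines `q, t` under an outer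
-- condition `S`. With all factors in the same block form, circuit identities can be checked block
-- by block.
open Classical in
theorem ctl_second_eq_mux {S : (Fin n → Fin d) → Prop} (hq : IndepOf S q) (ht : IndepOf S t)
    (V : Op1 d) : ctl S t V =
      mux (splitTwo h) fun r => if offPair h S r then shiftMux 0 (fun _ => V) else 1 := by
  ext x y
  rw [mux_splitTwo_apply, ctl]
  simp only [offPair_iff h hq ht, agree_off_iff h, eq_iff_of_pair (q := q) (t := t)]
  by_cases h1 : AgreeOff q t x y <;> by_cases h2 : x q = y q <;>
    by_cases h3 : S y <;> simp [h1, h2, h3, shiftMux, Matrix.one_apply]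

open Classical in
theorem ctl_second_and_eq_mux {S : (Fin n → Fin d) → Prop} (hq : IndepOf S q)
    (ht : IndepOf S t) (V : Op1 d) : ctl (fun x => S x ∧ x q = -1) t V =
      mux (splitTwo h) fun r => if offPair h S r then wedge1 V else 1 := by
  ext x y
  rw [mux_splitTwo_apply, ctl]
  simp only [offPair_iff h hq ht, agree_off_iff h, eq_iff_of_pair (q := q) (t := t)]
  by_cases h1 : AgreeOff q t x y <;> by_cases h2 : x q = y q <;>
    by_cases h3 : S y <;> by_cases h4 : y q = -1 <;>
    simp [h1, h2, h3, h4, wedge1, Matrix.one_apply]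

open Classical in
theorem ctl_first_inc_eq_mux {S : (Fin n → Fin d) → Prop} (hq : IndepOf S q)
    (ht : IndepOf S t) : ctl S q (inc d) =
      mux (splitTwo h) fun r => if offPair h S r then shiftMux 1 (fun _ => 1) else 1 := by
  ext x y
  rw [mux_splitTwo_apply, ctl]
  have h0 : (∀ k, k ≠ q → x k = y k) ↔ AgreeOff q t x y ∧ x t = y t := by
    rw [agree_off_iff h.symm]
    exact and_congr_left' ⟨fun h k h1 h2 => h k h2 h1, fun h k h1 h2 => h k h2 h1⟩
  simp only [h0, offPair_iff h hq ht, eq_iff_of_pair (q := q) (t := t)]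
  by_cases h1 : AgreeOff q t x y <;> by_cases h2 : x t = y t <;>
    by_cases h3 : S y <;> by_cases h4 : x q = y q + 1 <;>
    simp [h1, h2, h3, h4, inc, shiftMux, Matrix.one_apply]

end splitTwo

/-! ### Circuits -/

theorem Gate.toMatrix_one {d n : ℕ} (i : Fin n) (V : Op1 d) :
    (Gate.one i V).toMatrix = ctl (fun _ => True) i V := by
  ext x y
  simp [Gate.toMatrix, ctl]

theorem indepOf_true {d n : ℕ} (t : Fin n) : IndepOf (fun _ : Fin n → Fin d => True) t :=
  fun _ _ => Iff.rfl

theorem Gate.toMatrix_two_wedge1 {d n : ℕ} [NeZero d] {q t : Fin n} (h : q ≠ t) (V : Op1 d) :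
    (Gate.two q t (wedge1 V)).toMatrix = ctl (fun x => x q = -1) t V := by
  have h1 : (fun x : Fin n → Fin d => x q = -1) = fun x => True ∧ x q = -1 := by simp
  rw [h1, ctl_second_and_eq_mux h (indepOf_true q) (indepOf_true t)]
  ext x y
  rw [mux_splitTwo_apply]
  simp [Gate.toMatrix, offPair, AgreeOff]

/-- The circuit consists of gates of the library and has the operator `M`. -/
structure Circuit.Realizes {d n : ℕ} [NeZero d] (C : Circuit d n) (M : OpN d n) : Prop where
  lib : ∀ g ∈ C, g.InLibrary
  eval : Circuit.eval C = M

namespace Circuit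

variable {d n : ℕ} [NeZero d] {C D : Circuit d n} {M N : OpN d n}

theorem Realizes.of_eq (hC : Realizes C M) (h : N = M) : Realizes C N := h ▸ hC

theorem Realizes.nil : Realizes ([] : Circuit d n) 1 := ⟨by simp, rfl⟩

theorem Realizes.append (hC : Realizes C M) (hD : Realizes D N) : Realizes (C ++ D) (N * M) := by
  refine ⟨List.forall_mem_append.2 ⟨hC.lib, hD.lib⟩, ?_⟩
  rw [← hC.eval, ← hD.eval]
  clear hC hD
  induction C with
  | nil => simp [Circuit.eval]
  | cons g C ih => rw [List.cons_append, Circuit.eval, ih, Circuit.eval, mul_assoc]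

theorem Realizes.replicate (hC : Realizes C M) (k : ℕ) :
    Realizes (List.replicate k C).flatten (M ^ k) := by
  induction k with
  | zero => exact Realizes.nil
  | succ k ih =>
    rw [List.replicate_succ, List.flatten_cons, pow_succ]
    exact hC.append ih

theorem Realizes.one {i : Fin n} {V : Op1 d} (hV : V ∈ Matrix.unitaryGroup (Fin d) ℂ) :
    Realizes [Gate.one i V] (ctl (fun _ => True) i V) :=
  ⟨by simpa [Gate.InLibrary] using hV, by rw [← Gate.toMatrix_one]; exact one_mul _⟩

theorem Realizes.cinc {q t : Fin n} (h : q ≠ t) :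
    Realizes [Gate.two q t (cinc d)] (ctl (fun x => x q = -1) t (inc d)) :=
  ⟨by simpa [Gate.InLibrary] using h, by
    rw [← Gate.toMatrix_two_wedge1 h]; exact one_mul _⟩

theorem Realizes.cincInv {q t : Fin n} (h : q ≠ t) :
    Realizes [Gate.two q t (cincInv d)] (ctl (fun x => x q = -1) t (inc d)ᴴ) :=
  ⟨by simpa [Gate.InLibrary] using h, by
    rw [← Gate.toMatrix_two_wedge1 h]; exact one_mul _⟩

end Circuit

theorem indepOf_eq {d n : ℕ} {q t : Fin n} (h : q ≠ t) (a : Fin d) :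
    IndepOf (fun x : Fin n → Fin d => x q = a) t := by
  intro x b
  simp [h]

/-! ### Correctness of the circuits for controlled operations -/

section controlled

variable {d n : ℕ} [NeZero d]

theorem ctl_second_const {q t : Fin n} (h : q ≠ t) (V : Op1 d) :
    ctl (fun _ => True) t V = mux (splitTwo h) fun _ => shiftMux 0 fun _ => V := by
  rw [ctl_second_eq_mux h (indepOf_true q) (indepOf_true t)]
  simp [offPair]

theorem ctl_wedge1_const {q t : Fin n} (h : q ≠ t) (V : Op1 d) :
    ctl (fun x => x q = -1) t V = mux (splitTwo h) fun _ => wedge1 V := by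
  have h1 : (fun x : Fin n → Fin d => x q = -1) = fun x => True ∧ x q = -1 := by simp
  rw [h1, ctl_second_and_eq_mux h (indepOf_true q) (indepOf_true t)]
  simp [offPair]

open Classical in
theorem ctl_first_diagonal {q t : Fin n} (h : q ≠ t) (φ : Fin d → ℂ) :
    ctl (fun _ => True) q (Matrix.diagonal φ) =
      mux (splitTwo h) fun _ => shiftMux 0 fun j => φ j • 1 := by
  ext x y
  have h0 : (∀ k, k ≠ q → x k = y k) ↔ AgreeOff q t x y ∧ x t = y t := by
    rw [agree_off_iff h.symm]
    exact and_congr_left' ⟨fun h k h1 h2 => h k h2 h1, fun h k h1 h2 => h k h2 h1⟩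
  rw [mux_splitTwo_apply, ctl, if_pos trivial]
  simp only [h0]
  by_cases h1 : AgreeOff q t x y <;> by_cases h2 : x t = y t <;> by_cases h4 : x q = y q <;>
    simp [h1, h2, h4, shiftMux]

theorem ctl_conj {S : (Fin n → Fin d) → Prop} {t : Fin n} (hS : IndepOf S t) {W : Op1 d}
    (hW : W * Wᴴ = 1) (E : Op1 d) :
    ctl (fun _ => True) t W * (ctl S t E * ctl (fun _ => True) t Wᴴ) = ctl S t (W * E * Wᴴ) := by
  rw [ctl_eq_mux hS, ctl_eq_mux hS, ctl_eq_mux (indepOf_true t), ctl_eq_mux (indepOf_true t),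
    mux_mul, mux_mul]
  congr 1
  ext1 r
  by_cases h : S ((splitOne t).symm (0, r)) <;> simp [h, hW, mul_assoc]

theorem inc_conj_diagonal (f : Fin d → ℂ) :
    inc d * Matrix.diagonal f * (inc d)ᴴ = Matrix.diagonal fun j => f (j - 1) := by
  ext a b
  rw [Matrix.mul_apply, Finset.sum_eq_single (b - 1)]
  · rw [Matrix.mul_diagonal]
    by_cases h : a = b <;> simp [inc, h]
  · intro c _ hc
    have : ¬ b = c + 1 := by
      rintro rfl
      simp at hc
    simp [inc, this]
  · simp

theorem val_neg_one : (-1 : Fin d).val = d - 1 := by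
  rw [← pred_nsmul_one, val_nsmul_one,
    Nat.mod_eq_of_lt (Nat.sub_lt (Nat.pos_of_ne_zero (NeZero.ne d)) one_pos)]

namespace Circuit

/-- If the control is on, the target undergoes `ξ · INC · D · INC⁻¹ · D⁻¹`. The shift turns `ξ ^ j`
into `ξ ^ (j - 1)`, except at level `0`, where it wraps around to `ξ ^ (d - 1)`. The result is `1`
off level `0` and `ξ ^ d` on it. If the control is off, `D` and `D⁻¹` cancel. -/
theorem realizes_ctrlPhase {c t : Fin n} (h : c ≠ t) {ξ : ℂ} (hξ : ‖ξ‖ = 1) :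
    Realizes (ctrlPhase c t ξ : Circuit d n)
      (ctl (fun x => x c = -1) t (Matrix.diagonal fun j => if j = 0 then ξ ^ d else 1)) := by
  set D : Op1 d := Matrix.diagonal fun j => ξ ^ j.val with hD
  have hDm : D ∈ Matrix.unitaryGroup (Fin d) ℂ := diagonal_mem_unitary fun j => by simp [hξ]
  have hE : Matrix.diagonal (fun j : Fin d => if j = -1 then ξ else 1) ∈
      Matrix.unitaryGroup (Fin d) ℂ := diagonal_mem_unitary fun j => by split_ifs <;> simp [hξ]
  have key := (Realizes.one (i := t) (conjTranspose_mem_unitary hDm)).append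
    ((Realizes.cincInv h).append ((Realizes.one (i := t) hDm).append
      ((Realizes.cinc h).append (Realizes.one (i := c) hE))))
  have hξ' : star ξ * ξ = 1 := by
    rw [RCLike.star_def, Complex.conj_mul', hξ]
    simp
  have hd : d - 1 + 1 = d := Nat.sub_add_cancel (Nat.one_le_iff_ne_zero.2 (NeZero.ne d))
  refine Realizes.of_eq key ?_
  rw [ctl_wedge1_const h, ctl_wedge1_const h, ctl_wedge1_const h, ctl_second_const h,
    ctl_second_const h, ctl_first_diagonal h, mux_mul, mux_mul, mux_mul, mux_mul]
  congr 1
  ext1 r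
  simp only [wedge1_eq, shiftMux_mul, add_zero]
  congr 1
  ext1 j
  by_cases hj : j = -1
  · simp only [if_pos hj]
    rw [smul_mul_assoc, smul_mul_assoc, smul_mul_assoc, smul_mul_assoc, one_mul, inc_conj_diagonal, hD,
      Matrix.diagonal_conjTranspose, Matrix.diagonal_mul_diagonal, ← Matrix.diagonal_smul]
    congr 1
    ext a
    simp only [Pi.smul_apply, Pi.star_apply, smul_eq_mul]
    by_cases ha : a = 0
    · rw [if_pos ha, ha, zero_sub, val_neg_one]
      simp only [Fin.val_zero, pow_zero, star_one, mul_one]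
      rw [← pow_succ', hd]
    · rw [if_neg ha, Fin.val_sub_one_of_ne_zero ha, star_pow]
      have ha' : a.val ≠ 0 := by
        intro h0
        exact ha (Fin.ext (by simpa using h0))
      obtain ⟨e, he⟩ := Nat.exists_eq_succ_of_ne_zero ha'
      rw [he, Nat.succ_eq_add_one, Nat.add_sub_cancel, ← mul_assoc, ← pow_succ', ← mul_pow,
        mul_comm ξ, hξ', one_pow]
  · simp only [if_neg hj, one_smul, one_mul, mul_one]
    exact (Matrix.mem_unitaryGroup_iff.1 hDm).symm

theorem realizes_ctrlOne {c t : Fin n} (h : c ≠ t) {V : Op1 d}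
    (hV : V ∈ Matrix.unitaryGroup (Fin d) ℂ) :
    Realizes (ctrlOne c t V : Circuit d n) (ctl (fun x => x c = -1) t V) := by
  have hS := indepOf_eq h (-1 : Fin d)
  have hP1 : (eigen V).1 * (eigen V).1ᴴ = 1 := Matrix.mem_unitaryGroup_iff.1 (eigen_fst_mem hV)
  have hP2 : (eigen V).1ᴴ * (eigen V).1 = 1 := Matrix.mem_unitaryGroup_iff'.1 (eigen_fst_mem hV)
  -- The partial products correct the eigenvalues in `L` only; duplicates would correct an
  -- eigenvalue twice.
  have key : ∀ L : List (Fin d), L.Nodup →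
      Realizes (L.flatMap fun k => [.one t (eigenFrame V k)ᴴ] ++ ctrlPhase c t (eigenRoot V k) ++
        [.one t (eigenFrame V k)] : Circuit d n)
      (ctl (fun x => x c = -1) t ((eigen V).1 *
        Matrix.diagonal (fun j => if j ∈ L then eigenRoot V j ^ d else 1) * (eigen V).1ᴴ)) := by
    intro L
    induction L with
    | nil =>
      intro _
      simpa [hP1, ctl_one] using Realizes.nil
    | cons k L ih =>
      intro hL
      rw [List.nodup_cons] at hL
      have hF := eigenFrame_mem_unitary hV k
      have hk := ((Realizes.one (i := t) (conjTranspose_mem_unitary hF)).append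
        (realizes_ctrlPhase (d := d) h (norm_eigenRoot (V := V) k))).append
          (Realizes.one (i := t) hF)
      rw [ctl_conj hS (Matrix.mem_unitaryGroup_iff.1 hF), eigenFrame_conj] at hk
      rw [List.flatMap_cons]
      convert hk.append (ih hL.2) using 1
      rw [ctl_mul hS]
      congr 1
      calc _ = (eigen V).1 * (Matrix.diagonal (fun j => if j ∈ L then eigenRoot V j ^ d else 1) *
            Matrix.diagonal (fun j => if j = k then eigenRoot V k ^ d else 1)) *
              (eigen V).1ᴴ := by
            rw [Matrix.diagonal_mul_diagonal]
            congr 3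
            ext j
            by_cases hjk : j = k
            · subst hjk; simp [hL.1]
            · simp [hjk]
        _ = (eigen V).1 * (Matrix.diagonal (fun j => if j ∈ L then eigenRoot V j ^ d else 1) *
              ((eigen V).1ᴴ * (eigen V).1) *
            Matrix.diagonal (fun j => if j = k then eigenRoot V k ^ d else 1)) *
              (eigen V).1ᴴ := by rw [hP2, mul_one]
        _ = _ := by simp only [mul_assoc]
  have := key (List.finRange d) (List.nodup_finRange d)
  simp only [List.mem_finRange, if_true, eigenRoot_pow] at this
  rw [← eigen_eq hV] at this
  exact this

/-- Where `S` holds this is `peel_identity`. Where it fails, the line `q` stands still and the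
powers of `X` and `X†` must cancel by themselves. -/
theorem Realizes.peel {q t : Fin n} (h : q ≠ t) {S : (Fin n → Fin d) → Prop} (hq : IndepOf S q)
    (ht : IndepOf S t) {X : Op1 d} (hX : X ∈ Matrix.unitaryGroup (Fin d) ℂ) {A B : Circuit d n}
    (hA : Realizes A (ctl S q (inc d))) (hB : Realizes B (ctl S t X)) :
    Realizes (peel q t X A B) (ctl (fun x => S x ∧ x q = -1) t (X ^ d)) := by
  have hX1 : X * Xᴴ = 1 := Matrix.mem_unitaryGroup_iff.1 hX
  have hX2 : Xᴴ * X = 1 := Matrix.mem_unitaryGroup_iff'.1 hX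
  have key := (((realizes_ctrlOne h (pow_mem hX (d - 1))).append hA).append
    (((realizes_ctrlOne h (conjTranspose_mem_unitary hX)).append hA).replicate (d - 1))).append hB
  refine Realizes.of_eq key ?_
  rw [ctl_second_and_eq_mux h hq ht, ctl_second_eq_mux h hq ht, ctl_first_inc_eq_mux h hq ht,
    ctl_wedge1_const h, ctl_wedge1_const h, mux_mul, mux_mul, mux_pow, mux_mul, mux_mul]
  congr 1
  ext1 r
  by_cases hr : offPair h S r
  · simp only [if_pos hr]
    exact (peel_identity hX1).symm
  · simp only [if_neg hr, one_mul, wedge1_pow, wedge1_mul]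
    have hc : Commute Xᴴ X := by rw [Commute, SemiconjBy, hX1, hX2]
    rw [← hc.mul_pow, hX2, one_pow, wedge1_one]

-- If both conditions hold, `borrow_identity` applies. If only `S₁` holds, the borrowed line makes a
-- full cycle. If only `S₂` holds, the target receives `INC ^ d = 1` or nothing. In all cases `s`
-- returns to its initial state.
open Classical in
theorem Realizes.borrow {s t : Fin n} (h : s ≠ t) {S₁ S₂ : (Fin n → Fin d) → Prop}
    (h1s : IndepOf S₁ s) (h1t : IndepOf S₁ t) (h2s : IndepOf S₂ s) (h2t : IndepOf S₂ t)
    {A B : Circuit d n} (hA : Realizes A (ctl S₁ s (inc d)))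
    (hB : Realizes B (ctl (fun x => S₂ x ∧ x s = -1) t (inc d))) :
    Realizes (List.replicate d (A ++ B)).flatten (ctl (fun x => S₁ x ∧ S₂ x) t (inc d)) := by
  refine Realizes.of_eq ((hA.append hB).replicate d) ?_
  have hs : IndepOf (fun x => S₁ x ∧ S₂ x) s := fun x a => and_congr (h1s x a) (h2s x a)
  have ht : IndepOf (fun x => S₁ x ∧ S₂ x) t := fun x a => and_congr (h1t x a) (h2t x a)
  rw [ctl_second_eq_mux h hs ht, ctl_first_inc_eq_mux h h1s h1t, ctl_second_and_eq_mux h h2s h2t,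
    mux_mul, mux_pow]
  congr 1
  ext1 r
  have hr : offPair h (fun x => S₁ x ∧ S₂ x) r ↔ offPair h S₁ r ∧ offPair h S₂ r := Iff.rfl
  simp only [hr]
  by_cases hr1 : offPair h S₁ r <;> by_cases hr2 : offPair h S₂ r <;>
    simp [hr1, hr2, borrow_identity, shiftMux_one_one_pow, wedge1_pow, inc_pow_card, wedge1_one]

end Circuit

/-- All controls of a list are in the state `|d - 1⟩`. -/
def AllOn (L : List (Fin n)) (x : Fin n → Fin d) : Prop := ∀ c ∈ L, x c = -1

theorem indepOf_allOn {L : List (Fin n)} {t : Fin n} (h : t ∉ L) :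
    IndepOf (AllOn L : (Fin n → Fin d) → Prop) t := by
  intro x a
  refine forall₂_congr fun c hc => ?_
  have : c ≠ t := by
    rintro rfl
    exact h hc
  simp [this]

theorem allOn_cons (c : Fin n) (L : List (Fin n)) :
    (AllOn (c :: L) : (Fin n → Fin d) → Prop) = fun x => AllOn L x ∧ x c = -1 := by
  ext x
  simp [AllOn, and_comm]

theorem allOn_append (L M : List (Fin n)) :
    (AllOn (L ++ M) : (Fin n → Fin d) → Prop) = fun x => AllOn L x ∧ AllOn M x := by
  ext x
  simp only [AllOn, List.forall_mem_append]

theorem allOn_nil : (AllOn [] : (Fin n → Fin d) → Prop) = fun _ => True := by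
  ext x
  simp [AllOn]

theorem allOn_singleton (c : Fin n) :
    (AllOn [c] : (Fin n → Fin d) → Prop) = fun x => x c = -1 := by
  ext x
  simp [AllOn]

open Circuit

/-- In the recursive calls the roles rotate: the factor with target `s` may borrow `t`, and the
factor with target `t` may borrow `c`, which belongs to the controls of the other factor. Hence one
spare line suffices at all depths. -/
theorem realizes_ctrlInc : ∀ (L : List (Fin n)) (t s : Fin n), L.Nodup → t ∉ L → s ∉ L → s ≠ t →
    Realizes (ctrlInc L t s : Circuit d n) (ctl (AllOn L) t (inc d))
  | [], t, s, _, _, _, _ => by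
    rw [ctrlInc, allOn_nil]
    exact Realizes.one (inc_mem_unitary d)
  | [c], t, s, _, ht, _, _ => by
    rw [ctrlInc, allOn_singleton]
    exact Realizes.cinc (by simpa [eq_comm] using ht)
  | [c, q], t, s, hL, ht, _, _ => by
    have hcq : c ≠ q := by simpa using hL
    have hct : c ≠ t := by rintro rfl; simp at ht
    have hqt : q ≠ t := by rintro rfl; simp at ht
    have hr := root_mem_unitary (inc_mem_unitary d)
    have key := Realizes.peel hqt (indepOf_eq hcq (-1)) (indepOf_eq hct (-1)) hr
      (Realizes.cinc hcq) (realizes_ctrlOne hct hr)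
    rw [root_pow (inc_mem_unitary d)] at key
    rw [ctrlInc]
    convert key using 2
    ext x
    simp [AllOn]
  | c :: c' :: c'' :: cs, t, s, hL, ht, hs, hst => by
    rw [ctrlInc]
    set L := c :: c' :: c'' :: cs with hLdef
    set k := (cs.length + 5) / 2 with hk
    have happ : L.take k ++ L.drop k = L := List.take_append_drop k L
    have hct : c ≠ t := by rintro rfl; simp [hLdef] at ht
    have hc_drop : c ∉ L.drop k := by
      intro hc
      have h1 : c ∈ L.take k := by
        obtain ⟨j, hj⟩ : ∃ j, k = j + 1 := ⟨k - 1, by omega⟩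
        rw [hj, hLdef, List.take_succ_cons]
        exact List.mem_cons_self
      rw [← happ, List.nodup_append] at hL
      exact hL.2.2 c h1 c hc rfl
    have hsc : s ≠ c := by rintro rfl; simp [hLdef] at hs
    have ht1 : t ∉ L.take k := fun h => ht (List.mem_of_mem_take h)
    have ht2 : t ∉ L.drop k := fun h => ht (List.mem_of_mem_drop h)
    have hs1 : s ∉ L.take k := fun h => hs (List.mem_of_mem_take h)
    have hs2 : s ∉ L.drop k := fun h => hs (List.mem_of_mem_drop h)
    have hA := realizes_ctrlInc (L.take k) s t (hL.sublist (List.take_sublist k L)) hs1 ht1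
      hst.symm
    have hB := realizes_ctrlInc (s :: L.drop k) t c
      (List.nodup_cons.2 ⟨hs2, hL.sublist (List.drop_sublist k L)⟩)
      (by simp [hst.symm, ht2]) (by simp [hsc.symm, hc_drop]) hct
    rw [allOn_cons] at hB
    have key := Realizes.borrow hst (indepOf_allOn hs1) (indepOf_allOn ht1) (indepOf_allOn hs2)
      (indepOf_allOn ht2) hA hB
    rw [← allOn_append, happ] at key
    exact key
  termination_by L => L.length
  decreasing_by
    all_goals simp
    all_goals omega

/-- While the control `q` is incremented, the target `t` is idle and serves as the borrowed line. -/
theorem realizes_ctrlMany : ∀ (L : List (Fin n)) (t : Fin n) (V : Op1 d), L.Nodup → t ∉ L →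
    V ∈ Matrix.unitaryGroup (Fin d) ℂ → Realizes (ctrlMany L t V) (ctl (AllOn L) t V)
  | [], t, V, _, _, hV => by
    rw [ctrlMany, allOn_nil]
    exact Realizes.one hV
  | [c], t, V, _, ht, hV => by
    rw [ctrlMany, allOn_singleton]
    exact realizes_ctrlOne (by simpa [eq_comm] using ht) hV
  | q :: c :: cs, t, V, hL, ht, hV => by
    rw [List.nodup_cons] at hL
    rw [List.mem_cons, not_or] at ht
    have hr := root_mem_unitary hV
    rw [ctrlMany, allOn_cons]
    have key := Realizes.peel (Ne.symm ht.1) (indepOf_allOn hL.1) (indepOf_allOn ht.2) hr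
      (realizes_ctrlInc (c :: cs) q t hL.2 hL.1 ht.2 ht.1)
      (realizes_ctrlMany (c :: cs) t (root V) hL.2 ht.2 hr)
    rwa [root_pow hV] at key

end controlled

/-! ### Translations of the dit strings -/

/-- The operator `|x⟩ ↦ |x + m⟩`. -/
def translation {d n : ℕ} [NeZero d] (m : Fin n → Fin d) : OpN d n := fun x y =>
  if x = y + m then 1 else 0

section translation

variable {d n : ℕ} [NeZero d]

theorem translation_zero : translation (0 : Fin n → Fin d) = 1 := by
  ext x y
  simp [translation, Matrix.one_apply]

theorem mul_translation_apply (M : OpN d n) (m x y : Fin n → Fin d) :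
    (M * translation m) x y = M x (y + m) := by
  rw [Matrix.mul_apply, Finset.sum_eq_single (y + m)]
  · simp [translation]
  · intro z _ hz
    simp [translation, hz]
  · simp

theorem translation_mul_apply (M : OpN d n) (m x y : Fin n → Fin d) :
    (translation m * M) x y = M (x - m) y := by
  rw [Matrix.mul_apply, Finset.sum_eq_single (x - m)]
  · simp [translation]
  · intro z _ hz
    have : x ≠ z + m := by
      rintro rfl
      simp at hz
    simp [translation, this]
  · simp

theorem translation_mul (m m' : Fin n → Fin d) :
    translation m * translation m' = translation (m + m') := by
  ext x y
  rw [mul_translation_apply, translation, translation, add_assoc, add_comm m']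

theorem ctl_true_eq_translation {i : Fin n} {V : Op1 d} {a : Fin d}
    (hV : ∀ x y, V x y = if x = y + a then 1 else 0) :
    ctl (fun _ => True) i V = translation (Pi.single i a) := by
  ext x y
  have h : x = y + Pi.single i a ↔ (∀ k, k ≠ i → x k = y k) ∧ x i = y i + a := by
    constructor
    · rintro rfl
      exact ⟨fun k hk => by simp [hk], by simp⟩
    · rintro ⟨h1, h2⟩
      ext k
      by_cases hk : k = i
      · subst hk; simp [h2]
      · simp [hk, h1 k hk]
  rw [translation, ctl, if_pos trivial, hV]
  simp only [h]
  split_ifs <;> simp_all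

theorem Circuit.realizes_moves {o : CtrlOp d n} {G : Fin d → Op1 d}
    (hG : ∀ q, G q ∈ Matrix.unitaryGroup (Fin d) ℂ) {g : Fin d → Fin d}
    (hGg : ∀ q x y, G q x y = if x = y + g q then 1 else 0) :
    Realizes ((List.finRange n).flatMap fun i =>
      ((o.ctrl i).map fun q => Gate.one i (G q)).toList : Circuit d n)
      (translation fun i => ((o.ctrl i).map g).getD 0) := by
  have key : ∀ L : List (Fin n), Realizes (L.flatMap fun i =>
      ((o.ctrl i).map fun q => Gate.one i (G q)).toList : Circuit d n)
      (translation (L.map fun i => Pi.single i (((o.ctrl i).map g).getD 0)).sum) := by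
    intro L
    induction L with
    | nil =>
      simpa [translation_zero] using Realizes.nil
    | cons i L ih =>
      rw [List.flatMap_cons, List.map_cons, List.sum_cons, add_comm, ← translation_mul]
      refine Realizes.append ?_ ih
      rcases o.ctrl i with _ | q
      · simpa [translation_zero] using Realizes.nil
      · have := Realizes.one (i := i) (hG q)
        rw [ctl_true_eq_translation (hGg q)] at this
        simpa using this
  convert key (List.finRange n) using 2
  rw [← Fin.sum_univ_def]
  exact (Finset.univ_sum_single _).symm

theorem nsmul_one_val (a : Fin d) : a.val • (1 : Fin d) = a := by
  ext
  rw [val_nsmul_one, Nat.mod_eq_of_lt a.isLt]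

-- The two outer layers are translations by `m` and `-m`, with `m` carrying each control value to
-- `-1`; conjugation by them changes only the matching condition.
open Classical in
theorem CtrlOp.realizes_circuit {o : CtrlOp d n}
    (ho : o.gate ∈ Matrix.unitaryGroup (Fin d) ℂ) : o.circuit.Realizes o.toMatrix := by
  set L := (List.finRange n).filter fun i => (o.ctrl i).isSome with hL
  set m : Fin n → Fin d := fun i => ((o.ctrl i).map fun q => -1 - q).getD 0 with hm
  have h1 := Circuit.realizes_moves (o := o) (G := fun q => inc d ^ (-1 - q).val)
    (fun q => pow_mem (inc_mem_unitary d) _) (g := fun q => -1 - q)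
    (fun q x y => by rw [inc_eq_submatrix, nsmul_one_val])
  have h3 := Circuit.realizes_moves (o := o) (G := fun q => (inc d ^ (-1 - q).val)ᴴ)
    (fun q => conjTranspose_mem_unitary (pow_mem (inc_mem_unitary d) _))
    (g := fun q => -(-1 - q))
    (fun q x y => by
      rw [Matrix.conjTranspose_apply, inc_eq_submatrix, nsmul_one_val,
        ← sub_eq_add_neg, if_congr (eq_sub_iff_add_eq (a := x)) rfl rfl]
      split_ifs <;> simp_all)
  have ht : o.target ∉ L := by simp [hL, o.ctrl_target]
  have h2 := realizes_ctrlMany L o.target o.gate ((List.nodup_finRange n).filter _) ht ho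
  have key := (h1.append h2).append h3
  refine Circuit.Realizes.of_eq key ?_
  have hneg : (fun i => ((o.ctrl i).map fun q => -(-1 - q)).getD 0) = -m := by
    ext1 i
    rw [hm, Pi.neg_apply]
    rcases o.ctrl i with _ | q <;> simp
  rw [hneg]
  ext x y
  rw [translation_mul_apply, mul_translation_apply, sub_neg_eq_add, o.toMatrix_eq_ctl, ctl, ctl,
    ← hm]
  -- The target is not translated, so the gate itself is unaffected.
  have hmt : m o.target = 0 := by simp [hm, o.ctrl_target]
  have hmatch : o.Matches y ↔ AllOn L (y + m) := by
    simp only [CtrlOp.Matches, AllOn, hL, List.mem_filter, List.mem_finRange, true_and]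
    refine forall_congr' fun i => ?_
    rcases hi : o.ctrl i with _ | q
    · simp
    · have h5 : y i + (-1 - q) = -1 ↔ y i = q := by
        constructor
        · intro h
          exact add_right_cancel (h.trans (add_sub_cancel q (-1)).symm)
        · rintro rfl
          exact add_sub_cancel _ _
      simp [hm, hi, h5]
  have h4 : (∀ i, i ≠ o.target → x i = y i) ↔
      ∀ i, i ≠ o.target → (x + m) i = (y + m) i := by simp
  simp only [hmatch, h4, add_left_inj, Pi.add_apply, hmt, add_zero]

end translation

/-! ### Correctness of the synthesis -/

section synthesis

variable {d : ℕ}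

theorem run_map_eq_diagonal {n : ℕ} {α : Type*} (L : List α) (f : α → CtrlOp d n)
    (w : α → (Fin n → Fin d) → ℂ) (h : ∀ j ∈ L, (f j).toMatrix = Matrix.diagonal (w j)) :
    run (L.map f) = Matrix.diagonal fun x => (L.map fun j => w j x).prod := by
  induction L with
  | nil => simp [run]
  | cons j L ih =>
    rw [List.forall_mem_cons] at h
    rw [List.map_cons, run, ih h.2, h.1, Matrix.diagonal_mul_diagonal]
    simp [mul_comm]

theorem toMatrix_phase {n : ℕ} {o : CtrlOp d (n + 1)} {j : Fin (n + 1) → Fin d} {z : ℂ}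
    (ht : o.target = Fin.last n)
    (hc : o.ctrl = fun i => if i = Fin.last n then none else some (j i))
    (hg : o.gate = Matrix.diagonal fun a => if a = j (Fin.last n) then z else 1) :
    o.toMatrix = Matrix.diagonal fun x => if x = j then z else 1 := by
  have hm : ∀ y, o.Matches y ↔ ∀ i, i ≠ Fin.last n → y i = j i := by
    intro y
    simp only [CtrlOp.Matches, hc]
    refine forall_congr' fun i => ?_
    by_cases hi : i = Fin.last n <;> simp [hi, eq_comm]
  have hj : ∀ y, y = j ↔ (∀ i, i ≠ Fin.last n → y i = j i) ∧ y (Fin.last n) = j (Fin.last n) := by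
    intro y
    constructor
    · rintro rfl
      simp
    · rintro ⟨h1, h2⟩
      ext i
      by_cases hi : i = Fin.last n
      · subst hi; rw [h2]
      · rw [h1 i hi]
  ext x y
  rw [o.toMatrix_eq_ctl, ctl, ht, hg]
  by_cases hxy : x = y
  · subst hxy
    by_cases h1 : o.Matches x
    · have h2 : x = j ↔ x (Fin.last n) = j (Fin.last n) :=
        (hj x).trans (and_iff_right ((hm x).1 h1))
      simp [h1, h2]
    · have : ¬ x = j := fun h => h1 ((hm x).2 ((hj x).1 h).1)
      simp [h1, this]
  · rw [Matrix.diagonal_apply_ne _ hxy]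
    by_cases h1 : o.Matches y
    · rw [if_pos h1]
      split_ifs with h2
      · rw [Matrix.diagonal_apply_ne]
        intro h3
        apply hxy
        ext i
        by_cases hi : i = Fin.last n
        · subst hi; rw [h3]
        · rw [h2 i hi]
      · rfl
    · rw [if_neg h1, if_neg hxy]

theorem diagonalOps_gate_mem {n : ℕ} {w : (Fin n → Fin d) → ℂ} (hw : ∀ x, ‖w x‖ = 1) :
    ∀ o ∈ diagonalOps n w, o.gate ∈ Matrix.unitaryGroup (Fin d) ℂ := by
  cases n with
  | zero => simp [diagonalOps]
  | succ n =>
    rw [diagonalOps, List.forall_mem_map]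
    intro j _
    refine diagonal_mem_unitary fun a => ?_
    split_ifs <;> simp [hw]

theorem run_diagonalOps {n : ℕ} (hn : 1 ≤ n) (w : (Fin n → Fin d) → ℂ) :
    run (diagonalOps n w) = Matrix.diagonal w := by
  obtain ⟨n, rfl⟩ : ∃ e, n = e + 1 := ⟨n - 1, by omega⟩
  rw [diagonalOps, run_map_eq_diagonal _ _ (fun j x => if x = j then w j else 1)
    fun j _ => toMatrix_phase rfl rfl rfl]
  congr 1
  ext x
  have hnd : (words d (n + 1)).Nodup :=
    (words_pairwise d (n + 1)).imp fun h => by rintro rfl; exact lt_irrefl _ h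
  rw [← List.prod_toFinset _ hnd, Finset.prod_ite_eq, if_pos (List.mem_toFinset.2 (mem_words x))]

variable [NeZero d]

theorem Circuit.realizes_flatMap_circuit {n : ℕ} {L : List (CtrlOp d n)}
    (hL : ∀ o ∈ L, o.gate ∈ Matrix.unitaryGroup (Fin d) ℂ) :
    Realizes (L.flatMap CtrlOp.circuit) (run L) := by
  induction L with
  | nil => exact Realizes.nil
  | cons o L ih =>
    rw [List.forall_mem_cons] at hL
    exact (CtrlOp.realizes_circuit hL.1).append (ih hL.2)

theorem run_reverse_adjoint {n : ℕ} (L : List (CtrlOp d n)) :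
    run (L.reverse.map CtrlOp.adjoint) = (run L)ᴴ := by
  induction L with
  | nil => simp [run]
  | cons o L ih =>
    rw [List.reverse_cons, List.map_append, run_append, ih, run, Matrix.conjTranspose_mul]
    simp [run, CtrlOp.toMatrix_adjoint]

theorem realizes_synthesize {n : ℕ} (hn : 1 ≤ n) {U : OpN d n}
    (hU : U ∈ Matrix.unitaryGroup (Fin n → Fin d) ℂ) : (synthesize n U).Realizes U := by
  set W := run (triangle n U) * U with hW
  have hWu : W ∈ Matrix.unitaryGroup (Fin n → Fin d) ℂ := run_triangle_mul_mem_unitary hU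
  have hWd : Matrix.diagonal (fun j => W j j) = W := (run_triangle_mul_isDiag hU).diagonal_diag
  have hnorm : ∀ j, ‖W j j‖ = 1 := by
    intro j
    have h1 : W * Wᴴ = 1 := Matrix.mem_unitaryGroup_iff.1 hWu
    rw [← hWd, Matrix.diagonal_conjTranspose, Matrix.diagonal_mul_diagonal,
      ← Matrix.diagonal_one] at h1
    have h2 := congrFun (Matrix.diagonal_injective h1) j
    rw [Pi.star_apply, RCLike.star_def, Complex.mul_conj'] at h2
    have h3 : ‖W j j‖ ^ 2 = 1 := by exact_mod_cast h2
    exact (pow_eq_one_iff_of_nonneg (norm_nonneg _) two_ne_zero).1 h3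
  have hgate := triangle_gate_mem n U
  have key := Circuit.realizes_flatMap_circuit
    (L := diagonalOps n (fun j => W j j) ++ (triangle n U).reverse.map CtrlOp.adjoint) (by
      rw [List.forall_mem_append, List.forall_mem_map]
      refine ⟨diagonalOps_gate_mem hnorm, fun o ho => ?_⟩
      exact conjTranspose_mem_unitary (hgate o (List.mem_reverse.1 ho)))
  refine Circuit.Realizes.of_eq key ?_
  rw [run_append, run_diagonalOps hn, run_reverse_adjoint, hWd, hW, ← mul_assoc]
  have : (run (triangle n U))ᴴ * run (triangle n U) = 1 :=
    Matrix.mem_unitaryGroup_iff'.1 (run_mem_unitary hgate)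
  rw [this, one_mul]

end synthesis

/-! ### The number of two-qudit gates -/

section cost

variable {d n : ℕ}

theorem Circuit.twoCount_append (C D : Circuit d n) :
    twoCount (C ++ D) = C.twoCount + D.twoCount := List.countP_append

theorem Circuit.twoCount_flatten_replicate (C : Circuit d n) (k : ℕ) :
    twoCount (List.replicate k C).flatten = k * C.twoCount := by
  simp [twoCount, List.countP_flatten]

theorem Circuit.twoCount_flatMap {α : Type*} (L : List α) (f : α → Circuit d n) :
    twoCount (L.flatMap f) = (L.map fun a => (f a).twoCount).sum := by
  simp [twoCount, List.countP_flatMap, Function.comp_def]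

variable [NeZero d]

theorem twoCount_ctrlOne (c t : Fin n) (V : Op1 d) :
    Circuit.twoCount (ctrlOne c t V) = 2 * d := by
  rw [ctrlOne, Circuit.twoCount_flatMap]
  have h : ∀ k, Circuit.twoCount ([.one t (eigenFrame V k)ᴴ] ++
      ctrlPhase c t (eigenRoot V k) ++ [.one t (eigenFrame V k)] : Circuit d n) = 2 := by
    intro k
    rfl
  simp only [h]
  simp [mul_comm]

theorem twoCount_peel (q t : Fin n) (X : Op1 d) (A B : Circuit d n) :
    Circuit.twoCount (peel q t X A B) = d * (2 * d + A.twoCount) + B.twoCount := by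
  have hd : d - 1 + 1 = d := Nat.sub_add_cancel (Nat.one_le_iff_ne_zero.2 (NeZero.ne d))
  simp only [peel, Circuit.twoCount_append, Circuit.twoCount_flatten_replicate, twoCount_ctrlOne]
  generalize A.twoCount = a
  generalize B.twoCount = b
  calc _ = (d - 1 + 1) * (2 * d + a) + b := by ring
    _ = _ := by rw [hd]

/-- The number of two-qudit gates of `∧ₖ(INC)`. -/
def incCost (d : ℕ) : ℕ → ℕ
  | 0 => 0
  | 1 => 1
  | 2 => d * (2 * d + 1) + 2 * d
  | k + 3 => d * (incCost d ((k + 5) / 2) + incCost d (k + 4 - (k + 5) / 2))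
  decreasing_by
    all_goals omega

/-- The number of two-qudit gates of `∧ₖ(V)`. -/
def ctrlCost (d : ℕ) : ℕ → ℕ
  | 0 => 0
  | 1 => 2 * d
  | k + 2 => d * (2 * d + incCost d (k + 1)) + ctrlCost d (k + 1)

theorem twoCount_ctrlInc : ∀ (L : List (Fin n)) (t s : Fin n),
    Circuit.twoCount (ctrlInc L t s : Circuit d n) = incCost d L.length
  | [], t, s => by
    rw [ctrlInc, List.length_nil, incCost]
    rfl
  | [c], t, s => by
    rw [ctrlInc, List.length_singleton, incCost]
    rfl
  | [c, q], t, s => by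
    rw [ctrlInc, twoCount_peel, twoCount_ctrlOne]
    have h : Circuit.twoCount [Gate.two c q (cinc d)] = 1 := rfl
    rw [h]
    simp [incCost]
  | c :: c' :: c'' :: cs, t, s => by
    rw [ctrlInc, Circuit.twoCount_flatten_replicate, Circuit.twoCount_append, twoCount_ctrlInc,
      twoCount_ctrlInc]
    simp only [List.length_cons, List.length_take, List.length_drop]
    rw [incCost]
    congr 3
    · omega
    · omega
  termination_by L => L.length
  decreasing_by
    all_goals simp
    all_goals omega

theorem twoCount_ctrlMany : ∀ (L : List (Fin n)) (t : Fin n) (V : Op1 d),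
    Circuit.twoCount (ctrlMany L t V) = ctrlCost d L.length
  | [], t, V => rfl
  | [c], t, V => by
    rw [ctrlMany, twoCount_ctrlOne]
    rfl
  | q :: c :: cs, t, V => by
    rw [ctrlMany, twoCount_peel, twoCount_ctrlInc, twoCount_ctrlMany]
    rfl

theorem CtrlOp.twoCount_circuit (o : CtrlOp d n) :
    o.circuit.twoCount = ctrlCost d o.numControls := by
  have h : ∀ G : Fin d → Op1 d, Circuit.twoCount ((List.finRange n).flatMap fun i =>
      ((o.ctrl i).map fun q => Gate.one i (G q)).toList : Circuit d n) = 0 := by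
    intro G
    rw [Circuit.twoCount_flatMap]
    refine List.sum_eq_zero fun k hk => ?_
    obtain ⟨i, _, rfl⟩ := List.mem_map.1 hk
    rcases o.ctrl i with _ | q <;> rfl
  have hlen : ((List.finRange n).filter fun i => (o.ctrl i).isSome).length = o.numControls := by
    rw [CtrlOp.numControls, ← List.toFinset_card_of_nodup ((List.nodup_finRange n).filter _)]
    congr 1
    ext i
    simp
  rw [CtrlOp.circuit, Circuit.twoCount_append, Circuit.twoCount_append, h, h, twoCount_ctrlMany,
    hlen, zero_add, add_zero]

theorem twoCount_synthesize (hn : 1 ≤ n) (U : OpN d n) :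
    (synthesize n U).twoCount =
      d ^ n * ctrlCost d (n - 1) + ((profile (triangle n U)).map (ctrlCost d)).sum := by
  obtain ⟨n, rfl⟩ : ∃ e, n = e + 1 := ⟨n - 1, by omega⟩
  rw [synthesize, List.flatMap_append, Circuit.twoCount_append, Circuit.twoCount_flatMap,
    Circuit.twoCount_flatMap]
  simp only [CtrlOp.twoCount_circuit]
  congr 1
  · have h : ∀ o ∈ diagonalOps (n + 1) (fun j => (run (triangle (n + 1) U) * U) j j),
        ctrlCost d o.numControls = ctrlCost d n := by
      rw [diagonalOps, List.forall_mem_map]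
      intro j _
      congr 1
      simp only [CtrlOp.numControls]
      have : (Finset.univ.filter fun i : Fin (n + 1) =>
          (if i = Fin.last n then none else some (j i)).isSome = true) =
          Finset.univ.erase (Fin.last n) := by
        ext i
        by_cases hi : i = Fin.last n <;> simp [hi]
      rw [this]
      simp
    rw [List.map_congr_left h, List.map_const', List.sum_replicate, smul_eq_mul, diagonalOps,
      List.length_map, length_words]
    rfl
  · rw [List.map_map, List.map_reverse, List.sum_reverse, profile, List.map_map]
    rfl

end cost

/-! ### Bounds for the cost recursions -/

theorem incCost_two (d : ℕ) : incCost d 2 = 2 * d ^ 2 + 3 * d := by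
  rw [incCost]; ring

theorem incCost_three (d : ℕ) : incCost d 3 = 4 * d ^ 3 + 6 * d ^ 2 := by
  have h : incCost d 3 = d * (incCost d 2 + incCost d 2) := incCost.eq_4 d 0
  rw [h, incCost_two]; ring

theorem incCost_four (d : ℕ) : incCost d 4 = 4 * d ^ 4 + 8 * d ^ 3 + 3 * d ^ 2 := by
  have h : incCost d 4 = d * (incCost d 3 + incCost d 2) := incCost.eq_4 d 1
  rw [h, incCost_two, incCost_three]; ring

theorem incCost_five (d : ℕ) : incCost d 5 = 8 * d ^ 4 + 12 * d ^ 3 := by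
  have h : incCost d 5 = d * (incCost d 3 + incCost d 3) := incCost.eq_4 d 2
  rw [h, incCost_three]; ring

/-- The constant `9` covers `k = 4`, where the cost can reach `8.75 * d ^ 4` at `d = 2`. From `k =
5` on, both factors have at most `k - 2` controls, so their two costs times `d` are absorbed by `2 ≤
d`. -/
theorem incCost_le_pow {d : ℕ} (hd : 2 ≤ d) (k : ℕ) : incCost d k ≤ 9 * d ^ k := by
  induction k using Nat.strong_induction_on with
  | _ k ih =>
    have h2 : 2 * d ≤ d ^ 2 := by nlinarith
    have h3 : 2 * d ^ 2 ≤ d ^ 3 := by rw [pow_succ d 2, mul_comm]; gcongr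
    have h4 : 2 * d ^ 3 ≤ d ^ 4 := by rw [pow_succ d 3, mul_comm]; gcongr
    match k, ih with
    | 0, _ => simp [incCost]
    | 1, _ => rw [incCost, pow_one]; omega
    | 2, _ => rw [incCost_two]; omega
    | 3, _ => rw [incCost_three]; omega
    | 4, _ => rw [incCost_four]; omega
    | k + 5, ih =>
      rw [incCost]
      have ha := ih ((k + 2 + 5) / 2) (by omega)
      have hb := ih (k + 2 + 4 - (k + 2 + 5) / 2) (by omega)
      calc _ ≤ d * (9 * d ^ ((k + 2 + 5) / 2) + 9 * d ^ (k + 2 + 4 - (k + 2 + 5) / 2)) := by gcongr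
        _ ≤ d * (9 * d ^ (k + 3) + 9 * d ^ (k + 3)) := by
          gcongr <;> omega
        _ = 9 * (2 * d ^ (k + 4)) := by ring
        _ ≤ 9 * (d * d ^ (k + 4)) := by gcongr
        _ = _ := by ring

/-- The constant solves `c = 2 + 9 + c / 2`: the `9` is that of `incCost_le_pow`, and the tail of
the recursion is halved because `2 ≤ d`. -/
theorem ctrlCost_le_pow {d : ℕ} (hd : 2 ≤ d) : ∀ k : ℕ, ctrlCost d k ≤ 22 * d ^ k
  | 0 => by simp [ctrlCost]
  | 1 => by rw [ctrlCost, pow_one]; omega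
  | k + 2 => by
    have ih := ctrlCost_le_pow hd (k + 1)
    have hI := incCost_le_pow hd (k + 1)
    have h2 : d ^ 2 ≤ d ^ (k + 2) := Nat.pow_le_pow_right (by omega) (by omega)
    rw [ctrlCost]
    calc _ ≤ d * (2 * d + 9 * d ^ (k + 1)) + 22 * d ^ (k + 1) := by gcongr
      _ = 2 * d ^ 2 + 9 * d ^ (k + 2) + 11 * (2 * d ^ (k + 1)) := by ring
      _ ≤ 2 * d ^ (k + 2) + 9 * d ^ (k + 2) + 11 * (d * d ^ (k + 1)) := by gcongr
      _ = _ := by ring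

/-- The exponent `1 + log₂ d` satisfies `2 ^ (1 + log₂ d) = 2 d`. -/
theorem two_rpow_one_add_logb {d : ℕ} (hd : 2 ≤ d) :
    (2 : ℝ) ^ (1 + Real.logb 2 d) = 2 * d := by
  rw [Real.rpow_add two_pos, Real.rpow_one, Real.rpow_logb two_pos (by norm_num) (by positivity)]

theorem one_le_logb {d : ℕ} (hd : 2 ≤ d) : 1 ≤ Real.logb 2 d := by
  rw [Real.le_logb_iff_rpow_le (by norm_num) (by positivity), Real.rpow_one]
  exact_mod_cast hd

/-- Halving the number of controls costs a factor `2 * d = 2 ^ p`, which fixes the exponent `p`. A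
factor with `j` controls satisfies `2 * j ≤ k + 2`, that is, `j - 2 ≤ (k - 2) / 2`; the shift by `2`
makes the halving exact. -/
theorem incCost_le_rpow {d : ℕ} (hd : 2 ≤ d) (k : ℕ) :
    (incCost d k : ℝ) ≤ 6 * d ^ 3 * max ((k : ℝ) - 2) 2 ^ (1 + Real.logb 2 d) := by
  set p := 1 + Real.logb 2 d with hp
  have hp2 : 2 ≤ p := by linarith [one_le_logb hd]
  have h2p : (2 : ℝ) ^ p = 2 * d := two_rpow_one_add_logb hd
  have hdR : (2 : ℝ) ≤ d := by exact_mod_cast hd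
  have hbase : ∀ k : ℕ, (incCost d k : ℝ) ≤ 12 * d ^ 4 →
      (incCost d k : ℝ) ≤ 6 * d ^ 3 * max ((k : ℝ) - 2) 2 ^ p := by
    intro k hk
    calc _ ≤ (12 : ℝ) * d ^ 4 := hk
      _ = 6 * d ^ 3 * (2 : ℝ) ^ p := by rw [h2p]; ring
      _ ≤ _ := by
        gcongr
        exact le_max_right _ _
  have hd2 : (2 : ℝ) * d ≤ d ^ 2 := by nlinarith
  have hd3 : (2 : ℝ) * d ^ 2 ≤ d ^ 3 := by nlinarith [sq_nonneg (d : ℝ)]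
  have hd4 : (2 : ℝ) * d ^ 3 ≤ d ^ 4 := by nlinarith [pow_pos (by linarith : (0:ℝ) < d) 3]
  induction k using Nat.strong_induction_on with
  | _ k ih =>
    match k, ih with
    | 0, _ => exact hbase 0 (by rw [incCost]; push_cast; positivity)
    | 1, _ => exact hbase 1 (by rw [incCost]; push_cast; nlinarith)
    | 2, _ => exact hbase 2 (by rw [incCost_two]; push_cast; nlinarith)
    | 3, _ => exact hbase 3 (by rw [incCost_three]; push_cast; nlinarith)
    | 4, _ =>
      refine hbase 4 ?_
      rw [incCost_four]
      push_cast
      nlinarith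
    -- Here `(5 - 2) / 2 < 2`, so the halving step does not apply; the bound follows from `3 ^ p ≥ 3
    -- * d`.
    | 5, _ =>
      rw [incCost_five]
      push_cast
      have h3p : (3 : ℝ) * d ≤ 3 ^ p := by
        have h : (3 : ℝ) = 3 / 2 * 2 := by norm_num
        have h1 : (3 / 2 : ℝ) ≤ (3 / 2 : ℝ) ^ p := Real.self_le_rpow_of_one_le (by norm_num) (by linarith)
        calc (3 : ℝ) * d = 3 / 2 * (2 * d) := by ring
          _ ≤ (3 / 2) ^ p * 2 ^ p := by rw [h2p]; gcongr
          _ = _ := by rw [← Real.mul_rpow (by norm_num) (by norm_num)]; norm_num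
      have hmax : max ((5 : ℝ) - 2) 2 = 3 := by norm_num
      rw [hmax]
      calc (8 : ℝ) * d ^ 4 + 12 * d ^ 3 ≤ 6 * (d : ℝ) ^ 3 * (3 * d) := by nlinarith
        _ ≤ _ := by gcongr
    | k + 6, ih =>
      have hsub : max (((k + 6 : ℕ) : ℝ) - 2) 2 = (k : ℝ) + 4 := by
        push_cast
        rw [max_eq_left] <;> linarith [(Nat.cast_nonneg k : (0 : ℝ) ≤ k)]
      have hhalf : ∀ j : ℕ, 2 * j ≤ k + 8 → j < k + 6 →
          (incCost d j : ℝ) ≤ 6 * d ^ 3 * ((k : ℝ) + 4) ^ p / (2 * d) := by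
        intro j hj hjk
        refine (ih j hjk).trans ?_
        have h1 : max ((j : ℝ) - 2) 2 ≤ ((k : ℝ) + 4) / 2 := by
          have : (2 : ℝ) * j ≤ k + 8 := by exact_mod_cast hj
          exact max_le (by linarith) (by linarith [(Nat.cast_nonneg k : (0 : ℝ) ≤ k)])
        calc _ ≤ 6 * (d : ℝ) ^ 3 * (((k : ℝ) + 4) / 2) ^ p := by gcongr
          _ = _ := by rw [Real.div_rpow (by positivity) (by norm_num), h2p]; ring
      have ha := hhalf ((k + 3 + 5) / 2) (by omega) (by omega)
      have hb := hhalf (k + 3 + 4 - (k + 3 + 5) / 2) (by omega) (by omega)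
      rw [incCost, hsub]
      push_cast
      calc (d : ℝ) * (_ + _) ≤ d * (6 * d ^ 3 * ((k : ℝ) + 4) ^ p / (2 * d) +
            6 * d ^ 3 * ((k : ℝ) + 4) ^ p / (2 * d)) := by gcongr
        _ = _ := by field_simp; ring

/-- Bernoulli's inequality for `(1 + 1 / y) ^ s`; it serves as a discrete integration of powers. -/
theorem rpow_add_one_ge {y s : ℝ} (hy : 0 < y) (hs : 1 ≤ s) :
    y ^ s + s * y ^ (s - 1) ≤ (y + 1) ^ s := by
  have h1 : y + 1 = y * (1 + 1 / y) := by field_simp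
  have h2 : 1 + s * (1 / y) ≤ (1 + 1 / y) ^ s :=
    one_add_mul_self_le_rpow_one_add (by have := div_pos one_pos hy; linarith) hs
  rw [h1, Real.mul_rpow hy.le (by positivity), Real.rpow_sub_one hy.ne']
  calc _ = y ^ s * (1 + s * (1 / y)) := by ring
    _ ≤ _ := by gcongr

/-- Summing the costs of the increments raises the exponent by one. As `2 + log₂ d ≥ 3`, each step
of the right side gains at least `3 * 2 * d ^ 4` times the lower power, which pays for the `d * 6 *
d ^ 3` of the increments; the extra `1` in `h1` absorbs `2 * d ^ 2`. -/
theorem ctrlCost_le_rpow {d : ℕ} (hd : 2 ≤ d) : ∀ k : ℕ,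
    (ctrlCost d k : ℝ) ≤ 2 * d ^ 4 * ((k : ℝ) + 2) ^ (2 + Real.logb 2 d)
  | 0 => by
    rw [ctrlCost]
    push_cast
    positivity
  | 1 => by
    have hdR : (2 : ℝ) ≤ d := by exact_mod_cast hd
    have h1 : (1 : ℝ) ≤ (((1 : ℕ) : ℝ) + 2) ^ (2 + Real.logb 2 d) :=
      Real.one_le_rpow (by norm_num) (by linarith [one_le_logb hd])
    have h2 : (d : ℝ) ≤ d ^ 4 := le_self_pow₀ (by linarith) (by norm_num)
    rw [ctrlCost]
    push_cast at *
    nlinarith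
  | k + 2 => by
    have hdR : (2 : ℝ) ≤ d := by exact_mod_cast hd
    have ih := ctrlCost_le_rpow hd (k + 1)
    have hI := incCost_le_rpow hd (k + 1)
    have hL := one_le_logb hd
    set L := Real.logb 2 d
    have hk : (0 : ℝ) ≤ k := Nat.cast_nonneg k
    have hI' : (incCost d (k + 1) : ℝ) ≤ 6 * d ^ 3 * ((k : ℝ) + 2) ^ (1 + L) := by
      refine hI.trans ?_
      gcongr
      push_cast
      exact max_le (by linarith) (by linarith)
    have h1 : ((k : ℝ) + 2) ^ (1 + L) + 1 ≤ ((k : ℝ) + 3) ^ (1 + L) := by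
      have := rpow_add_one_ge (y := (k : ℝ) + 2) (s := 1 + L) (by linarith) (by linarith)
      have h' : (1 : ℝ) ≤ ((k : ℝ) + 2) ^ (1 + L - 1) :=
        Real.one_le_rpow (by linarith) (by linarith)
      rw [add_assoc] at this
      norm_num at this h' ⊢
      nlinarith
    have h2 : ((k : ℝ) + 3) ^ (2 + L) + 3 * ((k : ℝ) + 3) ^ (1 + L) ≤ ((k : ℝ) + 4) ^ (2 + L) := by
      have := rpow_add_one_ge (y := (k : ℝ) + 3) (s := 2 + L) (by linarith) (by linarith)
      have e1 : 2 + L - 1 = 1 + L := by ring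
      have e2 : (k : ℝ) + 3 + 1 = k + 4 := by ring
      rw [e1, e2] at this
      have h' : (0 : ℝ) ≤ ((k : ℝ) + 3) ^ (1 + L) := by positivity
      nlinarith
    have e3 : (((k + 1 : ℕ) : ℝ) + 2) = k + 3 := by push_cast; ring
    have e4 : (((k + 2 : ℕ) : ℝ) + 2) = k + 4 := by push_cast; ring
    rw [e3] at ih
    rw [e4, ctrlCost]
    push_cast
    have hd24 : (2 : ℝ) * d ^ 2 ≤ 6 * d ^ 4 := by
      have : (d : ℝ) ^ 2 ≤ d ^ 4 := pow_le_pow_right₀ (by linarith) (by norm_num)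
      nlinarith [sq_nonneg (d : ℝ)]
    calc (d : ℝ) * (2 * d + incCost d (k + 1)) + ctrlCost d (k + 1)
        ≤ d * (2 * d + 6 * d ^ 3 * ((k : ℝ) + 2) ^ (1 + L)) +
          2 * d ^ 4 * ((k : ℝ) + 3) ^ (2 + L) := by gcongr
      _ = 2 * d ^ 2 + 6 * d ^ 4 * ((k : ℝ) + 2) ^ (1 + L) +
          2 * d ^ 4 * ((k : ℝ) + 3) ^ (2 + L) := by ring
      _ ≤ 6 * d ^ 4 + 6 * d ^ 4 * ((k : ℝ) + 2) ^ (1 + L) +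
          2 * d ^ 4 * ((k : ℝ) + 3) ^ (2 + L) := by gcongr
      _ = 6 * d ^ 4 * (((k : ℝ) + 2) ^ (1 + L) + 1) + 2 * d ^ 4 * ((k : ℝ) + 3) ^ (2 + L) := by ring
      _ ≤ 6 * d ^ 4 * ((k : ℝ) + 3) ^ (1 + L) + 2 * d ^ 4 * ((k : ℝ) + 3) ^ (2 + L) := by gcongr
      _ = 2 * d ^ 4 * (((k : ℝ) + 3) ^ (2 + L) + 3 * ((k : ℝ) + 3) ^ (1 + L)) := by ring
      _ ≤ _ := by gcongr

/-- The first term is the diagonal, with `n - 1` controls per phase and the polynomial bound; the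
second is the Triangle part, with the exponential bound summed against the weight. -/
theorem twoCount_synthesize_le {d n : ℕ} [NeZero d] (hd : 2 ≤ d) (hn : 1 ≤ n) (U : OpN d n) :
    ((synthesize n U).twoCount : ℝ) ≤
      2 * ((n : ℝ) + 1) ^ (2 + Real.logb 2 d) * (d : ℝ) ^ (n + 4) + 26 * (d : ℝ) ^ (2 * n + 8) := by
  rw [twoCount_synthesize hn]
  have hd1 : (1 : ℝ) ≤ d := by exact_mod_cast (by omega : 1 ≤ d)
  have h1 : ((profile (triangle n U)).map (ctrlCost d)).sum ≤ 22 * d ^ (2 * n + 4) := by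
    calc _ ≤ ((profile (triangle n U)).map fun k => 22 * d ^ k).sum :=
          List.sum_le_sum fun k _ => ctrlCost_le_pow hd k
      _ = 22 * weight (triangle n U) := by rw [List.sum_map_mul_left]; rfl
      _ ≤ _ := Nat.mul_le_mul_left _ (weightLE_triangle hd n U)
  have h2 : (((profile (triangle n U)).map (ctrlCost d)).sum : ℝ) ≤ 22 * (d : ℝ) ^ (2 * n + 4) := by
    exact_mod_cast h1
  have h3 := ctrlCost_le_rpow hd (n - 1)
  have e1 : (((n - 1 : ℕ) : ℝ) + 2) = n + 1 := by
    rw [Nat.cast_sub hn]; push_cast; ring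
  rw [e1] at h3
  rw [Nat.cast_add]
  refine add_le_add ?_ (h2.trans ?_)
  · push_cast
    calc _ ≤ (d : ℝ) ^ n * (2 * d ^ 4 * ((n : ℝ) + 1) ^ (2 + Real.logb 2 d)) := by gcongr
      _ = _ := by ring
  · have : (d : ℝ) ^ (2 * n + 4) ≤ d ^ (2 * n + 8) := pow_le_pow_right₀ hd1 (by omega)
    nlinarith [pow_nonneg (zero_le_one.trans hd1) (2 * n + 8)]

open Filter Asymptotics in
theorem cost_isBigO {d : ℕ} (hd : 2 ≤ d) :
    (fun n : ℕ => 2 * ((n : ℝ) + 1) ^ (2 + Real.logb 2 d) * (d : ℝ) ^ (n + 4)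
      + 26 * (d : ℝ) ^ (2 * n + 8)) =O[atTop] fun n : ℕ => (d : ℝ) ^ (2 * n) := by
  have hdR : (2 : ℝ) ≤ d := by exact_mod_cast hd
  have hlog : 0 < Real.log d := Real.log_pos (by linarith)
  have h1 : (fun n : ℕ => ((n : ℝ) + 1) ^ (2 + Real.logb 2 d)) =O[atTop]
      fun n : ℕ => (d : ℝ) ^ n := by
    have h := (isLittleO_rpow_exp_pos_mul_atTop (2 + Real.logb 2 d) hlog).isBigO
    have ht : Tendsto (fun n : ℕ => (n : ℝ) + 1) atTop atTop :=
      tendsto_atTop_add_const_right _ _ tendsto_natCast_atTop_atTop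
    refine (h.comp_tendsto ht).trans (IsBigO.of_bound d (Eventually.of_forall fun n => ?_))
    have : Real.exp (Real.log d * ((n : ℝ) + 1)) = d * d ^ n := by
      rw [mul_add, mul_one, Real.exp_add, Real.exp_log (by linarith), mul_comm (Real.log d),
        Real.exp_nat_mul, Real.exp_log (by linarith), mul_comm]
    simp only [Function.comp_apply, this]
    rw [norm_mul, Real.norm_of_nonneg (by linarith : (0 : ℝ) ≤ d)]
  refine IsBigO.add ?_ ?_
  · have h2 := (h1.mul (isBigO_refl (fun n : ℕ => (d : ℝ) ^ n) atTop)).const_mul_left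
      (2 * (d : ℝ) ^ 4)
    refine (h2.congr_left fun n => ?_).congr_right fun n => ?_
    · ring
    · ring
  · refine ((isBigO_refl (fun n : ℕ => (d : ℝ) ^ (2 * n)) atTop).const_mul_left
      (26 * (d : ℝ) ^ 8)).congr_left fun n => ?_
    ring

/-! ### Polynomials in the entries of a matrix -/

section polynomial

variable {ι σ τ : Type*}

/-- The value of a polynomial in the entries of a matrix. -/
def entryEval (M : Matrix ι ι ℂ) (Q : MvPolynomial (ι × ι) ℂ) : ℂ :=
  MvPolynomial.eval (fun p => M p.1 p.2) Q

/-- The composition of a polynomial in the entries of a matrix with a polynomial family. -/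
theorem entryEval_map_eval (F : Matrix ι ι (MvPolynomial σ ℂ)) (v : σ → ℂ)
    (Q : MvPolynomial (ι × ι) ℂ) : entryEval (F.map (MvPolynomial.eval v)) Q =
      MvPolynomial.eval v (MvPolynomial.aeval (fun p => F p.1 p.2) Q) := by
  rw [MvPolynomial.aeval_def, entryEval, MvPolynomial.eval_eval₂]
  have h : (MvPolynomial.eval v).comp (algebraMap ℂ (MvPolynomial σ ℂ)) = RingHom.id ℂ := by
    ext z
    simp
  rw [h]
  rfl

/-- If a polynomial vanishes on those members of a polynomial family whose parameters lie in
infinite sets, then it vanishes on the whole family. -/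
theorem entryEval_family_eq_zero {Q : MvPolynomial (ι × ι) ℂ} (F : Matrix ι ι (MvPolynomial σ ℂ))
    {s : Set ℂ} (hs : s.Infinite)
    (h : ∀ v : σ → ℂ, (∀ i, v i ∈ s) → entryEval (F.map (MvPolynomial.eval v)) Q = 0)
    (v : σ → ℂ) : entryEval (F.map (MvPolynomial.eval v)) Q = 0 := by
  rw [entryEval_map_eval]
  have : MvPolynomial.aeval (fun p : ι × ι => F p.1 p.2) Q = 0 := by
    refine MvPolynomial.funext_set (fun _ => s) (fun _ => hs) fun v hv => ?_
    rw [← entryEval_map_eval, map_zero]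
    exact h v fun i => hv i (Set.mem_univ i)
  rw [this, map_zero]

variable [Fintype ι] [DecidableEq ι] {Q : MvPolynomial (ι × ι) ℂ}

/-- Fix an eigenbasis of `H` and vary the eigenvalues: on the unit circle the matrices are unitary,
and the circle is infinite, so the polynomial vanishes for arbitrary eigenvalues. -/
theorem entryEval_isHermitian_eq_zero (hQ : ∀ U ∈ Matrix.unitaryGroup ι ℂ, entryEval U Q = 0)
    {H : Matrix ι ι ℂ} (hH : H.IsHermitian) : entryEval H Q = 0 := by
  set P : Matrix ι ι ℂ := (hH.eigenvectorUnitary : Matrix ι ι ℂ) with hP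
  have hPm : P ∈ Matrix.unitaryGroup ι ℂ := hH.eigenvectorUnitary.2
  have hsp : H = P * Matrix.diagonal (fun k => (hH.eigenvalues k : ℂ)) * Pᴴ := by
    conv_lhs => rw [hH.spectral_theorem]
    rw [Unitary.conjStarAlgAut_apply]
    rfl
  have hF : ∀ v : ι → ℂ, (P.map MvPolynomial.C * Matrix.diagonal MvPolynomial.X *
      Pᴴ.map MvPolynomial.C).map (MvPolynomial.eval v) = P * Matrix.diagonal v * Pᴴ := by
    intro v
    rw [Matrix.map_mul, Matrix.map_mul, Matrix.map_map, Matrix.map_map,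
      Matrix.diagonal_map (map_zero _)]
    have hC : (MvPolynomial.eval v : MvPolynomial ι ℂ → ℂ) ∘ MvPolynomial.C = id := by
      ext1 z
      simp
    have hX : (fun i => MvPolynomial.eval v (MvPolynomial.X i)) = v := by
      ext1 i
      simp
    rw [hC, Matrix.map_id, Matrix.map_id]
    congr 3
  rw [hsp, ← hF]
  refine entryEval_family_eq_zero _ infinite_unit_sphere (fun v hv => ?_) _
  rw [hF]
  exact hQ _ (mul_mem (mul_mem hPm (diagonal_mem_unitary fun k => by simpa using hv k))
    (conjTranspose_mem_unitary hPm))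

/-- The unitary matrices are Zariski dense in all matrices. -/
theorem eq_zero_of_entryEval_unitary (hQ : ∀ U ∈ Matrix.unitaryGroup ι ℂ, entryEval U Q = 0) :
    Q = 0 := by
  have hall : ∀ M : Matrix ι ι ℂ, entryEval M Q = 0 := by
    intro M
    -- Write `M = X + iY` with Hermitian `X, Y`. For real `r` the matrix `X + rY` is Hermitian, so
    -- vanishing extends from the real parameters to `i`.
    set X : Matrix ι ι ℂ := (2⁻¹ : ℂ) • (M + Mᴴ) with hX
    set Y : Matrix ι ι ℂ := (-Complex.I * 2⁻¹) • (M - Mᴴ) with hY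
    have hF : ∀ v : Unit → ℂ, (X.map MvPolynomial.C +
        (MvPolynomial.X () : MvPolynomial Unit ℂ) • Y.map MvPolynomial.C).map
          (MvPolynomial.eval v) = X + v () • Y := by
      intro v
      ext i j
      simp
    have hM : M = X + (fun _ : Unit => Complex.I) () • Y := by
      have h1 : Complex.I * (-Complex.I * 2⁻¹) = 2⁻¹ := by
        rw [← mul_assoc, mul_neg, Complex.I_mul_I]; simp
      rw [hX, hY, smul_smul, h1, ← smul_add, add_add_sub_cancel, ← two_smul ℂ M, smul_smul]
      norm_num
    rw [hM, ← hF fun _ => Complex.I]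
    refine entryEval_family_eq_zero _ (s := Set.range fun x : ℝ => (x : ℂ))
      (Set.infinite_range_of_injective Complex.ofReal_injective) (fun v hv => ?_) _
    rw [hF]
    obtain ⟨r, hr⟩ := hv ()
    refine entryEval_isHermitian_eq_zero hQ ?_
    rw [← hr, Matrix.IsHermitian, hX, hY]
    simp only [Matrix.conjTranspose_add, Matrix.conjTranspose_smul, Matrix.conjTranspose_sub,
      Matrix.conjTranspose_conjTranspose]
    ext i j
    simp
    ring
  refine MvPolynomial.funext fun v => ?_
  rw [map_zero]
  exact hall fun i j => v (i, j)

end polynomial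

/-! ### Polynomially parametrized sets of matrices and their dimension -/

/-- The set `S` of matrices is covered by a family whose entries are polynomials in parameters
indexed by `σ`. -/
def PolyCovered {ι : Type*} (σ : Type) (S : Set (Matrix ι ι ℂ)) : Prop :=
  ∃ F : Matrix ι ι (MvPolynomial σ ℂ), ∀ M ∈ S, ∃ v : σ → ℂ, M = F.map (MvPolynomial.eval v)

namespace PolyCovered

variable {ι : Type*} {σ τ : Type} {S T : Set (Matrix ι ι ℂ)}

theorem mul [Fintype ι] (hS : PolyCovered σ S) (hT : PolyCovered τ T) :
    PolyCovered (σ ⊕ τ) (Set.image2 (· * ·) S T) := by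
  obtain ⟨F, hF⟩ := hS
  obtain ⟨G, hG⟩ := hT
  refine ⟨F.map (MvPolynomial.rename Sum.inl) * G.map (MvPolynomial.rename Sum.inr), ?_⟩
  rintro _ ⟨A, hA, B, hB, rfl⟩
  obtain ⟨v, rfl⟩ := hF A hA
  obtain ⟨w, rfl⟩ := hG B hB
  refine ⟨Sum.elim v w, ?_⟩
  rw [Matrix.map_mul, Matrix.map_map, Matrix.map_map]
  congr 1 <;> ext <;> simp [MvPolynomial.eval_rename]

/-- A family of matrices with fewer parameters than entries satisfies a polynomial equation. -/
theorem exists_ne_zero {ι : Type} [Fintype ι] [Fintype σ] {S : Set (Matrix ι ι ℂ)}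
    (hS : PolyCovered σ S) (hcard : Fintype.card σ < Fintype.card ι * Fintype.card ι) :
    ∃ Q : MvPolynomial (ι × ι) ℂ, Q ≠ 0 ∧ ∀ M ∈ S, entryEval M Q = 0 := by
  obtain ⟨F, hF⟩ := hS
  have hdep : ¬ AlgebraicIndependent ℂ fun p : ι × ι => F p.1 p.2 := by
    intro h
    -- The transcendence degree of the polynomial ring is the number of parameters.
    have h1 := h.cardinalMk_le_trdeg
    rw [MvPolynomial.trdeg_of_isDomain, Cardinal.lift_uzero, Cardinal.mk_fintype,
      Cardinal.mk_fintype, Nat.cast_le, Fintype.card_prod] at h1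
    omega
  rw [algebraicIndependent_iff] at hdep
  push Not at hdep
  obtain ⟨Q, h1, h2⟩ := hdep
  refine ⟨Q, h2, fun M hM => ?_⟩
  obtain ⟨v, rfl⟩ := hF M hM
  rw [entryEval_map_eval, h1, map_zero]

end PolyCovered

/-! ### Normal form of a circuit: two-qudit gates after a layer of one-qudit gates -/

/-- The tensor product `⊗ₖ V k`. -/
def layer {κ : Type*} [Fintype κ] {d : ℕ} (V : κ → Op1 d) : Matrix (κ → Fin d) (κ → Fin d) ℂ :=
  fun x y => ∏ k, V k (x k) (y k)

section layer

variable {d n : ℕ}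

theorem layer_mul {κ : Type*} [Fintype κ] [DecidableEq κ] (V W : κ → Op1 d) :
    layer V * layer W = layer fun k => V k * W k := by
  ext x y
  simp only [layer, Matrix.mul_apply, ← Finset.prod_mul_distrib]
  rw [Finset.prod_univ_sum, Fintype.piFinset_univ]

theorem layer_one {κ : Type*} [Fintype κ] [DecidableEq κ] :
    layer (fun _ : κ => (1 : Op1 d)) = 1 := by
  ext x y
  simp only [layer, Matrix.one_apply, Finset.prod_ite_zero, funext_iff]
  simp

theorem toMatrix_one_eq_layer (i : Fin n) (V : Op1 d) :
    (Gate.one i V).toMatrix = layer (Function.update (fun _ => 1) i V) := by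
  ext x y
  rw [layer, ← Finset.mul_prod_erase _ _ (Finset.mem_univ i), Function.update_self,
    Finset.prod_congr rfl (g := fun k => if x k = y k then 1 else 0), Finset.prod_ite_zero]
  · simp only [Finset.mem_erase, Finset.mem_univ, and_true, Finset.prod_const_one, Gate.toMatrix]
    split_ifs <;> simp
  · intro k hk
    rw [Function.update_of_ne (Finset.ne_of_mem_erase hk), Matrix.one_apply]

open scoped Kronecker

theorem layer_eq_kronecker {i j : Fin n} (h : i ≠ j) (V : Fin n → Op1 d) :
    layer V = ((V i ⊗ₖ V j) ⊗ₖ layer fun k : {k // k ≠ i ∧ k ≠ j} => V k).submatrix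
      (splitTwo h) (splitTwo h) := by
  ext x y
  simp only [layer, Matrix.submatrix_apply, Matrix.kroneckerMap_apply, splitTwo, Equiv.coe_fn_mk]
  rw [← Finset.mul_prod_erase _ _ (Finset.mem_univ i),
    ← Finset.mul_prod_erase _ _ (Finset.mem_erase.2 ⟨h.symm, Finset.mem_univ j⟩), mul_assoc]
  congr 2
  refine (Finset.prod_subtype _ (fun k => ?_) fun k => V k (x k) (y k))
  simp [and_comm]

theorem toMatrix_two_eq_kronecker {i j : Fin n} (h : i ≠ j) (W : Op2 d) :
    (Gate.two i j W).toMatrix = (W ⊗ₖ (1 : Matrix ({k // k ≠ i ∧ k ≠ j} → Fin d) _ ℂ)).submatrix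
      (splitTwo h) (splitTwo h) := by
  ext x y
  have h1 : (∀ k, k ≠ i → k ≠ j → x k = y k) ↔ (splitTwo h x).2 = (splitTwo h y).2 := by
    simp [splitTwo, funext_iff]
  rw [Matrix.submatrix_apply, Matrix.kroneckerMap_apply, Matrix.one_apply, Gate.toMatrix]
  simp only [h1, mul_ite, mul_one, mul_zero]
  rfl

/-- A layer can be moved past a two-qudit gate. -/
theorem layer_mul_two {i j : Fin n} (h : i ≠ j) (V : Fin n → Op1 d) (W : Op2 d) :
    ∃ (V' : Fin n → Op1 d) (W' : Op2 d),
      layer V * (Gate.two i j W).toMatrix = (Gate.two i j W').toMatrix * layer V' := by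
  -- The factors on `i` and `j` are absorbed into `W`; the others act on different lines and commute
  -- with it.
  refine ⟨fun k => if k = i ∨ k = j then 1 else V k, (V i ⊗ₖ V j) * W, ?_⟩
  have hV : (fun k : {k // k ≠ i ∧ k ≠ j} => if (k : Fin n) = i ∨ (k : Fin n) = j then
      (1 : Op1 d) else V k) = fun k : {k // k ≠ i ∧ k ≠ j} => V k := by
    ext1 k
    rw [if_neg (by simpa using k.2)]
  rw [layer_eq_kronecker h V, layer_eq_kronecker h, toMatrix_two_eq_kronecker h,
    toMatrix_two_eq_kronecker h, Matrix.submatrix_mul_equiv, Matrix.submatrix_mul_equiv,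
    ← Matrix.mul_kronecker_mul, ← Matrix.mul_kronecker_mul, hV]
  simp

/-- The products of two-qudit gates on the pairs of lines of a list, the head performed first,
after a layer of one-qudit gates. -/
def shapeSet (d : ℕ) {n : ℕ} : List (Fin n × Fin n) → Set (OpN d n)
  | [] => {1}
  | p :: s => Set.image2 (· * ·) (shapeSet d s) (Set.range fun W => (Gate.two p.1 p.2 W).toMatrix)

/-- One-qudit gates collect in the layer performed first. Unitarity is dropped; it supplies only `i
≠ j`, and a larger family does no harm to the parameter count. -/
theorem eval_mem_shapeSet : ∀ C : Circuit d n, (∀ g ∈ C, g.IsUnitary) →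
    ∃ s : List (Fin n × Fin n), s.length = C.twoCount ∧
      C.eval ∈ Set.image2 (· * ·) (shapeSet d s) (Set.range layer)
  | [], _ => ⟨[], rfl, 1, rfl, 1, ⟨_, layer_one⟩, mul_one _⟩
  | .one i V :: C, h => by
    obtain ⟨s, hs, A, hA, _, ⟨L, rfl⟩, hC⟩ :=
      eval_mem_shapeSet C fun g hg => h g (List.mem_cons_of_mem _ hg)
    refine ⟨s, by simpa [Circuit.twoCount, Gate.isTwo] using hs, A, hA, _,
      ⟨fun k => L k * Function.update (fun _ => (1 : Op1 d)) i V k, rfl⟩, ?_⟩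
    rw [Circuit.eval, ← hC, toMatrix_one_eq_layer, mul_assoc, layer_mul]
  | .two i j W :: C, h => by
    obtain ⟨s, hs, A, hA, _, ⟨L, rfl⟩, hC⟩ :=
      eval_mem_shapeSet C fun g hg => h g (List.mem_cons_of_mem _ hg)
    obtain ⟨V', W', hW⟩ := layer_mul_two (h _ List.mem_cons_self).1 L W
    refine ⟨(i, j) :: s, by
        rw [List.length_cons, hs, Circuit.twoCount, Circuit.twoCount, List.countP_cons_of_pos rfl],
      A * (Gate.two i j W').toMatrix, ⟨A, hA, _, ⟨W', rfl⟩, rfl⟩, _, ⟨V', rfl⟩, ?_⟩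
    rw [Circuit.eval, ← hC]
    simp only [mul_assoc, hW]

theorem polyCovered_two (i j : Fin n) :
    PolyCovered ((Fin d × Fin d) × (Fin d × Fin d))
      (Set.range fun W : Op2 d => (Gate.two i j W).toMatrix) := by
  classical
  refine ⟨.of fun x y => if ∀ k, k ≠ i → k ≠ j → x k = y k then
    MvPolynomial.X ((x i, x j), (y i, y j)) else 0, ?_⟩
  rintro _ ⟨W, rfl⟩
  refine ⟨fun p => W p.1 p.2, ?_⟩
  ext x y
  rw [Matrix.map_apply, Matrix.of_apply, apply_ite (MvPolynomial.eval _), MvPolynomial.eval_X,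
    map_zero]
  simp only [Gate.toMatrix]

theorem polyCovered_layer :
    PolyCovered (Fin n × Fin d × Fin d) (Set.range (layer : (Fin n → Op1 d) → OpN d n)) := by
  refine ⟨.of fun x y => ∏ k, MvPolynomial.X (k, x k, y k), ?_⟩
  rintro _ ⟨V, rfl⟩
  refine ⟨fun p => V p.1 p.2.1 p.2.2, ?_⟩
  ext x y
  simp [layer, map_prod]

theorem exists_polyCovered_shapeSet : ∀ s : List (Fin n × Fin n),
    ∃ (σ : Type) (_ : Fintype σ), Fintype.card σ = s.length * d ^ 4 ∧
      PolyCovered σ (shapeSet d s)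
  | [] => ⟨Empty, inferInstance, by simp, 1, by
      rintro _ rfl
      refine ⟨Empty.elim, ?_⟩
      rw [Matrix.map_one _ (map_zero _) (map_one _)]⟩
  | p :: s => by
    obtain ⟨σ, hσ, hc, h⟩ := exists_polyCovered_shapeSet s
    refine ⟨_, inferInstance, ?_, h.mul (polyCovered_two p.1 p.2)⟩
    simp only [Fintype.card_sum, hc, Fintype.card_prod, Fintype.card_fin, List.length_cons]
    ring

/-- If the circuits with at most `N` two-qudit gates have fewer parameters than a matrix has
entries, then they do not represent all the unitary matrices. -/
theorem exists_unitary_twoCount_gt {N : ℕ} (hN : N * d ^ 4 + n * d ^ 2 < d ^ (2 * n)) :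
    ∃ U ∈ Matrix.unitaryGroup (Fin n → Fin d) ℂ,
      ∀ C : Circuit d n, (∀ g ∈ C, g.IsUnitary) → C.eval = U → N < C.twoCount := by
  have hQ : ∀ s : List (Fin n × Fin n), s.length ≤ N →
      ∃ Q : MvPolynomial ((Fin n → Fin d) × (Fin n → Fin d)) ℂ, Q ≠ 0 ∧
        ∀ M ∈ Set.image2 (· * ·) (shapeSet d s) (Set.range layer), entryEval M Q = 0 := by
    intro s hs
    obtain ⟨σ, _, hc, hσ⟩ := exists_polyCovered_shapeSet (d := d) s
    refine (hσ.mul polyCovered_layer).exists_ne_zero ?_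
    have h1 : s.length * d ^ 4 ≤ N * d ^ 4 := Nat.mul_le_mul_right _ hs
    have h2 : d ^ n * d ^ n = d ^ (2 * n) := by rw [← pow_add, two_mul]
    have h3 : n * (d * d) = n * d ^ 2 := by rw [sq]
    simp only [Fintype.card_sum, hc, Fintype.card_prod, Fintype.card_fin, Fintype.card_pi,
      Finset.prod_const, Finset.card_univ, h2, h3]
    omega
  choose! Q hQ0 hQ using hQ
  have hfin := List.finite_length_le (Fin n × Fin n) N
  by_contra! hcon
  -- The number of shapes is finite, so the equations multiply to one equation satisfied by every
  -- unitary.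
  have hprod : ∏ s ∈ hfin.toFinset, Q s = 0 := by
    refine eq_zero_of_entryEval_unitary fun U hU => ?_
    obtain ⟨C, hC, rfl, hle⟩ := hcon U hU
    obtain ⟨s, hs, hmem⟩ := eval_mem_shapeSet C hC
    rw [entryEval, map_prod]
    exact Finset.prod_eq_zero (hfin.mem_toFinset.2 (hs.trans_le hle)) (hQ s (hs.trans_le hle) _ hmem)
  rw [Finset.prod_eq_zero_iff] at hprod
  obtain ⟨s, hs, h0⟩ := hprod
  exact hQ0 s (hfin.mem_toFinset.1 hs) h0

end layer

-- Half of the `d ^ (2 * n)` entries is allotted to the two-qudit gates, which gives the constant `1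
-- / (2 * d ^ 4)`; the other half eventually exceeds the `n * d ^ 2` parameters of the layer.
open Filter in
theorem eventually_exists_twoCount_ge {d : ℕ} (hd : 2 ≤ d) :
    ∀ᶠ n : ℕ in atTop, ∃ U ∈ Matrix.unitaryGroup (Fin n → Fin d) ℂ,
      ∀ C : Circuit d n, (∀ g ∈ C, g.IsUnitary) → C.eval = U →
        1 / (2 * (d : ℝ) ^ 4) * (d : ℝ) ^ (2 * n) ≤ (C.twoCount : ℝ) := by
  have hd' : (2 : ℝ) ≤ d := by exact_mod_cast hd
  have hlim : Tendsto (fun n : ℕ => (n : ℝ) * ((1 : ℝ) / 4) ^ n) atTop (nhds 0) :=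
    tendsto_self_mul_const_pow_of_lt_one (by norm_num) (by norm_num)
  have hpos : (0 : ℝ) < 1 / (2 * (d : ℝ) ^ 2) := by positivity
  filter_upwards [hlim.eventually_lt_const hpos] with n hn
  have hlin : (n : ℝ) * d ^ 2 < d ^ (2 * n) / 2 := by
    have h1 : (4 : ℝ) ^ n ≤ d ^ (2 * n) := by
      rw [pow_mul]
      gcongr
      nlinarith
    rw [one_div, inv_pow, ← div_eq_mul_inv, div_lt_div_iff₀ (by positivity) (by positivity)] at hn
    linarith
  -- `N` is the largest integer strictly below the claimed bound, so more than `N` gates means at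
  -- least that bound.
  set N : ℕ := ⌈1 / (2 * (d : ℝ) ^ 4) * (d : ℝ) ^ (2 * n)⌉₊ - 1 with hNdef
  have hx : 0 < 1 / (2 * (d : ℝ) ^ 4) * (d : ℝ) ^ (2 * n) := by positivity
  have hceil : 0 < ⌈1 / (2 * (d : ℝ) ^ 4) * (d : ℝ) ^ (2 * n)⌉₊ := Nat.ceil_pos.2 hx
  have hNlt : (N : ℝ) < 1 / (2 * (d : ℝ) ^ 4) * (d : ℝ) ^ (2 * n) := Nat.lt_ceil.1 (by omega)
  have hN : N * d ^ 4 + n * d ^ 2 < d ^ (2 * n) := by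
    have h2 : (N : ℝ) * d ^ 4 ≤ d ^ (2 * n) / 2 := by
      calc (N : ℝ) * d ^ 4 ≤ 1 / (2 * (d : ℝ) ^ 4) * (d : ℝ) ^ (2 * n) * d ^ 4 := by gcongr
        _ = _ := by field_simp
    have h3 : (N : ℝ) * d ^ 4 + n * d ^ 2 < d ^ (2 * n) := by linarith
    exact_mod_cast h3
  obtain ⟨U, hU, h⟩ := exists_unitary_twoCount_gt hN
  refine ⟨U, hU, fun C hC hCU => Nat.ceil_le.1 ?_⟩
  have := h C hC hCU
  omega

end

end QuditTriangle

open QuditTriangle Filter Asymptotics in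
theorem mainTheorem4 (d : ℕ) [NeZero d] (hd : 2 ≤ d) :
    -- Triangle reduces every unitary to diagonal form by unitary controlled operations
    (∀ n : ℕ, 1 ≤ n → ∀ U ∈ Matrix.unitaryGroup (Fin n → Fin d) ℂ,
      (∀ o ∈ triangle n U, o.gate ∈ Matrix.unitaryGroup (Fin d) ℂ) ∧
      (run (triangle n U) * U).IsDiag) ∧
    -- the number of its `k`-controlled operations
    (∃ f : ℕ → ℕ → ℕ,
      (∀ n : ℕ, 1 ≤ n → ∀ U ∈ Matrix.unitaryGroup (Fin n → Fin d) ℂ, ∀ k : ℕ,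
        (triangle n U).countP (fun o => o.numControls = k) = f n k) ∧
      (∀ᶠ n : ℕ in atTop, ∀ k : ℕ, (f n k : ℝ) ≤ (d : ℝ) ^ (2 * (n : ℤ) - (k : ℤ) + 4))) ∧
    -- the resulting circuit over one-qudit unitaries, `CINC` and `CINC⁻¹`, and its cost
    (∀ n : ℕ, 1 ≤ n → ∀ U ∈ Matrix.unitaryGroup (Fin n → Fin d) ℂ,
      (∀ g ∈ synthesize n U, g.InLibrary) ∧
      (synthesize n U).eval = U ∧
      ((synthesize n U).twoCount : ℝ) ≤
        2 * ((n : ℝ) + 1) ^ (2 + Real.logb 2 d) * (d : ℝ) ^ (n + 4)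
          + 26 * (d : ℝ) ^ (2 * n + 8)) ∧
    ((fun n : ℕ => 2 * ((n : ℝ) + 1) ^ (2 + Real.logb 2 d) * (d : ℝ) ^ (n + 4)
          + 26 * (d : ℝ) ^ (2 * n + 8)) =O[atTop] fun n : ℕ => (d : ℝ) ^ (2 * n)) ∧
    -- optimality: some unitary needs that many two-qudit gates, whichever these are
    (∃ a : ℝ, 0 < a ∧ ∀ᶠ n : ℕ in atTop,
      ∃ U ∈ Matrix.unitaryGroup (Fin n → Fin d) ℂ,
        ∀ C : Circuit d n, (∀ g ∈ C, g.IsUnitary) → C.eval = U →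
          a * (d : ℝ) ^ (2 * n) ≤ (C.twoCount : ℝ)) := by
  -- Since the control patterns do not depend on the input, the counting function is read off from
  -- the zero matrix.
  refine ⟨fun n hn U hU => ⟨?_, ?_⟩, ⟨fun n k => (triangle n (0 : OpN d n)).countP
    fun o => o.numControls = k, fun n _ U _ k => (oblivious_triangle n).countP_eq U 0 k,
    Eventually.of_forall fun n k => countP_triangle_le hd 0 k⟩, fun n hn U hU => ?_,
    cost_isBigO hd, 1 / (2 * (d : ℝ) ^ 4), by positivity, eventually_exists_twoCount_ge hd⟩
  · exact triangle_gate_mem n U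
  · exact run_triangle_mul_isDiag hU
  · have h := realizes_synthesize hn hU
    exact ⟨h.lib, h.eval, twoCount_synthesize_le hd hn U⟩
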